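/- Notation. Let $p=e_*+h_*+2s_*$ and write $z=(z',z'')\in\mathbb C^p\times\mathbb C^p$. The product quadric $Q\subset\mathbb C^{2p}$, $z_{p+j}=Q_j(z',\bar z')$ $(1\le j\le p)$, is given by $$Q_e=(z_e+2\gamma_e\bar z_e)^2,\quad Q_h=(z_h+2\gamma_h\bar z_h)^2,\quad Q_s=(z_s+2\gamma_s\bar z_{s+s_*})^2,\quad Q_{s+s_*}=(z_{s+s_*}+2(1-\bar\gamma_s)\bar z_s)^2,$$ for $e_*$ elliptic indices $e$, $h_*$ hyperbolic indices $h$ and $s_*$ indices $s$ of complex type, where $0<\gamma_e<1/2<\gamma_h\le\infty$ (with $Q_h=z_h^2+\bar z_h^2$ if $\gamma_h=\infty$), $\gamma_s\in\mathbb C$, $\operatorname{Re}\gamma_s\le 1/2$, $\operatorname{Im}\gamma_s\ge0$, $\gamma_s\ne0,1/2$. Let $\tau_1(z',w')=(z',-w'-\boldsymbol\gamma^{-1}z')$ be the deck transformation of $(z',w')\mapsto(z',Q(z',w'))$ that changes the sign of all $p$ linear forms being squared, $\rho_0(z',w')=(\bar w',\bar z')$, $\tau_2=\rho_0\tau_1\rho_0$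 and $\sigma=\tau_1\tau_2$. The eigenvalues of $\sigma$ are numbers $\mu_j,\mu_j^{-1}$ $(1\le j\le p)$, where $\mu_h=\lambda_h^2$ with $|\lambda_h|=1$, $\lambda_h+\bar\lambda_h=\gamma_h^{-1}$, $\operatorname{Im}\lambda_h>0$, and $\mu_s=\bar\gamma_s^{-1}-1$, $\mu_{s+s_*}=\bar\mu_s^{-1}$. A third-order perturbation of $Q$ is a formal submanifold $M:\ z_{p+j}=Q_j(z',\bar z')+H_j(z',\bar z')$, where the $H_j$ are formal power series without terms of order less than $3$. A formal complex submanifold $K$ of dimension $p$ through $0$ is attached to $M$ if $K\cap M$ contains two totally real formal submanifolds $K_1,K_2$ of dimension $p$ that intersect transversally at the origin; then $\{K_1,K_2\}$ is called a pair of asymptotic formal submanifolds of $M$. A formal deck transformation of $M:\ z''=E(z',\bar z')$ is a formal biholomorphic map $(z',w')\mapsto(z',f(z',w'))$ fixing $0$ with $E(z',f(z',w'))=E(z',w')$; their maximal number is $2^p$. For a formal anti-holomorphic map $\rho$ we write $\bar\rho(z')=\overline{\rho(z')}$. Lemma. Let $p\ge1$, let $M$ be a third-order perturbation of a product quadric $Q$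 in $\mathbb C^{2p}$, and assume that $\sigma$ has $2p$ distinct eigenvalues. (i) If $M$ admits an attached formal submanifold, then $e_*=0$. (ii) If $e_*=0$, then there is a complex submanifold $K$ (given by convergent power series) attached to $Q$ such that at least $2^{h_*+s_*-1}$ pairs of asymptotic totally real and real analytic submanifolds of $Q$ are contained in $K$. (iii) For $p=2$ and all real $\gamma_1,\gamma_2>1/2$, there is no formal submanifold attached to $$z_3=(z_1+2\gamma_1\bar z_1)^2+(z_2+2\gamma_2\bar z_2)^3,\qquad z_4=(z_2+2\gamma_2\bar z_2)^2 .$$ (iv) Let $e_*=0$ and assume that $M$ has the maximum number $2^p$ of formal deck transformations. Given signs $\epsilon_h,\epsilon_s=\pm1$, let $\nu=\nu_\epsilon=(\nu_1,\dots,\nu_p)$ with $\nu_h=\mu_h^{\epsilon_h}$, $\nu_s=\bar\mu_s^{\epsilon_s}$, $\nu_{s+s_*}=\mu_s^{-\epsilon_s}$. Suppose that $$\nu^P\ne\nu_j^{-1}\quad\text{for all }P\in\mathbb N^p\text{ with }|P|>0\text{ and all }1\le j\le p.\qquad(*)$$ Then $M$ admits a unique pair of asymptotic formal submanifolds $K_1,K_2$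 such that each $K_i$ is defined in $M$ by $z'=\rho_i(z')$ for a formal anti-holomorphic involution $\rho_i$, and the linear part of $\bar\rho_2^{-1}\bar\rho_1$ has eigenvalues $\nu_1,\dots,\nu_p$. In particular, if $(*)$ holds for every $\nu_\epsilon$, then $M$ admits exactly $2^{h_*+s_*-1}$ pairs of asymptotic formal submanifolds. -/

import Mathlib

open scoped ENNReal ComplexConjugate

noncomputable section

namespace CRSing

/-! ### Formal power series in `z` and `z̄` -/

/-- Formal power series in the coordinates `z` of `ℂ^σ` and their conjugates:
`Sum.inl j` is the variable `z_j`, `Sum.inr j` is the variable `z̄_j`.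
This is the complexification of the ring `ℝ[[x, y]]`, `z = x + i y`. -/
abbrev RealSeries (σ : Type) : Type := MvPowerSeries (σ ⊕ σ) ℂ

/-- Complex conjugation on power series in `z, z̄`: conjugate the coefficients and exchange
`z` and `z̄`.  Its fixed points are the real valued series, i.e. the elements of `ℝ[[x, y]]`. -/
def conjSeries {σ : Type} [Finite σ] : RealSeries σ →+* RealSeries σ :=
  (MvPowerSeries.rename (R := ℂ) (Sum.swap : σ ⊕ σ → σ ⊕ σ)).toRingHom.comp
    (MvPowerSeries.map (starRingEnd ℂ))

/-- A holomorphic power series in `z`, seen as a power series in `z, z̄`. -/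
def ofHol {σ : Type} [Finite σ] (f : MvPowerSeries σ ℂ) : RealSeries σ :=
  MvPowerSeries.rename (R := ℂ) (Sum.inl : σ → σ ⊕ σ) f

/-- The coefficient of the linear monomial `x_i`. -/
def linCoeff {τ : Type} (i : τ) (f : MvPowerSeries τ ℂ) : ℂ :=
  MvPowerSeries.coeff (Finsupp.single i 1) f

/-- A power series converges in a neighbourhood of the origin. -/
def IsConvergent {τ : Type} (f : MvPowerSeries τ ℂ) : Prop :=
  ∃ C r : ℝ, ∀ n : τ →₀ ℕ, ‖MvPowerSeries.coeff n f‖ ≤ C * r ^ n.degree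

/-- The differential at the origin of a power series in `z, z̄`, as a real linear form on `ℂ^σ`. -/
def diffAtZero {σ : Type} [Fintype σ] (f : RealSeries σ) (v : σ → ℂ) : ℂ :=
  ∑ j, linCoeff (Sum.inl j) f * v j + ∑ j, linCoeff (Sum.inr j) f * conj (v j)

/-! ### Formal submanifolds, represented by their ideals -/

/-- The tangent space at the origin of the formal subset of `ℂ^σ` with ideal `I`. -/
def tangentSpace {σ : Type} [Fintype σ] (I : Ideal (RealSeries σ)) : Submodule ℝ (σ → ℂ) where
  carrier := {v | ∀ f ∈ I, diffAtZero f v = 0}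
  zero_mem' := fun f _ => by simp [diffAtZero]
  add_mem' := by
    intro a b ha hb f hf
    have h1 := ha f hf
    have h2 := hb f hf
    simp only [diffAtZero, Pi.add_apply, map_add, mul_add, Finset.sum_add_distrib] at h1 h2 ⊢
    linear_combination h1 + h2
  smul_mem' := by
    intro c a ha f hf
    have h1 := ha f hf
    simp only [diffAtZero, Pi.smul_apply, Complex.real_smul, map_mul, Complex.conj_ofReal,
      mul_left_comm _ (c : ℂ), ← Finset.mul_sum] at h1 ⊢
    rw [← mul_add, h1, mul_zero]

/-- `I` is the ideal of a formal real submanifold of real codimension `k` through the origin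
of `ℂ^σ`: it is generated by `k` real valued series that vanish at the origin and have linearly
independent differentials there. -/
def IsFormalSubmanifold {σ : Type} [Finite σ] (k : ℕ) (I : Ideal (RealSeries σ)) : Prop :=
  ∃ r : Fin k → RealSeries σ,
    (∀ i, MvPowerSeries.constantCoeff (r i) = 0) ∧
    (∀ i, conjSeries (r i) = r i) ∧
    LinearIndependent ℂ (fun i => fun x : σ ⊕ σ => linCoeff x (r i)) ∧
    I = Ideal.span (Set.range r)

/-- As `IsFormalSubmanifold`, with convergent defining functions: the ideal of a germ of a real
analytic submanifold. -/
def IsAnalyticSubmanifold {σ : Type} [Finite σ] (k : ℕ) (I : Ideal (RealSeries σ)) : Prop :=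
  ∃ r : Fin k → RealSeries σ,
    (∀ i, IsConvergent (r i)) ∧
    (∀ i, MvPowerSeries.constantCoeff (r i) = 0) ∧
    (∀ i, conjSeries (r i) = r i) ∧
    LinearIndependent ℂ (fun i => fun x : σ ⊕ σ => linCoeff x (r i)) ∧
    I = Ideal.span (Set.range r)

/-- `I` is the ideal of a formal complex submanifold of complex codimension `k` through the
origin of `ℂ^σ`: it is generated by `k` holomorphic series, with independent differentials,
and by their conjugates. -/
def IsFormalComplexSubmanifold {σ : Type} [Finite σ] (k : ℕ) (I : Ideal (RealSeries σ)) : Prop :=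
  ∃ f : Fin k → MvPowerSeries σ ℂ,
    (∀ i, MvPowerSeries.constantCoeff (f i) = 0) ∧
    LinearIndependent ℂ (fun i => fun x : σ => linCoeff x (f i)) ∧
    I = Ideal.span (Set.range (fun i => ofHol (f i)) ∪
      Set.range (fun i => conjSeries (ofHol (f i))))

/-- As `IsFormalComplexSubmanifold`, with convergent defining functions: the ideal of a germ of a
complex submanifold. -/
def IsComplexSubmanifold {σ : Type} [Finite σ] (k : ℕ) (I : Ideal (RealSeries σ)) : Prop :=
  ∃ f : Fin k → MvPowerSeries σ ℂ,
    (∀ i, IsConvergent (f i)) ∧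
    (∀ i, MvPowerSeries.constantCoeff (f i) = 0) ∧
    LinearIndependent ℂ (fun i => fun x : σ => linCoeff x (f i)) ∧
    I = Ideal.span (Set.range (fun i => ofHol (f i)) ∪
      Set.range (fun i => conjSeries (ofHol (f i))))

/-- The tangent space at the origin contains no complex line. -/
def IsTotallyReal {σ : Type} [Fintype σ] (I : Ideal (RealSeries σ)) : Prop :=
  ∀ v ∈ tangentSpace I, Complex.I • v ∈ tangentSpace I → v = 0

/-! ### Submanifolds `z'' = E(z', z̄')` of `ℂ^{2p}`

The `p` coordinates `z'` are indexed by `ι`, the coordinates `z = (z', z'')` of `ℂ^{2p}` by `ι ⊕ ι`.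
The series `E_j` in `(z', w')`, to be evaluated at `w' = z̄'`, lie in
`MvPowerSeries (ι ⊕ ι) ℂ`, where `Sum.inl j` is `z_j` and `Sum.inr j` is `w_j`. -/

section Manifold

variable {ι : Type} [Fintype ι]

/-- `E(z', z̄')` as a series on `ℂ^{2p}`. -/
def evalBar (E : MvPowerSeries (ι ⊕ ι) ℂ) : RealSeries (ι ⊕ ι) :=
  MvPowerSeries.rename (R := ℂ)
    (Sum.map Sum.inl Sum.inl : ι ⊕ ι → (ι ⊕ ι) ⊕ (ι ⊕ ι)) E

/-- The defining function `z_{p+j} - E_j(z', z̄')`. -/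
def graphFun (E : ι → MvPowerSeries (ι ⊕ ι) ℂ) (j : ι) : RealSeries (ι ⊕ ι) :=
  MvPowerSeries.X (Sum.inl (Sum.inr j)) - evalBar (E j)

/-- The ideal of the formal real submanifold `M : z_{p+j} = E_j(z', z̄')` of `ℂ^{2p}`. -/
def manifold (E : ι → MvPowerSeries (ι ⊕ ι) ℂ) : Ideal (RealSeries (ι ⊕ ι)) :=
  Ideal.span (Set.range (graphFun E) ∪ Set.range (fun j => conjSeries (graphFun E j)))

/-- `K` is a formal complex submanifold of dimension `p` of `ℂ^{2p}`, and `K₁, K₂` are totally real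
formal submanifolds of dimension `p` contained in `K ∩ M` that intersect transversally
at the origin. Inclusions of submanifolds are reversed inclusions of ideals. -/
def IsAttachedAlong (M K K₁ K₂ : Ideal (RealSeries (ι ⊕ ι))) : Prop :=
  IsFormalComplexSubmanifold (Fintype.card ι) K ∧
  IsFormalSubmanifold (3 * Fintype.card ι) K₁ ∧ IsFormalSubmanifold (3 * Fintype.card ι) K₂ ∧
  IsTotallyReal K₁ ∧ IsTotallyReal K₂ ∧
  K ⊔ M ≤ K₁ ∧ K ⊔ M ≤ K₂ ∧
  tangentSpace K₁ ⊓ tangentSpace K₂ = ⊥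

/-- `K` is a formal complex submanifold attached to `M`. -/
def IsAttached (M K : Ideal (RealSeries (ι ⊕ ι))) : Prop :=
  ∃ K₁ K₂, IsAttachedAlong M K K₁ K₂

/-- `{K₁, K₂}` is a pair of asymptotic formal submanifolds of `M`. -/
def IsAsymptoticPair (M K₁ K₂ : Ideal (RealSeries (ι ⊕ ι))) : Prop :=
  ∃ K, IsAttachedAlong M K K₁ K₂

/-- The set of (unordered) pairs of asymptotic formal submanifolds of `M`. -/
def asymptoticPairs (M : Ideal (RealSeries (ι ⊕ ι))) : Set (Sym2 (Ideal (RealSeries (ι ⊕ ι)))) :=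
  {S | ∃ K₁ K₂, S = s(K₁, K₂) ∧ IsAsymptoticPair M K₁ K₂}

/-- The set of (unordered) pairs of asymptotic real analytic submanifolds of `M` that
are contained in the attached submanifold `K`. -/
def analyticAsymptoticPairsIn (M K : Ideal (RealSeries (ι ⊕ ι))) :
    Set (Sym2 (Ideal (RealSeries (ι ⊕ ι)))) :=
  {S | ∃ K₁ K₂, S = s(K₁, K₂) ∧ IsAttachedAlong M K K₁ K₂ ∧
    IsAnalyticSubmanifold (3 * Fintype.card ι) K₁ ∧
    IsAnalyticSubmanifold (3 * Fintype.card ι) K₂}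

/-- The formal deck transformations `(z', w') ↦ (z', f(z', w'))` of the projection
`π₁(z', w') = (z', E(z', w'))` of the complexification of `M`, given by the vector `f`. -/
def formalDeckTransformations [DecidableEq ι] (E : ι → MvPowerSeries (ι ⊕ ι) ℂ) :
    Set (ι → MvPowerSeries (ι ⊕ ι) ℂ) :=
  {f | (∀ j, MvPowerSeries.constantCoeff (f j) = 0) ∧
    IsUnit (Matrix.of fun j k => linCoeff (Sum.inr k) (f j)).det ∧
    ∀ j, MvPowerSeries.subst (Sum.elim (fun i => MvPowerSeries.X (Sum.inl i)) f) (E j) = E j}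

/-- `M` has the maximum number `2^p` of formal deck transformations. -/
def HasMaximalDeck [DecidableEq ι] (E : ι → MvPowerSeries (ι ⊕ ι) ℂ) : Prop :=
  (formalDeckTransformations E).encard = 2 ^ Fintype.card ι

/-- `ρ(z') = conj (P(z'))` is a formal anti-holomorphic involution of `ℂ^p` fixing the origin:
`P` is the holomorphic map `ρ̄`, and `ρ (ρ (z')) = P^c (P (z'))`, where `P^c` has the conjugate
coefficients. -/
def IsAntiholomorphicInvolution (P : ι → MvPowerSeries ι ℂ) : Prop :=
  (∀ j, MvPowerSeries.constantCoeff (P j) = 0) ∧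
  ∀ j, MvPowerSeries.subst P (MvPowerSeries.map (starRingEnd ℂ) (P j)) =
    (MvPowerSeries.X j : MvPowerSeries ι ℂ)

/-- The function `z̄_j - P_j(z')` on `ℂ^{2p}`, the conjugate of `z_j - ρ_j(z')`. -/
def fixFun (P : ι → MvPowerSeries ι ℂ) (j : ι) : RealSeries (ι ⊕ ι) :=
  MvPowerSeries.X (Sum.inr (Sum.inl j)) - ofHol (MvPowerSeries.rename (R := ℂ) Sum.inl (P j))

/-- The ideal of the subset of `M` defined by `z' = ρ(z')`, with `ρ = conj ∘ P`. -/
def fixedIn (M : Ideal (RealSeries (ι ⊕ ι))) (P : ι → MvPowerSeries ι ℂ) :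
    Ideal (RealSeries (ι ⊕ ι)) :=
  M ⊔ Ideal.span (Set.range (fixFun P) ∪ Set.range (fun j => conjSeries (fixFun P j)))

/-- The matrix of the linear part at the origin of a formal map of `ℂ^p`. -/
def linearPart (P : ι → MvPowerSeries ι ℂ) : Matrix ι ι ℂ :=
  Matrix.of fun j k => linCoeff k (P j)

end Manifold

/-! ### Product quadrics -/

/-- The indices of the `p = e + h + 2 s` coordinates `z'`: `e` elliptic ones, `h` hyperbolic ones,
and `s` couples `(z_s, z_{s + s_*})` of complex type. -/
abbrev Index (e h s : ℕ) : Type := Fin e ⊕ Fin h ⊕ Fin s ⊕ Fin s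

namespace Index

/-- Elliptic coordinate. -/
abbrev ell {e h s : ℕ} (i : Fin e) : Index e h s := Sum.inl i
/-- Hyperbolic coordinate. -/
abbrev hyp {e h s : ℕ} (i : Fin h) : Index e h s := Sum.inr (Sum.inl i)
/-- First coordinate `z_s` of a couple of complex type. -/
abbrev fst {e h s : ℕ} (i : Fin s) : Index e h s := Sum.inr (Sum.inr (Sum.inl i))
/-- Second coordinate `z_{s + s_*}` of a couple of complex type. -/
abbrev snd {e h s : ℕ} (i : Fin s) : Index e h s := Sum.inr (Sum.inr (Sum.inr i))

end Index

/-- The parameters of a product quadric with `e` elliptic, `h` hyperbolic and `s` complex factors. -/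
structure ProductQuadric (e h s : ℕ) where
  γe : Fin e → ℝ
  γh : Fin h → ℝ≥0∞
  γs : Fin s → ℂ
  γe_pos : ∀ i, 0 < γe i
  γe_lt : ∀ i, γe i < 1 / 2
  lt_γh : ∀ i, 1 / 2 < γh i
  γs_re : ∀ i, (γs i).re ≤ 1 / 2
  γs_im : ∀ i, 0 ≤ (γs i).im
  γs_ne_zero : ∀ i, γs i ≠ 0
  γs_ne_half : ∀ i, γs i ≠ 1 / 2

namespace ProductQuadric

variable {e h s : ℕ} (D : ProductQuadric e h s)

/-- The variable `z_j`. -/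
def zVar {ι : Type} (j : ι) : MvPowerSeries (ι ⊕ ι) ℂ := MvPowerSeries.X (Sum.inl j)

/-- The variable `w_j`, which stands for `z̄_j`. -/
def wVar {ι : Type} (j : ι) : MvPowerSeries (ι ⊕ ι) ℂ := MvPowerSeries.X (Sum.inr j)

/-- The right-hand sides `Q_j(z', w')` of the equations `z_{p+j} = Q_j(z', z̄')` of the product
quadric. -/
def quadric : Index e h s → MvPowerSeries (Index e h s ⊕ Index e h s) ℂ
  | Sum.inl i =>
      (zVar (Index.ell i) + (2 * (D.γe i : ℂ)) • wVar (Index.ell i)) ^ 2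
  | Sum.inr (Sum.inl i) =>
      if D.γh i = ⊤ then zVar (Index.hyp i) ^ 2 + wVar (Index.hyp i) ^ 2
      else (zVar (Index.hyp i) + (2 * ((D.γh i).toReal : ℂ)) • wVar (Index.hyp i)) ^ 2
  | Sum.inr (Sum.inr (Sum.inl i)) =>
      (zVar (Index.fst i) + (2 * D.γs i) • wVar (Index.snd i)) ^ 2
  | Sum.inr (Sum.inr (Sum.inr i)) =>
      (zVar (Index.snd i) + (2 * (1 - conj (D.γs i))) • wVar (Index.fst i)) ^ 2

/-- The matrix `γ⁻¹`, with `1 / ∞ = 0`. -/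
def gammaInv : Matrix (Index e h s) (Index e h s) ℂ
  | Sum.inl i, Sum.inl k => if i = k then (D.γe i : ℂ)⁻¹ else 0
  | Sum.inr (Sum.inl i), Sum.inr (Sum.inl k) => if i = k then (((D.γh i)⁻¹).toReal : ℂ) else 0
  | Sum.inr (Sum.inr (Sum.inl i)), Sum.inr (Sum.inr (Sum.inr k)) =>
      if i = k then (1 - conj (D.γs i))⁻¹ else 0
  | Sum.inr (Sum.inr (Sum.inr i)), Sum.inr (Sum.inr (Sum.inl k)) =>
      if i = k then (D.γs i)⁻¹ else 0
  | _, _ => 0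

/-- The deck transformation `τ₁ : (z', w') ↦ (z', -w' - γ⁻¹ z')` of `π₁` for the complexified
product quadric, namely the one whose set of fixed points has the smallest dimension `p`. -/
def tau₁ : Matrix (Index e h s ⊕ Index e h s) (Index e h s ⊕ Index e h s) ℂ :=
  Matrix.fromBlocks 1 0 (-D.gammaInv) (-1)

/-- `τ₂ = ρ τ₁ ρ`, with `ρ(z', w') = (conj w', conj z')`. -/
def tau₂ : Matrix (Index e h s ⊕ Index e h s) (Index e h s ⊕ Index e h s) ℂ :=
  Matrix.fromBlocks (-1) (-D.gammaInv.map conj) 0 1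

/-- `σ = τ₁ τ₂`. -/
def sigma : Matrix (Index e h s ⊕ Index e h s) (Index e h s ⊕ Index e h s) ℂ :=
  D.tau₁ * D.tau₂

/-- `σ` has `2p` distinct eigenvalues. -/
def HasDistinctEigenvalues : Prop :=
  (spectrum ℂ D.sigma).ncard = 2 * Fintype.card (Index e h s)

/-- `λ_h`, the number on the unit circle with `λ_h + conj λ_h = 1 / γ_h` and `0 < arg λ_h ≤ π / 2`. -/
def lamH (i : Fin h) : ℂ :=
  ⟨((D.γh i)⁻¹).toReal / 2, Real.sqrt (1 - (((D.γh i)⁻¹).toReal / 2) ^ 2)⟩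

/-- `μ_h = λ_h²`. -/
def muH (i : Fin h) : ℂ := D.lamH i ^ 2

/-- `μ_s = 1 / conj γ_s - 1`. -/
def muS (i : Fin s) : ℂ := (conj (D.γs i))⁻¹ - 1

/-- For a product quadric without elliptic component and signs `ε`, the numbers
`ν_h = μ_h ^ ε_h`, `ν_s = (conj μ_s) ^ ε_s`, `ν_{s + s_*} = μ_s ^ (-ε_s)`. -/
def nu (D : ProductQuadric 0 h s) (εh : Fin h → ℤˣ) (εs : Fin s → ℤˣ) : Index 0 h s → ℂ
  | Sum.inl i => i.elim0
  | Sum.inr (Sum.inl i) => D.muH i ^ ((εh i : ℤˣ) : ℤ)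
  | Sum.inr (Sum.inr (Sum.inl i)) => conj (D.muS i) ^ ((εs i : ℤˣ) : ℤ)
  | Sum.inr (Sum.inr (Sum.inr i)) => D.muS i ^ (-((εs i : ℤˣ) : ℤ))

end ProductQuadric

/-- `H` consists of terms of order at least three. -/
def IsThirdOrder {ι : Type} (H : ι → MvPowerSeries (ι ⊕ ι) ℂ) : Prop :=
  ∀ j, 3 ≤ (H j).order

/-- `ν^Q ≠ 1 / ν_j` for all multi-indices `Q ≠ 0` and all `j`. -/
def IsNonResonant {ι : Type} [Fintype ι] (ν : ι → ℂ) : Prop :=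
  ∀ Q : ι → ℕ, Q ≠ 0 → ∀ j, ∏ i, ν i ^ Q i ≠ (ν j)⁻¹

/-- The right-hand sides of `z₃ = (z₁ + 2γ₁ z̄₁)² + (z₂ + 2γ₂ z̄₂)³`, `z₄ = (z₂ + 2γ₂ z̄₂)²`. -/
def exampleE (γ₁ γ₂ : ℝ) : Fin 2 → MvPowerSeries (Fin 2 ⊕ Fin 2) ℂ :=
  ![(ProductQuadric.zVar 0 + (2 * (γ₁ : ℂ)) • ProductQuadric.wVar 0) ^ 2
      + (ProductQuadric.zVar 1 + (2 * (γ₂ : ℂ)) • ProductQuadric.wVar 1) ^ 3,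
    (ProductQuadric.zVar 1 + (2 * (γ₂ : ℂ)) • ProductQuadric.wVar 1) ^ 2]

end CRSing

end

/-! Dictionary. The quadric is $q_j(w_{\pi j}+g_jz_j/2)^2$, where $\pi$ swaps the two coordinates of
a complex couple and $g$ lists the entries of $\boldsymbol\gamma^{-1}$. Distinct eigenvalues of
$\sigma$ amount to the numbers $G_j=g_j\bar g_{\pi j}$ being distinct and different from $0$ and $4$
(`HasDistinctEigenvalues.isRegular`). A totally real formal $p$-dimensional submanifold of $M$ is a
leaf $\bar z'=P(z')$ with $P=\bar\rho$ the conjugate of an antiholomorphic involution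
(`exists_eq_fixedIn`). Two leaves lie in one complex submanifold of dimension $p$ exactly when
$E(z',P_1)=E(z',P_2)$, and they are transversal exactly when the difference of their linear parts is
invertible (`IsAttachedAlong.exists_involutions`, `isAttachedAlong_complexGraph`).

First order. The lowest terms of $E(z',P_1)=E(z',P_2)$ are differences of squares. Since orders add
in products of power series, transversality forces the linear parts $A,B$ to satisfy $B=-A-\Gamma$,
besides $\bar AA=\bar BB=1$. Then $\bar\Gamma A$ commutes with the diagonal matrix
$\bar\Gamma\Gamma$, whose entries are the distinct $G_j$. So it is diagonal, and everything is
encoded by numbers $\nu_j$ with $(1+\nu_j)^2=G_j\nu_j$ and $\bar\nu_{\pi j}\nu_j=1$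
(`exists_eq_leafMatrix`). If $\pi j=j$, then $|\nu_j|=1$ and $|g_j|^2=|1+\nu_j|^2\le4$, which
excludes elliptic indices: this is (i). Without elliptic indices the solutions are the $2^{h_*+s_*}$
vectors $\nu_\epsilon$, and exchanging the two leaves inverts $\nu$. On the quadric the linear
leaves are exact and $Q(z',P_\nu(z'))$ does not depend on $\nu$, which gives (ii).

Example (iii). The second equation makes the second components of the two involutions exactly
opposite about the centre. The first one becomes a product equal to a multiple of $(P_1-P_1')^3$,
where the index is that of the component. On a line where the first component of $P-P'$ has no
linear term and the second one has, the left side has order at least four and the right side has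
order three.

Nonlinear theory (iv). Maximality of the deck group yields a transformation $f$ reflecting all $p$
forms, and the second leaf is $f(z',P(z'))$ (`IsPerturbation.exists_deck`,
`IsPerturbation.eq_comp₂`). The graph $w'=P(z')$ is then invariant under the nonlinear $\sigma$.
Linearised, the invariance equation has the divisors $\nu^{-Q}-\nu_j$, so nonresonance gives one and
only one formal solution (`exists_isInvariantGraph`). The anti-involution $\rho_0$ carries it to
another invariant graph with the same linear part; by uniqueness the two agree, so the solution is
real (`IsInvariantGraph.isAntiholomorphicInvolution`). Counting the vectors $\nu_\epsilon$ modulo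
inversion gives $2^{h_*+s_*-1}$. -/

noncomputable section
set_option linter.unusedSectionVars false
namespace CRSing

open MvPowerSeries

/-! ### The filtration of power series by order -/

section Filtration

variable {σ τ : Type}

/-- The ideal of the power series of order at least `k`. -/
def ordIdeal (σ : Type) (k : ℕ) : Ideal (MvPowerSeries σ ℂ) where
  carrier := {f | ∀ d : σ →₀ ℕ, d.degree < k → coeff d f = 0}
  zero_mem' := fun _ _ => by simp
  add_mem' := fun {a b} ha hb d hd => by simp [ha d hd, hb d hd]
  smul_mem' := fun c f hf d hd => by
    classical
    rw [smul_eq_mul, coeff_mul]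
    refine Finset.sum_eq_zero fun x hx => ?_
    have hx' : x.1 + x.2 = d := by simpa using hx
    have : x.2.degree < k := by
      have := congrArg Finsupp.degree hx'
      rw [map_add] at this
      omega
    rw [hf _ this, mul_zero]

theorem mem_ordIdeal_iff_le_order {k : ℕ} {f : MvPowerSeries σ ℂ} :
    f ∈ ordIdeal σ k ↔ (k : ℕ∞) ≤ f.order := by
  refine ⟨fun h => nat_le_order h, fun h d hd => coeff_of_lt_order (lt_of_lt_of_le ?_ h)⟩
  exact_mod_cast hd

theorem ordIdeal_mono {k l : ℕ} (h : k ≤ l) {f : MvPowerSeries σ ℂ} (hf : f ∈ ordIdeal σ l) :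
    f ∈ ordIdeal σ k := fun d hd => hf d (lt_of_lt_of_le hd h)

theorem mem_ordIdeal_zero (f : MvPowerSeries σ ℂ) : f ∈ ordIdeal σ 0 :=
  fun _ hd => absurd hd (Nat.not_lt_zero _)

theorem mem_ordIdeal_one {f : MvPowerSeries σ ℂ} :
    f ∈ ordIdeal σ 1 ↔ constantCoeff f = 0 := by
  refine ⟨fun h => h 0 (by simp), fun h d hd => ?_⟩
  have : d = 0 := by
    rw [Nat.lt_one_iff] at hd
    exact (Finsupp.degree_eq_zero_iff d).1 hd
  subst this
  exact h

theorem mul_mem_ordIdeal {k l m : ℕ} {f g : MvPowerSeries σ ℂ} (hf : f ∈ ordIdeal σ k)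
    (hg : g ∈ ordIdeal σ l) (h : m ≤ k + l) : f * g ∈ ordIdeal σ m := by
  rw [mem_ordIdeal_iff_le_order] at *
  refine le_trans ?_ (le_trans (add_le_add hf hg) le_order_mul)
  exact_mod_cast h

theorem eq_zero_of_forall_mem_ordIdeal {f : MvPowerSeries σ ℂ} (h : ∀ k, f ∈ ordIdeal σ k) :
    f = 0 := by
  ext d
  exact h (d.degree + 1) d (Nat.lt_succ_self _)

theorem smul_mem_ordIdeal {k : ℕ} (c : ℂ) {f : MvPowerSeries σ ℂ} (hf : f ∈ ordIdeal σ k) :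
    c • f ∈ ordIdeal σ k := fun d hd => by rw [coeff_smul, hf d hd, mul_zero]

theorem X_mem_ordIdeal (i : σ) : (X i : MvPowerSeries σ ℂ) ∈ ordIdeal σ 1 := by
  rw [mem_ordIdeal_one]; simp

theorem map_mem_ordIdeal {k : ℕ} (φ : ℂ →+* ℂ) {f : MvPowerSeries σ ℂ} (hf : f ∈ ordIdeal σ k) :
    MvPowerSeries.map φ f ∈ ordIdeal σ k := fun d hd => by
  rw [coeff_map, hf d hd, map_zero]

/-- A product lies in a deep term of the filtration only if one of the factors does. -/
theorem mem_ordIdeal_of_mul_mem {k l : ℕ} {f g : MvPowerSeries σ ℂ}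
    (h : f * g ∈ ordIdeal σ (k + l)) (hg : g ∉ ordIdeal σ (l + 1)) : f ∈ ordIdeal σ k := by
  rw [mem_ordIdeal_iff_le_order] at *
  rw [order_mul] at h
  have h1 : g.order ≤ (l : ℕ∞) := by
    rw [not_le] at hg
    exact Order.le_of_lt_add_one (by exact_mod_cast hg)
  have h2 : (k : ℕ∞) + l ≤ f.order + l := by
    refine le_trans (by exact_mod_cast h) (by gcongr)
  exact (ENat.add_le_add_iff_right (ENat.natCast_ne_top l)).1 h2

theorem subst_mem_ordIdeal [Finite σ] {a : σ → MvPowerSeries τ ℂ}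
    (ha : ∀ i, constantCoeff (a i) = 0) {k : ℕ} {f : MvPowerSeries σ ℂ}
    (hf : f ∈ ordIdeal σ k) : subst a f ∈ ordIdeal τ k := by
  classical
  have hs := hasSubst_of_constantCoeff_zero ha
  rw [mem_ordIdeal_iff_le_order] at *
  refine le_trans ?_ (le_order_subst hs f)
  have h1 : (1 : ℕ∞) ≤ ⨅ i, (a i).order := le_iInf fun i => by
    exact_mod_cast (mem_ordIdeal_iff_le_order (k := 1)).1 (mem_ordIdeal_one.2 (ha i))
  calc (k : ℕ∞) ≤ 1 * f.order := by simpa using hf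
    _ ≤ _ := by gcongr

end Filtration

/-! ### Linear coefficients and the chain rule at the origin. -/

section Linear

variable {σ τ : Type}

@[simp] theorem linCoeff_zero (i : σ) : linCoeff i 0 = 0 := by simp [linCoeff]

@[simp] theorem linCoeff_add (i : σ) (f g : MvPowerSeries σ ℂ) :
    linCoeff i (f + g) = linCoeff i f + linCoeff i g := by simp [linCoeff]

@[simp] theorem linCoeff_sub (i : σ) (f g : MvPowerSeries σ ℂ) :
    linCoeff i (f - g) = linCoeff i f - linCoeff i g := by simp [linCoeff]

@[simp] theorem linCoeff_smul (i : σ) (c : ℂ) (f : MvPowerSeries σ ℂ) :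
    linCoeff i (c • f) = c * linCoeff i f := by simp [linCoeff]

theorem linCoeff_sum {κ : Type} (s : Finset κ) (i : σ) (f : κ → MvPowerSeries σ ℂ) :
    linCoeff i (∑ j ∈ s, f j) = ∑ j ∈ s, linCoeff i (f j) := by simp [linCoeff]

theorem linCoeff_X [DecidableEq σ] (i j : σ) :
    linCoeff i (X j : MvPowerSeries σ ℂ) = if i = j then 1 else 0 := by
  rw [linCoeff, coeff_index_single_X]

@[simp] theorem linCoeff_C (i : σ) (c : ℂ) : linCoeff i (C c : MvPowerSeries σ ℂ) = 0 := by
  classical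
  simp [linCoeff, coeff_C]

theorem linCoeff_of_mem {i : σ} {f : MvPowerSeries σ ℂ} (hf : f ∈ ordIdeal σ 2) :
    linCoeff i f = 0 := hf _ (by simp)

theorem linCoeff_congr {i : σ} {f g : MvPowerSeries σ ℂ} (h : f - g ∈ ordIdeal σ 2) :
    linCoeff i f = linCoeff i g := by
  rw [← sub_eq_zero, ← linCoeff_sub, linCoeff_of_mem h]

theorem mem_ordIdeal_two {f : MvPowerSeries σ ℂ} :
    f ∈ ordIdeal σ 2 ↔ constantCoeff f = 0 ∧ ∀ i, linCoeff i f = 0 := by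
  refine ⟨fun h => ⟨mem_ordIdeal_one.1 (ordIdeal_mono (by norm_num) h),
    fun i => linCoeff_of_mem h⟩, fun h d hd => ?_⟩
  rcases Nat.lt_succ_iff_lt_or_eq.1 hd with h1 | h1
  · exact mem_ordIdeal_one.2 h.1 d h1
  · obtain ⟨i, rfl⟩ : d ∈ Set.range fun i : σ => Finsupp.single i 1 := by
      rw [Finsupp.range_single_one]
      exact h1
    exact h.2 i

theorem linCoeff_map (φ : ℂ →+* ℂ) (i : σ) (f : MvPowerSeries σ ℂ) :
    linCoeff i (MvPowerSeries.map φ f) = φ (linCoeff i f) := by simp [linCoeff]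

variable [Fintype σ]

/-- A power series minus its Taylor polynomial of degree one. -/
theorem sub_taylor_mem (f : MvPowerSeries σ ℂ) :
    f - (C (constantCoeff f) + ∑ j, linCoeff j f • X j) ∈ ordIdeal σ 2 := by
  classical
  refine mem_ordIdeal_two.2 ⟨by simp, fun i => ?_⟩
  simp [linCoeff_sum, linCoeff_X]

theorem linCoeff_mul (i : σ) (f g : MvPowerSeries σ ℂ) :
    linCoeff i (f * g) = constantCoeff f * linCoeff i g + linCoeff i f * constantCoeff g := by
  have hf := sub_taylor_mem f
  set f' := f - (C (constantCoeff f)) with hf'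
  set g' := g - (C (constantCoeff g)) with hg'
  have h : f * g = f' * g' + constantCoeff f • g + constantCoeff g • f
      - C (constantCoeff f * constantCoeff g) := by
    rw [hf', hg', smul_eq_C_mul, smul_eq_C_mul, map_mul]; ring
  have h2 : f' * g' ∈ ordIdeal σ 2 :=
    mul_mem_ordIdeal (k := 1) (l := 1) (mem_ordIdeal_one.2 (by simp [hf']))
      (mem_ordIdeal_one.2 (by simp [hg'])) le_rfl
  rw [h, linCoeff_sub, linCoeff_add, linCoeff_add, linCoeff_of_mem h2,
    linCoeff_C, linCoeff_smul, linCoeff_smul]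
  ring

theorem linCoeff_subst {a : σ → MvPowerSeries τ ℂ} (ha : ∀ i, constantCoeff (a i) = 0)
    (f : MvPowerSeries σ ℂ) (i : τ) :
    linCoeff i (subst a f) = ∑ j, linCoeff j f * linCoeff i (a j) := by
  have hs := hasSubst_of_constantCoeff_zero ha
  have h := subst_mem_ordIdeal ha (sub_taylor_mem f)
  rw [subst_sub hs] at h
  rw [linCoeff_congr h, subst_add hs, subst_C, linCoeff_add, linCoeff_C, zero_add]
  rw [← substAlgHom_apply (R := ℂ) hs, map_sum, linCoeff_sum]
  refine Finset.sum_congr rfl fun j _ => ?_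
  rw [map_smul, linCoeff_smul, substAlgHom_X]

end Linear

/-! ### Taylor estimates for substitution. -/

section Shift

variable {σ τ : Type}

/-- A power series all of whose monomials involve a variable of `S` is a combination of these
variables. -/
theorem exists_eq_sum_X_mul [DecidableEq σ] (S : Finset σ) (f : MvPowerSeries σ ℂ)
    (hf : ∀ d : σ →₀ ℕ, (∀ b ∈ S, d b = 0) → coeff d f = 0) :
    ∃ g : σ → MvPowerSeries σ ℂ, f = ∑ b ∈ S, X b * g b ∧
      ∀ k, f ∈ ordIdeal σ (k + 1) → ∀ b, g b ∈ ordIdeal σ k := by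
  classical
  -- Every exponent is assigned to a single variable of `S` occurring in it, so that no monomial is
  -- counted twice when `f` is split into multiples of the variables.
  have hc : ∀ d : σ →₀ ℕ, ∃ b : Option σ, (∀ c, b = some c → c ∈ S ∧ d c ≠ 0) ∧
      (b = none → ∀ b ∈ S, d b = 0) := by
    intro d
    by_cases h : ∃ b ∈ S, d b ≠ 0
    · obtain ⟨b, hb, hd⟩ := h
      exact ⟨some b, fun c hc => by cases hc; exact ⟨hb, hd⟩, by simp⟩
    · push Not at h
      exact ⟨none, by simp, fun _ => h⟩
  choose v hv1 hv2 using hc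
  let g : σ → MvPowerSeries σ ℂ := fun b m =>
    if v (m + Finsupp.single b 1) = some b then coeff (m + Finsupp.single b 1) f else 0
  have hg : ∀ b m, coeff m (g b) =
      if v (m + Finsupp.single b 1) = some b then coeff (m + Finsupp.single b 1) f else 0 :=
    fun b m => rfl
  refine ⟨g, ?_, ?_⟩
  · ext d
    have key : ∀ b ∈ S, coeff d (X b * g b) = if v d = some b then coeff d f else 0 := by
      intro b _
      rw [X, coeff_monomial_mul, one_mul]
      split_ifs with h1 h2 h2
      · rw [hg, tsub_add_cancel_of_le h1, if_pos h2]
      · rw [hg, tsub_add_cancel_of_le h1, if_neg h2]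
      · exfalso
        apply h1
        rw [Finsupp.single_le_iff]
        exact Nat.one_le_iff_ne_zero.2 (hv1 d b h2).2
      · rfl
    rw [map_sum, Finset.sum_congr rfl key]
    rcases hvd : v d with _ | c
    · simp [hf d (hv2 d hvd)]
    · rw [Finset.sum_eq_single c]
      · simp
      · intro b _ hb
        rw [if_neg]
        simpa using hb.symm
      · intro h
        exact absurd (hv1 d c hvd).1 h
  · intro k hk b d hd
    rw [hg]
    split_ifs
    · apply hk
      rw [map_add, Finsupp.degree_single]
      omega
    · rfl

/-- If `a` and `a'` agree to order `k` and `f` has order at least `m + 1`, then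
`f ∘ a` and `f ∘ a'` agree to order `k + m`. -/
theorem subst_sub_mem [Fintype σ] {a a' : σ → MvPowerSeries τ ℂ}
    (ha : ∀ i, constantCoeff (a i) = 0) (ha' : ∀ i, constantCoeff (a' i) = 0) {k : ℕ}
    (h : ∀ i, a i - a' i ∈ ordIdeal τ k) (m n : ℕ) (hn : n ≤ k + m) (f : MvPowerSeries σ ℂ)
    (hf : f ∈ ordIdeal σ (m + 1)) : subst a f - subst a' f ∈ ordIdeal τ n := by
  classical
  have hs := hasSubst_of_constantCoeff_zero ha
  have hs' := hasSubst_of_constantCoeff_zero ha'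
  have step : ∀ (f : MvPowerSeries σ ℂ), f ∈ ordIdeal σ 1 → ∃ g : σ → MvPowerSeries σ ℂ,
      (∀ k, f ∈ ordIdeal σ (k + 1) → ∀ b, g b ∈ ordIdeal σ k) ∧
      subst a f - subst a' f = ∑ b, ((a b - a' b) * subst a (g b)
        + a' b * (subst a (g b) - subst a' (g b))) := by
    intro f hf
    obtain ⟨g, hg, hk⟩ := exists_eq_sum_X_mul Finset.univ f (fun d hd => by
      refine hf d ?_
      have : d = 0 := Finsupp.ext fun b => hd b (Finset.mem_univ b)
      simp [this])
    refine ⟨g, hk, ?_⟩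
    conv_lhs => rw [hg]
    rw [← substAlgHom_apply (R := ℂ) hs, ← substAlgHom_apply (R := ℂ) hs', map_sum, map_sum,
      ← Finset.sum_sub_distrib]
    refine Finset.sum_congr rfl fun b _ => ?_
    rw [map_mul, map_mul, substAlgHom_X, substAlgHom_X, substAlgHom_apply, substAlgHom_apply]
    ring
  -- The case `m = 0`, for series with any constant term. The order rises one unit at a time,
  -- because `a'` has no constant term and multiplies a difference of the same kind.
  have base : ∀ l ≤ k, ∀ f : MvPowerSeries σ ℂ, subst a f - subst a' f ∈ ordIdeal τ l := by
    intro l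
    induction l with
    | zero => exact fun _ f => mem_ordIdeal_zero _
    | succ l ih =>
      intro hl f
      have hC : subst a f - subst a' f = subst a (f - C (constantCoeff f)) -
          subst a' (f - C (constantCoeff f)) := by
        rw [subst_sub hs, subst_sub hs', subst_C, subst_C]; ring
      obtain ⟨g, -, hg⟩ := step (f - C (constantCoeff f)) (mem_ordIdeal_one.2 (by simp))
      rw [hC, hg]
      refine Ideal.sum_mem _ fun b _ => Ideal.add_mem _ ?_ ?_
      · exact Ideal.mul_mem_right _ _ (ordIdeal_mono hl (h b))
      · exact mul_mem_ordIdeal (mem_ordIdeal_one.2 (ha' b)) (ih (by omega) (g b)) (by omega)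
  suffices H : ∀ m, ∀ f ∈ ordIdeal σ (m + 1), subst a f - subst a' f ∈ ordIdeal τ (k + m) from
    ordIdeal_mono hn (H m f hf)
  intro m
  induction m with
  | zero => exact fun f _ => base k le_rfl f
  | succ m ih =>
    intro f hf
    obtain ⟨g, hk, hg⟩ := step f (ordIdeal_mono (by omega) hf)
    rw [hg]
    refine Ideal.sum_mem _ fun b _ => Ideal.add_mem _ ?_ ?_
    · exact mul_mem_ordIdeal (h b) (subst_mem_ordIdeal ha (hk _ hf b)) (by omega)
    · exact mul_mem_ordIdeal (mem_ordIdeal_one.2 (ha' b)) (ih (g b) (hk _ hf b)) (by omega)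

/-- Change of `f ∘ a` under a change of `a`, to first order. -/
theorem subst_sub_sub_lin_mem [Fintype σ] {a a' : σ → MvPowerSeries τ ℂ}
    (ha : ∀ i, constantCoeff (a i) = 0) (ha' : ∀ i, constantCoeff (a' i) = 0) {k : ℕ}
    (h : ∀ i, a i - a' i ∈ ordIdeal τ k) (f : MvPowerSeries σ ℂ) :
    subst a f - subst a' f - ∑ i, linCoeff i f • (a i - a' i) ∈ ordIdeal τ (k + 1) := by
  have hs := hasSubst_of_constantCoeff_zero ha
  have hs' := hasSubst_of_constantCoeff_zero ha'
  have h1 := subst_sub_mem ha ha' h 1 (k + 1) le_rfl _ (sub_taylor_mem f)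
  convert h1 using 1
  rw [subst_sub hs, subst_sub hs', subst_add hs, subst_add hs', subst_C, subst_C,
    ← substAlgHom_apply (R := ℂ) hs (∑ j, _), ← substAlgHom_apply (R := ℂ) hs' (∑ j, _),
    map_sum, map_sum]
  simp only [map_smul, substAlgHom_X, smul_sub, Finset.sum_sub_distrib]
  ring

end Shift

/-! ### Fixed points of contractions -/

section FixedPoint

variable {σ κ : Type}

/-- A map that increases the order of agreement has a fixed point. -/
theorem exists_fixedPoint (Φ : (κ → MvPowerSeries σ ℂ) → κ → MvPowerSeries σ ℂ)
    (a₀ : κ → MvPowerSeries σ ℂ) (m : ℕ)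
    (hmap : ∀ a, (∀ i, a i - a₀ i ∈ ordIdeal σ m) → ∀ i, Φ a i - a₀ i ∈ ordIdeal σ m)
    (hcontr : ∀ k, m ≤ k → ∀ a b, (∀ i, a i - a₀ i ∈ ordIdeal σ m) →
      (∀ i, b i - a₀ i ∈ ordIdeal σ m) → (∀ i, a i - b i ∈ ordIdeal σ k) →
      ∀ i, Φ a i - Φ b i ∈ ordIdeal σ (k + 1)) :
    ∃ a, (∀ i, a i - a₀ i ∈ ordIdeal σ m) ∧ Φ a = a := by
  let s : ℕ → κ → MvPowerSeries σ ℂ := fun n => Φ^[n] a₀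
  have hs : ∀ n, s (n + 1) = Φ (s n) := fun n => Function.iterate_succ_apply' Φ n a₀
  have hS : ∀ n i, s n i - a₀ i ∈ ordIdeal σ m := by
    intro n
    induction n with
    | zero => intro i; simp [s]
    | succ n ih => rw [hs]; exact hmap _ ih
  have hstep : ∀ n i, s (n + 1) i - s n i ∈ ordIdeal σ (m + n) := by
    intro n
    induction n with
    | zero => exact fun i => hS 1 i
    | succ n ih =>
      intro i
      rw [hs (n + 1), hs n]
      have := hcontr (m + n) (by omega) _ _ (hS (n + 1)) (hS n) ih i
      rw [← hs n] at this ⊢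
      exact this
  have hlong : ∀ n l i, s (n + l) i - s n i ∈ ordIdeal σ (m + n) := by
    intro n l i
    induction l with
    | zero => simp
    | succ l ih =>
      have h1 : s (n + (l + 1)) i - s n i =
          (s (n + l + 1) i - s (n + l) i) + (s (n + l) i - s n i) := by
        rw [← add_assoc]; ring
      rw [h1]
      exact Ideal.add_mem _ (ordIdeal_mono (by omega) (hstep (n + l) i)) ih
  -- The coefficient at `d` no longer changes from the iterate `d.degree + 1` on, because successive
  -- iterates agree up to order `m + n`.
  let a : κ → MvPowerSeries σ ℂ := fun i d => coeff d (s (d.degree + 1) i)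
  have ha : ∀ i d, coeff d (a i) = coeff d (s (d.degree + 1) i) := fun i d => rfl
  have hlim : ∀ n i, a i - s n i ∈ ordIdeal σ (m + n) := by
    intro n i d hd
    rw [map_sub, ha]
    rcases le_total n (d.degree + 1) with h | h
    · obtain ⟨l, hl⟩ := Nat.exists_eq_add_of_le h
      have := hlong n l i d hd
      rw [map_sub] at this
      rw [hl, this]
    · obtain ⟨l, hl⟩ := Nat.exists_eq_add_of_le h
      have := hlong (d.degree + 1) l i d (by omega)
      rw [map_sub, sub_eq_zero] at this
      rw [hl, this, sub_self]
  have haS : ∀ i, a i - a₀ i ∈ ordIdeal σ m := fun i => by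
    simpa [s] using hlim 0 i
  refine ⟨a, haS, funext fun i => ?_⟩
  rw [← sub_eq_zero]
  refine eq_zero_of_forall_mem_ordIdeal fun n => ?_
  have h1 : Φ a i - a i = (Φ a i - Φ (s n) i) - (a i - s (n + 1) i) := by rw [hs]; ring
  rw [h1]
  exact Ideal.sub_mem _
    (ordIdeal_mono (by omega) (hcontr (m + n) (by omega) _ _ haS (hS n) (hlim n) i))
    (ordIdeal_mono (by omega) (hlim (n + 1) i))

/-- Uniqueness companion of `exists_fixedPoint`: agreement that always improves by one order is
equality. -/
theorem eq_of_forall_ordIdeal_succ {a b : κ → MvPowerSeries σ ℂ} (m : ℕ)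
    (h₀ : ∀ i, a i - b i ∈ ordIdeal σ m)
    (h : ∀ k, m ≤ k → (∀ i, a i - b i ∈ ordIdeal σ k) → ∀ i, a i - b i ∈ ordIdeal σ (k + 1)) :
    a = b := by
  have hk : ∀ k i, a i - b i ∈ ordIdeal σ (m + k) := by
    intro k
    induction k with
    | zero => exact h₀
    | succ k ih => exact h (m + k) (by omega) ih
  refine funext fun i => ?_
  rw [← sub_eq_zero]
  exact eq_zero_of_forall_mem_ordIdeal fun k => ordIdeal_mono (by omega) (hk k i)

end FixedPoint

/-! ### The formal implicit function theorem -/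

section Implicit

variable {α τ κ : Type} [Fintype τ] [Fintype κ]

/-- The part of the linear terms of `r` in the variables outside of the range of `e`. -/
def normalMatrix (e : α ↪ τ) (r : κ → MvPowerSeries τ ℂ) :
    Matrix κ {t // t ∉ Set.range e} ℂ :=
  Matrix.of fun i t => linCoeff t.1 (r i)

theorem sum_smul_eq_sum_subtype (e : α ↪ τ) [Fintype {t // t ∉ Set.range e}] (c : τ → ℂ) {N : Type} [AddCommGroup N] [Module ℂ N]
    (v : τ → N) (hv : ∀ a, v (e a) = 0) :
    ∑ t, c t • v t = ∑ t : {t // t ∉ Set.range e}, c t.1 • v t.1 := by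
  classical
  rw [← Fintype.sum_subtype_add_sum_subtype (fun t => t ∈ Set.range e)]
  rw [Finset.sum_eq_zero, zero_add]
  · exact Finset.sum_congr (Finset.ext fun t => by simp) fun _ _ => rfl
  rintro ⟨t, a, rfl⟩ -
  rw [hv, smul_zero]

theorem sum_smul_sum_smul_of_mul_eq_one {β κ N : Type} [Fintype β] [Fintype κ] [DecidableEq β]
    [AddCommGroup N] [Module ℂ N] {A : Matrix β κ ℂ} {B : Matrix κ β ℂ} (h : A * B = 1)
    (v : β → N) (t : β) : ∑ i, A t i • ∑ s, B i s • v s = v t := by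
  simp only [Finset.smul_sum, smul_smul]
  rw [Finset.sum_comm]
  simp only [← Finset.sum_smul]
  have : ∀ s, ∑ i, A t i * B i s = if t = s then 1 else 0 := fun s => by
    rw [← Matrix.one_apply, ← h, Matrix.mul_apply]
  simp [this]

/-- Uniqueness in the formal implicit function theorem. -/
theorem implicit_unique {σ : Type} (e : α ↪ τ) [Fintype {t // t ∉ Set.range e}]
    [DecidableEq {t // t ∉ Set.range e}] (r : κ → MvPowerSeries τ ℂ)
    (L : Matrix {t // t ∉ Set.range e} κ ℂ) (hL : L * normalMatrix e r = 1)
    {p p' : τ → MvPowerSeries σ ℂ} (hp : ∀ t, constantCoeff (p t) = 0)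
    (hp' : ∀ t, constantCoeff (p' t) = 0) (he : ∀ a, p (e a) = p' (e a))
    (h : ∀ i, subst p (r i) = subst p' (r i)) : p = p' := by
  classical
  refine eq_of_forall_ordIdeal_succ 1 (fun i => mem_ordIdeal_one.2 (by simp [hp, hp'])) ?_
  intro k _ hk t
  by_cases ht : t ∈ Set.range e
  · obtain ⟨a, rfl⟩ := ht
    simp [he]
  -- Modulo order `k + 1` only the linear terms of `r` see the difference, and only in the normal
  -- coordinates, because `p` and `p'` agree on the others.
  have h1 : ∀ i, ∑ s : {t // t ∉ Set.range e}, normalMatrix e r i s • (p s.1 - p' s.1)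
      ∈ ordIdeal σ (k + 1) := by
    intro i
    have := subst_sub_sub_lin_mem hp hp' hk (r i)
    rw [h, sub_self, zero_sub, neg_mem_iff,
      sum_smul_eq_sum_subtype e _ _ (fun a => by simp [he])] at this
    exact this
  have h2 : p t - p' t = ∑ i, L ⟨t, ht⟩ i •
      ∑ s : {t // t ∉ Set.range e}, normalMatrix e r i s • (p s.1 - p' s.1) :=
    (sum_smul_sum_smul_of_mul_eq_one hL (fun s => p s.1 - p' s.1) ⟨t, ht⟩).symm
  rw [h2]
  exact Ideal.sum_mem _ fun i _ => smul_mem_ordIdeal _ (h1 i)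

/-- The formal implicit function theorem. -/
theorem exists_implicit [DecidableEq κ] (e : α ↪ τ) [Fintype {t // t ∉ Set.range e}]
    [DecidableEq {t // t ∉ Set.range e}] (r : κ → MvPowerSeries τ ℂ)
    (hr : ∀ i, constantCoeff (r i) = 0)
    (L : Matrix {t // t ∉ Set.range e} κ ℂ) (hL : L * normalMatrix e r = 1) (hL' : normalMatrix e r * L = 1) :
    ∃ p : τ → MvPowerSeries α ℂ, (∀ t, constantCoeff (p t) = 0) ∧ (∀ a, p (e a) = X a) ∧
      ∀ i, subst p (r i) = 0 := by
  classical
  let a₀ : τ → MvPowerSeries α ℂ := fun t =>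
    if h : t ∈ Set.range e then X (Classical.choose h) else 0
  have ha₀e : ∀ a, a₀ (e a) = X a := by
    intro a
    have h : e a ∈ Set.range e := ⟨a, rfl⟩
    simp only [a₀, dif_pos h]
    rw [e.injective (Classical.choose_spec h)]
  have ha₀ : ∀ t, constantCoeff (a₀ t) = 0 := by
    intro t
    simp only [a₀]
    split_ifs <;> simp
  let Φ : (τ → MvPowerSeries α ℂ) → τ → MvPowerSeries α ℂ := fun p t =>
    if h : t ∈ Set.range e then a₀ t else p t - ∑ i, L ⟨t, h⟩ i • subst p (r i)
  have hconst : ∀ p : τ → MvPowerSeries α ℂ, (∀ t, p t - a₀ t ∈ ordIdeal α 1) →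
      ∀ t, constantCoeff (p t) = 0 := by
    intro p hp t
    have := mem_ordIdeal_one.1 (hp t)
    rwa [map_sub, ha₀, sub_zero] at this
  -- the fixed point problem is posed for series that agree with the coordinates on `α`
  let Ψ : (τ → MvPowerSeries α ℂ) → τ → MvPowerSeries α ℂ := fun p t =>
    if t ∈ Set.range e then a₀ t else p t
  have hΨ1 : ∀ p, (∀ t, p t - a₀ t ∈ ordIdeal α 1) → ∀ t, Ψ p t - a₀ t ∈ ordIdeal α 1 := by
    intro p hp t
    simp only [Ψ]
    split_ifs
    · simp
    · exact hp t
  obtain ⟨p, hp, hfix⟩ := exists_fixedPoint (fun p => Φ (Ψ p)) a₀ 1 (by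
    intro p hp t
    have hc := hconst _ (hΨ1 p hp)
    simp only [Φ]
    split_ifs with h
    · simp
    · rw [sub_right_comm]
      refine Ideal.sub_mem _ (hΨ1 p hp t) (Ideal.sum_mem _ fun i _ => smul_mem_ordIdeal _ ?_)
      exact mem_ordIdeal_one.2
        (constantCoeff_subst_eq_zero (hasSubst_of_constantCoeff_zero hc) hc (hr i))) (by
    intro k _ p q hp hq hpq t
    have hcp := hconst _ (hΨ1 p hp)
    have hcq := hconst _ (hΨ1 q hq)
    have hΨ : ∀ t, Ψ p t - Ψ q t ∈ ordIdeal α k := by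
      intro t
      simp only [Ψ]
      split_ifs
      · simp
      · exact hpq t
    simp only [Φ]
    split_ifs with h
    · simp
    have h1 : ∀ i, subst (Ψ p) (r i) - subst (Ψ q) (r i) -
        ∑ s : {t // t ∉ Set.range e}, normalMatrix e r i s • (Ψ p s.1 - Ψ q s.1)
        ∈ ordIdeal α (k + 1) := by
      intro i
      have := subst_sub_sub_lin_mem hcp hcq hΨ (r i)
      rwa [sum_smul_eq_sum_subtype e _ _ (fun a => by simp [Ψ])] at this
    have h2 : Ψ p t - Ψ q t = ∑ i, L ⟨t, h⟩ i •
        ∑ s : {t // t ∉ Set.range e}, normalMatrix e r i s • (Ψ p s.1 - Ψ q s.1) :=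
      (sum_smul_sum_smul_of_mul_eq_one hL (fun s => Ψ p s.1 - Ψ q s.1) ⟨t, h⟩).symm
    have h3 : Ψ p t - ∑ i, L ⟨t, h⟩ i • subst (Ψ p) (r i) -
        (Ψ q t - ∑ i, L ⟨t, h⟩ i • subst (Ψ q) (r i)) =
        -∑ i, L ⟨t, h⟩ i • (subst (Ψ p) (r i) - subst (Ψ q) (r i) -
        ∑ s : {t // t ∉ Set.range e}, normalMatrix e r i s • (Ψ p s.1 - Ψ q s.1)) := by
      have h4 : ∀ i, L ⟨t, h⟩ i • (subst (Ψ p) (r i) - subst (Ψ q) (r i) -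
          ∑ s : {t // t ∉ Set.range e}, normalMatrix e r i s • (Ψ p s.1 - Ψ q s.1)) =
          L ⟨t, h⟩ i • subst (Ψ p) (r i) - L ⟨t, h⟩ i • subst (Ψ q) (r i) - L ⟨t, h⟩ i •
          ∑ s : {t // t ∉ Set.range e}, normalMatrix e r i s • (Ψ p s.1 - Ψ q s.1) :=
        fun i => by rw [smul_sub, smul_sub]
      rw [Finset.sum_congr rfl fun i _ => h4 i, Finset.sum_sub_distrib, Finset.sum_sub_distrib,
        ← h2]
      ring
    rw [h3, neg_mem_iff]
    exact Ideal.sum_mem _ fun i _ => smul_mem_ordIdeal _ (h1 i))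
  have hpe : ∀ a, p (e a) = X a := by
    intro a
    have := congrFun hfix (e a)
    simp only [Φ] at this
    rw [← this, dif_pos ⟨a, rfl⟩, ha₀e]
  have hΨp : Ψ p = p := by
    funext t
    simp only [Ψ]
    split_ifs with h
    · obtain ⟨a, rfl⟩ := h
      rw [hpe, ha₀e]
    · rfl
  rw [hΨp] at hfix
  refine ⟨p, hconst p hp, hpe, fun j => ?_⟩
  have hz : ∀ t : {t // t ∉ Set.range e}, ∑ i, L t i • subst p (r i) = 0 := by
    intro t
    have := congrFun hfix t.1
    simp only [Φ, dif_neg t.2] at this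
    simpa using this
  rw [← sum_smul_sum_smul_of_mul_eq_one hL' (fun i => subst p (r i)) j]
  exact Finset.sum_eq_zero fun t _ => by rw [hz, smul_zero]

/-- An injective matrix with as many rows as columns is invertible. -/
theorem exists_two_sided_inverse {β κ : Type} [Fintype β] [Fintype κ] [DecidableEq β]
    [DecidableEq κ] (N : Matrix κ β ℂ)
    (hcard : Fintype.card κ = Fintype.card β)
    (hN : ∀ x : β → ℂ, (∀ i, ∑ t, N i t * x t = 0) → x = 0) :
    ∃ L : Matrix β κ ℂ, L * N = 1 ∧ N * L = 1 := by
  obtain ⟨k⟩ := Fintype.card_eq.1 hcard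
  have hu : IsUnit (N.submatrix k.symm id) := by
    rw [← Matrix.mulVec_injective_iff_isUnit]
    refine (injective_iff_map_eq_zero (Matrix.mulVecLin (N.submatrix k.symm id))).2 fun x hx => ?_
    refine hN x fun i => ?_
    have := congrFun hx (k i)
    simpa [Matrix.mulVec, dotProduct] using this
  obtain ⟨u, hu⟩ := hu
  refine ⟨(↑u⁻¹ : Matrix β β ℂ).submatrix id k, ?_, ?_⟩
  · have h1 : N = (u : Matrix β β ℂ).submatrix k id := by rw [hu]; ext; simp
    rw [h1, Matrix.submatrix_mul_equiv]
    simp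
  · have h1 : N = (u : Matrix β β ℂ).submatrix k id := by rw [hu]; ext; simp
    have := Matrix.submatrix_mul_equiv (u : Matrix β β ℂ) (↑u⁻¹ : Matrix β β ℂ) k
      (Equiv.refl β) k
    rw [h1]
    simpa using this

end Implicit

/-- Newton's iteration for `φ ∘ p = X` with the linear part of `φ` frozen: each step cancels the
error at the lowest order, hence gains one order. -/
theorem exists_right_inverse {σ : Type} [Fintype σ] [DecidableEq σ] (φ : σ → MvPowerSeries σ ℂ)
    (hφ : ∀ i, constantCoeff (φ i) = 0) (hu : IsUnit (linearPart φ)) :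
    ∃ ψ : σ → MvPowerSeries σ ℂ, (∀ i, constantCoeff (ψ i) = 0) ∧ ∀ i, subst ψ (φ i) = X i := by
  obtain ⟨u, hu⟩ := hu
  have hcst : ∀ p : σ → MvPowerSeries σ ℂ, (∀ i, p i ∈ ordIdeal σ 1) →
      ∀ i, constantCoeff (p i) = 0 := fun p hp i => mem_ordIdeal_one.1 (hp i)
  have hinv : (↑u⁻¹ : Matrix σ σ ℂ) * linearPart φ = 1 := by rw [← hu]; simp
  have hinv' : linearPart φ * (↑u⁻¹ : Matrix σ σ ℂ) = 1 := by rw [← hu]; simp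
  obtain ⟨ψ, hψ, hfix⟩ := exists_fixedPoint
    (fun p i => p i - ∑ j, (↑u⁻¹ : Matrix σ σ ℂ) i j • (subst p (φ j) - X j)) (fun _ => 0) 1 (by
      intro p hp i
      simp only [sub_zero] at hp ⊢
      refine Ideal.sub_mem _ (hp i) (Ideal.sum_mem _ fun j _ => smul_mem_ordIdeal _
        (Ideal.sub_mem _ (mem_ordIdeal_one.2 ?_) (X_mem_ordIdeal j)))
      exact constantCoeff_subst_eq_zero (hasSubst_of_constantCoeff_zero (hcst p hp)) (hcst p hp)
        (hφ j)) (by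
      intro k _ p q hp hq hpq i
      simp only [sub_zero] at hp hq
      have h1 := fun j => subst_sub_sub_lin_mem (hcst p hp) (hcst q hq) hpq (φ j)
      have h2 : p i - ∑ j, (↑u⁻¹ : Matrix σ σ ℂ) i j • (subst p (φ j) - X j) -
          (q i - ∑ j, (↑u⁻¹ : Matrix σ σ ℂ) i j • (subst q (φ j) - X j)) =
          -∑ j, (↑u⁻¹ : Matrix σ σ ℂ) i j • (subst p (φ j) - subst q (φ j) -
            ∑ k, linearPart φ j k • (p k - q k)) := by
        have h3 := sum_smul_sum_smul_of_mul_eq_one hinv (fun k => p k - q k) i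
        simp only [smul_sub, Finset.sum_sub_distrib] at h3 ⊢
        linear_combination -h3
      rw [h2, neg_mem_iff]
      exact Ideal.sum_mem _ fun j _ => smul_mem_ordIdeal _ (h1 j))
  simp only [sub_zero] at hψ
  refine ⟨ψ, hcst ψ hψ, fun i => ?_⟩
  have h1 : ∀ i, ∑ j, (↑u⁻¹ : Matrix σ σ ℂ) i j • (subst ψ (φ j) - X j) = 0 := fun i => by
    simpa using congrFun hfix i
  rw [← sub_eq_zero, ← sum_smul_sum_smul_of_mul_eq_one hinv' (fun j => subst ψ (φ j) - X j) i]
  exact Finset.sum_eq_zero fun t _ => by rw [h1, smul_zero]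

theorem linearPart_mul_of_subst_eq_X {σ : Type} [Fintype σ] [DecidableEq σ]
    {φ ψ : σ → MvPowerSeries σ ℂ} (hψ : ∀ i, constantCoeff (ψ i) = 0)
    (h : ∀ i, subst ψ (φ i) = X i) : linearPart φ * linearPart ψ = 1 := by
  ext i j
  have := congrArg (linCoeff j) (h i)
  rw [linCoeff_subst hψ, linCoeff_X] at this
  rw [Matrix.mul_apply, Matrix.one_apply]
  simp only [linearPart, Matrix.of_apply]
  rw [this]
  simp [eq_comm]

/-- The formal inverse function theorem. -/
theorem exists_inverse {σ : Type} [Fintype σ] [DecidableEq σ] (φ : σ → MvPowerSeries σ ℂ)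
    (hφ : ∀ i, constantCoeff (φ i) = 0) (hu : IsUnit (linearPart φ)) :
    ∃ ψ : σ → MvPowerSeries σ ℂ, (∀ i, constantCoeff (ψ i) = 0) ∧ (∀ i, subst ψ (φ i) = X i) ∧
      ∀ i, subst φ (ψ i) = X i := by
  obtain ⟨ψ, hψ, h⟩ := exists_right_inverse φ hφ hu
  have h1 := linearPart_mul_of_subst_eq_X hψ h
  have hu' : IsUnit (linearPart ψ) := (IsUnit.of_mul_eq_one _ (mul_eq_one_comm.1 h1))
  obtain ⟨χ, hχ, h'⟩ := exists_right_inverse ψ hψ hu'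
  have : χ = φ := by
    funext i
    have h2 := subst_comp_subst_apply (R := ℂ) (hasSubst_of_constantCoeff_zero hψ)
      (hasSubst_of_constantCoeff_zero hχ) (φ i)
    rw [h, subst_X (hasSubst_of_constantCoeff_zero hχ)] at h2
    rw [h2]
    simp only [h']
    rw [show (fun s => X s : σ → MvPowerSeries σ ℂ) = X from rfl, subst_self]
    rfl
  exact ⟨ψ, hψ, h, this ▸ h'⟩

/-! ### Ideals of graphs -/

section Graph

variable {α τ : Type} [Fintype α] [Fintype τ]

/-- The ideal of the image of the embedding `p` of the `α`-space into the `τ`-space, when the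
coordinates `e a` of `p` are the coordinates of the `α`-space. -/
def graphIdeal (e : α ↪ τ) (p : τ → MvPowerSeries α ℂ) : Ideal (MvPowerSeries τ ℂ) :=
  Ideal.span (Set.range fun t => X t - rename (R := ℂ) e (p t))

variable {e : α ↪ τ} {p : τ → MvPowerSeries α ℂ}

theorem subst_rename {σ : Type} {b : τ → MvPowerSeries σ ℂ}
    (hb : ∀ t, constantCoeff (b t) = 0) (c : α → τ) (f : MvPowerSeries α ℂ) :
    subst b (rename (R := ℂ) c f) = subst (b ∘ c) f := by
  rw [rename_eq_subst, subst_comp_subst_apply (HasSubst.X_comp c)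
    (hasSubst_of_constantCoeff_zero hb)]
  congr 1
  funext a
  simp [subst_X (hasSubst_of_constantCoeff_zero hb)]

theorem rename_subst {σ : Type} {b : τ → MvPowerSeries α ℂ}
    (hb : ∀ t, constantCoeff (b t) = 0) (c : α → σ) (f : MvPowerSeries τ ℂ) :
    rename (R := ℂ) c (subst b f) = subst (fun t => rename (R := ℂ) c (b t)) f := by
  rw [rename_eq_subst, subst_comp_subst_apply (hasSubst_of_constantCoeff_zero hb)
    (HasSubst.X_comp c)]
  simp only [rename_eq_subst]

theorem subst_eq_zero_of_mem_graphIdeal (hp : ∀ t, constantCoeff (p t) = 0)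
    (hpe : ∀ a, p (e a) = X a) {f : MvPowerSeries τ ℂ} (hf : f ∈ graphIdeal e p) :
    subst p f = 0 := by
  have hsp := hasSubst_of_constantCoeff_zero hp
  rw [← substAlgHom_apply (R := ℂ) hsp, ← RingHom.mem_ker]
  refine (Ideal.span_le (I := RingHom.ker (substAlgHom (R := ℂ) hsp))).2 ?_ hf
  rintro _ ⟨t, rfl⟩
  have h1 : p ∘ e = X := funext hpe
  rw [SetLike.mem_coe, RingHom.mem_ker, substAlgHom_apply, subst_sub hsp, subst_X hsp,
    subst_rename hp, h1, subst_self, id, sub_self]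

/-- Modulo the ideal of a graph a power series is determined by its restriction. -/
theorem sub_rename_subst_mem_graphIdeal (hp : ∀ t, constantCoeff (p t) = 0)
    (hpe : ∀ a, p (e a) = X a) (f : MvPowerSeries τ ℂ) :
    f - rename (R := ℂ) e (subst p f) ∈ graphIdeal e p := by
  classical
  have hsp := hasSubst_of_constantCoeff_zero hp
  -- Any remainder `k` will do: substituting `p` in the congruence identifies it as the restriction
  -- of `f`.
  suffices h : ∃ k : MvPowerSeries α ℂ, f - rename (R := ℂ) e k ∈ graphIdeal e p by
    obtain ⟨k, hk⟩ := h
    have h1 : p ∘ e = X := funext hpe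
    have h2 := subst_eq_zero_of_mem_graphIdeal hp hpe hk
    rw [subst_sub hsp, subst_rename hp, h1, subst_self, id, sub_eq_zero] at h2
    rwa [h2]
  let q : τ → MvPowerSeries τ ℂ := fun t => rename (R := ℂ) e (p t)
  have hq : ∀ t, constantCoeff (q t) = 0 := fun t => by simp [q, hp]
  let S : Finset τ := Finset.univ.filter fun t => t ∉ Set.range e
  let A : τ → MvPowerSeries τ ℂ := fun t => if t ∈ S then X t + q t else X t
  let B : τ → MvPowerSeries τ ℂ := fun t => if t ∈ S then X t - q t else X t
  have hA : ∀ t, constantCoeff (A t) = 0 := fun t => by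
    simp only [A]; split_ifs <;> simp [hq]
  have hB : ∀ t, constantCoeff (B t) = 0 := fun t => by
    simp only [B]; split_ifs <;> simp [hq]
  have hsA := hasSubst_of_constantCoeff_zero hA
  have hsB := hasSubst_of_constantCoeff_zero hB
  have hBe : B ∘ e = X ∘ e := funext fun a => by
    simp [B, S]
  have hBren : ∀ k : MvPowerSeries α ℂ, subst B (rename (R := ℂ) e k) = rename (R := ℂ) e k := by
    intro k
    rw [subst_rename hB, hBe, rename_eq_subst]
  have hBA : ∀ g, subst B (subst A g) = g := by
    intro g
    rw [subst_comp_subst_apply hsA hsB]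
    have : (fun s => subst B (A s)) = X := by
      funext t
      simp only [A]
      split_ifs with h
      · rw [subst_add hsB, subst_X hsB, hBren]
        simp [B, h, q]
      · rw [subst_X hsB]
        simp [B, h]
    rw [this, subst_self, id]
  set F := subst A f with hF
  obtain ⟨g, hg, -⟩ := exists_eq_sum_X_mul S (F - rename (R := ℂ) e (killCompl e F)) (by
    intro d hd
    have hd' : d ∈ Set.range (Finsupp.embDomain e) := by
      rw [Finsupp.mem_range_embDomain_iff]
      intro t ht
      by_contra h
      exact Finsupp.mem_support_iff.1 ht (hd t (by simpa [S] using h))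
    obtain ⟨d', rfl⟩ := hd'
    rw [map_sub, coeff_embDomain_rename, coeff_killCompl, sub_self])
  refine ⟨killCompl e F, ?_⟩
  have h1 : f - rename (R := ℂ) e (killCompl e F) =
      subst B (F - rename (R := ℂ) e (killCompl e F)) := by
    rw [subst_sub hsB, hBren, hF, hBA]
  rw [h1, hg, ← substAlgHom_apply (R := ℂ) hsB, map_sum]
  refine Ideal.sum_mem _ fun t ht => ?_
  rw [map_mul, substAlgHom_X]
  refine Ideal.mul_mem_right _ _ (Ideal.subset_span ⟨t, ?_⟩)
  simp [B, ht, q]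

theorem mem_graphIdeal (hp : ∀ t, constantCoeff (p t) = 0)
    (hpe : ∀ a, p (e a) = X a) {f : MvPowerSeries τ ℂ} :
    f ∈ graphIdeal e p ↔ subst p f = 0 := by
  refine ⟨subst_eq_zero_of_mem_graphIdeal hp hpe, fun hf => ?_⟩
  have := sub_rename_subst_mem_graphIdeal hp hpe f
  rwa [hf, map_zero, sub_zero] at this

theorem card_compl_range_add (e : α ↪ τ) [Fintype {t // t ∉ Set.range e}] :
    Fintype.card {t // t ∉ Set.range e} + Fintype.card α = Fintype.card τ := by
  classical
  have h := Fintype.card_subtype_compl fun t => t ∈ Set.range e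
  have h2 : Fintype.card {t // t ∈ Set.range e} = Fintype.card α :=
    (Fintype.card_congr (Equiv.ofInjective e e.injective)).symm
  have h3 := Fintype.card_subtype_le fun t => t ∈ Set.range e
  omega

/-- Elements of the ideal of a graph that are as many as its codimension and have independent
differentials generate the ideal. -/
theorem span_range_eq_graphIdeal {κ : Type} [Fintype κ] (hp : ∀ t, constantCoeff (p t) = 0)
    (hpe : ∀ a, p (e a) = X a) (r : κ → MvPowerSeries τ ℂ) (hr : ∀ i, r i ∈ graphIdeal e p)
    (hcard : Fintype.card κ + Fintype.card α = Fintype.card τ)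
    (hlin : LinearIndependent ℂ fun i => fun t => linCoeff t (r i)) :
    Ideal.span (Set.range r) = graphIdeal e p := by
  classical
  let G : {t // t ∉ Set.range e} → MvPowerSeries τ ℂ :=
    fun b => X b.1 - rename (R := ℂ) e (p b.1)
  have hG : graphIdeal e p = Ideal.span (Set.range G) := by
    refine le_antisymm (Ideal.span_le.2 ?_) (Ideal.span_le.2 ?_)
    · rintro _ ⟨t, rfl⟩
      by_cases ht : t ∈ Set.range e
      · obtain ⟨a, rfl⟩ := ht
        simp [hpe]
      · exact Ideal.subset_span ⟨⟨t, ht⟩, rfl⟩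
    · rintro _ ⟨t, rfl⟩
      exact Ideal.subset_span ⟨t.1, rfl⟩
  have hG0 : ∀ b, constantCoeff (G b) = 0 := fun b => by simp [G, hp]
  refine le_antisymm (Ideal.span_le.2 (by rintro _ ⟨i, rfl⟩; exact hr i)) ?_
  have hu : ∀ i, ∃ c : {t // t ∉ Set.range e} → MvPowerSeries τ ℂ, ∑ b, c b * G b = r i :=
    fun i => Ideal.mem_span_range_iff_exists_fun.1 (hG ▸ hr i)
  choose U hU using hu
  obtain ⟨L, -, hL⟩ := exists_two_sided_inverse
    (Matrix.of fun (b : {t // t ∉ Set.range e}) i => constantCoeff (U i b))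
    (by have := card_compl_range_add e; omega) (by
      intro x hx
      have := Fintype.linearIndependent_iff.1 hlin x (by
        funext t
        simp only [Finset.sum_apply, Pi.smul_apply, smul_eq_mul, ← hU, linCoeff_sum, linCoeff_mul,
          hG0, mul_zero, add_zero, Finset.mul_sum]
        rw [Finset.sum_comm]
        refine Finset.sum_eq_zero fun b _ => ?_
        have := hx b
        simp only [Matrix.of_apply] at this
        rw [← zero_mul (linCoeff t (G b)), ← this, Finset.sum_mul]
        exact Finset.sum_congr rfl fun i _ => by ring)
      exact funext this)
  -- `U` expresses `r` in the standard generators `G`, and its constant term is invertible because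
  -- the differentials of `r` are independent. Corrected by the constant inverse `L`, it reduces to
  -- the identity at the origin, hence is invertible over power series, and `G` can be recovered
  -- from `r`.
  let W : Matrix {t // t ∉ Set.range e} {t // t ∉ Set.range e} (MvPowerSeries τ ℂ) :=
    Matrix.of fun b c => ∑ i, C (L i b) * U i c
  have hW : W.map constantCoeff = 1 := by
    rw [← Matrix.transpose_one, ← hL]
    ext b c
    simp [W, Matrix.mul_apply, mul_comm]
  have hWu : IsUnit W.det := by
    rw [isUnit_iff_constantCoeff, ← RingHom.coe_coe, RingHom.map_det, RingHom.mapMatrix_apply]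
    erw [hW]
    simp
  have hWG : ∀ b, ∑ c, W b c * G c = ∑ i, C (L i b) * r i := by
    intro b
    simp only [W, Matrix.of_apply, ← hU, Finset.sum_mul, Finset.mul_sum]
    rw [Finset.sum_comm]
    simp only [mul_assoc]
  rw [hG, Ideal.span_le]
  rintro _ ⟨b, rfl⟩
  have h1 : G b = ∑ c, W⁻¹ b c * ∑ i, C (L i c) * r i := by
    simp only [← hWG]
    have h2 : W⁻¹.mulVec (W.mulVec G) = G := by
      rw [Matrix.mulVec_mulVec, Matrix.nonsing_inv_mul _ hWu, Matrix.one_mulVec]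
    conv_lhs => rw [← h2]
    rfl
  rw [SetLike.mem_coe, h1]
  exact Ideal.sum_mem _ fun c _ => Ideal.mul_mem_left _ _ (Ideal.sum_mem _ fun i _ =>
    Ideal.mul_mem_left _ _ (Ideal.subset_span ⟨i, rfl⟩))

/-- Series with independent differentials are the equations of a graph over the `α`-space if the
differentials together with those of the coordinates `e a` separate vectors. -/
theorem exists_span_range_eq_graphIdeal {κ : Type} [Fintype κ] (e : α ↪ τ)
    (r : κ → MvPowerSeries τ ℂ) (hr : ∀ i, constantCoeff (r i) = 0)
    (hcard : Fintype.card κ + Fintype.card α = Fintype.card τ)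
    (hlin : LinearIndependent ℂ fun i => fun t => linCoeff t (r i))
    (hinj : ∀ x : τ → ℂ, (∀ a, x (e a) = 0) → (∀ i, ∑ t, linCoeff t (r i) * x t = 0) → x = 0) :
    ∃ p : τ → MvPowerSeries α ℂ, (∀ t, constantCoeff (p t) = 0) ∧ (∀ a, p (e a) = X a) ∧
      Ideal.span (Set.range r) = graphIdeal e p := by
  classical
  obtain ⟨L, hL, hL'⟩ := exists_two_sided_inverse (normalMatrix e r)
    (by have := card_compl_range_add e; omega) (by
      intro x hx
      let y : τ → ℂ := fun t => if h : t ∈ Set.range e then 0 else x ⟨t, h⟩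
      have hy : y = 0 := by
        refine hinj y (fun a => dif_pos ⟨a, rfl⟩) fun i => ?_
        have h1 := sum_smul_eq_sum_subtype e (fun t => linCoeff t (r i)) y
          (fun a => dif_pos ⟨a, rfl⟩)
        simp only [smul_eq_mul] at h1
        rw [h1, ← hx i]
        refine Finset.sum_congr (Finset.ext fun t => by simp) fun t _ => ?_
        simp only [y, dif_neg t.2]
        rfl
      funext t
      have := congrFun hy t.1
      simp only [y, dif_neg t.2] at this
      exact this)
  obtain ⟨p, hp, hpe, h⟩ := exists_implicit e r hr L hL hL'
  exact ⟨p, hp, hpe, span_range_eq_graphIdeal hp hpe r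
    (fun i => (mem_graphIdeal hp hpe).2 (h i)) hcard hlin⟩

end Graph

/-! ### Conjugation and renaming of variables -/

section Conj

variable {σ τ : Type}

theorem linCoeff_rename [Fintype σ] [DecidableEq τ] (c : σ → τ) (f : MvPowerSeries σ ℂ) (t : τ) :
    linCoeff t (rename (R := ℂ) c f) = ∑ j, linCoeff j f * if t = c j then 1 else 0 := by
  rw [rename_eq_subst, linCoeff_subst (fun i => by simp)]
  simp only [Function.comp, linCoeff_X]

theorem linCoeff_rename_apply [Fintype σ] {c : σ → τ} (hc : Function.Injective c)
    (f : MvPowerSeries σ ℂ) (j : σ) :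
    linCoeff (c j) (rename (R := ℂ) c f) = linCoeff j f := by
  classical
  rw [linCoeff_rename]
  simp [hc.eq_iff]

theorem rename_mem_ordIdeal [Finite σ] (c : σ → τ) {k : ℕ} {f : MvPowerSeries σ ℂ}
    (hf : f ∈ ordIdeal σ k) : rename (R := ℂ) c f ∈ ordIdeal τ k := by
  rw [rename_eq_subst]
  exact subst_mem_ordIdeal (fun i => by simp) hf

theorem conjSeries_apply [Finite σ] (f : RealSeries σ) :
    conjSeries f = rename (R := ℂ) Sum.swap (MvPowerSeries.map (starRingEnd ℂ) f) := rfl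

@[simp] theorem conjSeries_X [Finite σ] (t : σ ⊕ σ) :
    conjSeries (X t : RealSeries σ) = X t.swap := by
  rw [conjSeries_apply, map_X, rename_X]

theorem map_conj_map_conj (f : MvPowerSeries σ ℂ) :
    MvPowerSeries.map (starRingEnd ℂ) (MvPowerSeries.map (starRingEnd ℂ) f) = f := by
  ext; simp

@[simp] theorem conjSeries_conjSeries [Finite σ] (f : RealSeries σ) :
    conjSeries (conjSeries f) = f := by
  rw [conjSeries_apply, conjSeries_apply, ← rename_map, map_conj_map_conj, rename_rename]
  simp

theorem conjSeries_rename [Finite σ] [Finite τ] (c : τ → σ ⊕ σ) (f : MvPowerSeries τ ℂ) :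
    conjSeries (rename (R := ℂ) c f) =
      rename (R := ℂ) (Sum.swap ∘ c) (MvPowerSeries.map (starRingEnd ℂ) f) := by
  rw [conjSeries_apply, ← rename_map, rename_rename]

theorem conjSeries_smul [Finite σ] (c : ℂ) (f : RealSeries σ) :
    conjSeries (c • f) = conj c • conjSeries f := by
  rw [smul_eq_C_mul, map_mul, smul_eq_C_mul, conjSeries_apply (C c), map_C, rename_C]

theorem linCoeff_conjSeries [Fintype σ] (f : RealSeries σ) (t : σ ⊕ σ) :
    linCoeff t (conjSeries f) = conj (linCoeff t.swap f) := by
  obtain ⟨s, rfl⟩ : ∃ s : σ ⊕ σ, t = s.swap := ⟨t.swap, (Sum.swap_swap t).symm⟩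
  rw [conjSeries_apply, Sum.swap_swap, ← linCoeff_map, linCoeff_rename_apply
    (Function.Involutive.injective (f := (Sum.swap : σ ⊕ σ → σ ⊕ σ)) Sum.swap_swap)]

theorem constantCoeff_conjSeries [Finite σ] (f : RealSeries σ) :
    constantCoeff (conjSeries f) = conj (constantCoeff f) := by
  rw [conjSeries_apply, constantCoeff_rename]; simp

theorem span_union_conj_le_comap [Finite σ] {κ : Type} (f : κ → RealSeries σ) :
    Ideal.span (Set.range f ∪ Set.range fun j => conjSeries (f j)) ≤
      (Ideal.span (Set.range f ∪ Set.range fun j => conjSeries (f j))).comap conjSeries := by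
  rw [Ideal.span_le]
  rintro _ (⟨j, rfl⟩ | ⟨j, rfl⟩)
  · exact Ideal.subset_span (Or.inr ⟨j, rfl⟩)
  · refine Ideal.subset_span (Or.inl ⟨j, ?_⟩)
    simp

/-- Power series in congruent arguments are congruent. -/
theorem subst_sub_subst_mem [Fintype σ] (I : Ideal (MvPowerSeries τ ℂ))
    {u v : σ → MvPowerSeries τ ℂ} (hu : ∀ i, constantCoeff (u i) = 0)
    (hv : ∀ i, constantCoeff (v i) = 0) (h : ∀ i, u i - v i ∈ I) (f : MvPowerSeries σ ℂ) :
    subst u f - subst v f ∈ I := by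
  have hw : ∀ t, constantCoeff (Sum.elim u v t) = 0 := by rintro (i | i) <;> simp [hu, hv]
  have hp : ∀ t : σ ⊕ σ, constantCoeff (Sum.elim X X t : MvPowerSeries σ ℂ) = 0 := by
    rintro (i | i) <;> simp
  have hsp := hasSubst_of_constantCoeff_zero hp
  have hs := hasSubst_of_constantCoeff_zero hw
  -- The universal case: `f(x) - f(y)` vanishes on the diagonal, which is a graph, so it lies in the
  -- ideal generated by the differences of the coordinates.
  have hF : rename (R := ℂ) Sum.inl f - rename (R := ℂ) Sum.inr f ∈
      graphIdeal (Function.Embedding.inl : σ ↪ σ ⊕ σ) (Sum.elim X X) := by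
    rw [mem_graphIdeal hp (fun _ => rfl), subst_sub hsp, subst_rename hp, subst_rename hp]
    simp
  have hle : graphIdeal (Function.Embedding.inl : σ ↪ σ ⊕ σ) (Sum.elim X X) ≤
      I.comap (substAlgHom (R := ℂ) hs) := by
    rw [graphIdeal, Ideal.span_le]
    rintro _ ⟨t, rfl⟩
    rw [SetLike.mem_coe, Ideal.mem_comap, map_sub, substAlgHom_X]
    rcases t with i | i
    · simp [subst_X hs]
    · simp only [Sum.elim_inr, rename_X, substAlgHom_X, Function.Embedding.inl_apply, Sum.elim_inl]
      rw [← neg_sub]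
      exact neg_mem (h i)
  have := hle hF
  rw [Ideal.mem_comap, map_sub, substAlgHom_apply, substAlgHom_apply, subst_rename hw,
    subst_rename hw] at this
  simpa using this

end Conj

/-! ### Leaves: the submanifolds `z' = ρ(z')` of `M` -/

section Leaf

variable {ι : Type} [Fintype ι]

theorem constantCoeff_sumElim {σ : Type} {u v : ι → MvPowerSeries σ ℂ}
    (hu : ∀ i, constantCoeff (u i) = 0) (hv : ∀ i, constantCoeff (v i) = 0) (t : ι ⊕ ι) :
    constantCoeff (Sum.elim u v t) = 0 := by
  rcases t with i | i <;> simp [hu, hv]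

/-- The coordinates `z'`. -/
def baseEmb (ι : Type) : ι ↪ (ι ⊕ ι) ⊕ (ι ⊕ ι) :=
  Function.Embedding.inl.trans Function.Embedding.inl

/-- The parametrization by `z'` of the subset `z' = ρ(z')` of `M`. -/
def leafMap (E : ι → MvPowerSeries (ι ⊕ ι) ℂ) (P : ι → MvPowerSeries ι ℂ) :
    (ι ⊕ ι) ⊕ (ι ⊕ ι) → MvPowerSeries ι ℂ :=
  Sum.elim (Sum.elim X fun j => subst (Sum.elim X P) (E j))
    (Sum.elim P fun j => subst (Sum.elim P X) (MvPowerSeries.map (starRingEnd ℂ) (E j)))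

variable {E : ι → MvPowerSeries (ι ⊕ ι) ℂ} {P : ι → MvPowerSeries ι ℂ}

theorem constantCoeff_leafMap (hE : ∀ j, constantCoeff (E j) = 0)
    (hP : ∀ j, constantCoeff (P j) = 0) (t : (ι ⊕ ι) ⊕ (ι ⊕ ι)) :
    constantCoeff (leafMap E P t) = 0 := by
  have h1 := constantCoeff_sumElim (u := X) (fun i : ι => by simp) hP
  have h2 := constantCoeff_sumElim (v := X) hP (fun i : ι => by simp)
  rcases t with (j | j) | (j | j)
  · simp [leafMap]
  · exact constantCoeff_subst_eq_zero (hasSubst_of_constantCoeff_zero h1) h1 (hE j)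
  · exact hP j
  · exact constantCoeff_subst_eq_zero (hasSubst_of_constantCoeff_zero h2) h2 (by simp [hE])

theorem leafMap_baseEmb (a : ι) : leafMap E P (baseEmb ι a) = X a := rfl

theorem conjSeries_graphFun (j : ι) :
    conjSeries (graphFun E j) = X (Sum.inr (Sum.inr j)) -
      rename (R := ℂ) (Sum.elim (Sum.inr ∘ Sum.inl) (Sum.inl ∘ Sum.inl))
        (MvPowerSeries.map (starRingEnd ℂ) (E j)) := by
  rw [graphFun, map_sub, conjSeries_X, evalBar, conjSeries_rename]
  have : Sum.swap ∘ (Sum.map Sum.inl Sum.inl : ι ⊕ ι → (ι ⊕ ι) ⊕ (ι ⊕ ι)) =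
      Sum.elim (Sum.inr ∘ Sum.inl) (Sum.inl ∘ Sum.inl) := by
    funext t; rcases t with i | i <;> rfl
  simp only [this]
  rfl

theorem fixFun_eq (j : ι) : fixFun P j =
    X (Sum.inr (Sum.inl j)) - rename (R := ℂ) (baseEmb ι) (P j) := by
  rw [fixFun, ofHol, rename_rename]
  rfl

theorem conjSeries_fixFun (j : ι) : conjSeries (fixFun P j) =
    X (Sum.inl (Sum.inl j)) - rename (R := ℂ) (Sum.inr ∘ Sum.inl)
      (MvPowerSeries.map (starRingEnd ℂ) (P j)) := by
  rw [fixFun_eq, map_sub, conjSeries_X, conjSeries_rename]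
  rfl

theorem subst_graphFun
    (p : (ι ⊕ ι) ⊕ (ι ⊕ ι) → MvPowerSeries ι ℂ) (hp : ∀ t, constantCoeff (p t) = 0) (j : ι) :
    subst p (graphFun E j) = p (Sum.inl (Sum.inr j)) -
      subst (Sum.elim (fun k => p (Sum.inl (Sum.inl k))) fun k => p (Sum.inr (Sum.inl k))) (E j)
        := by
  have hs := hasSubst_of_constantCoeff_zero hp
  rw [graphFun, evalBar, subst_sub hs, subst_X hs, subst_rename hp]
  congr 2
  funext t; rcases t with i | i <;> rfl

theorem subst_conjSeries_graphFun
    (p : (ι ⊕ ι) ⊕ (ι ⊕ ι) → MvPowerSeries ι ℂ) (hp : ∀ t, constantCoeff (p t) = 0) (j : ι) :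
    subst p (conjSeries (graphFun E j)) = p (Sum.inr (Sum.inr j)) -
      subst (Sum.elim (fun k => p (Sum.inr (Sum.inl k))) fun k => p (Sum.inl (Sum.inl k)))
        (MvPowerSeries.map (starRingEnd ℂ) (E j)) := by
  have hs := hasSubst_of_constantCoeff_zero hp
  rw [conjSeries_graphFun, subst_sub hs, subst_X hs, subst_rename hp]
  congr 2
  funext t; rcases t with i | i <;> rfl

/-- The subset `z' = ρ(z')` of `M` is the image of its parametrization. -/
theorem fixedIn_eq_graphIdeal (hE : ∀ j, constantCoeff (E j) = 0)
    (hP : IsAntiholomorphicInvolution P) :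
    fixedIn (manifold E) P = graphIdeal (baseEmb ι) (leafMap E P) := by
  have hp := constantCoeff_leafMap hE hP.1
  have hs := hasSubst_of_constantCoeff_zero hp
  apply le_antisymm
  · rw [fixedIn, manifold, ← Ideal.span_union, Ideal.span_le]
    rintro _ ((⟨j, rfl⟩ | ⟨j, rfl⟩) | (⟨j, rfl⟩ | ⟨j, rfl⟩)) <;>
      rw [SetLike.mem_coe, mem_graphIdeal hp leafMap_baseEmb]
    · rw [subst_graphFun _ hp]
      exact sub_self _
    · simp only [subst_conjSeries_graphFun _ hp]
      exact sub_self _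
    · rw [fixFun_eq, subst_sub hs, subst_X hs, subst_rename hp]
      have : leafMap E P ∘ baseEmb ι = X := rfl
      rw [this, subst_self]
      exact sub_self _
    -- The conjugate equation holds on the parametrized set precisely because `ρ` is an involution.
    · simp only [conjSeries_fixFun]
      rw [subst_sub hs, subst_X hs, subst_rename hp, sub_eq_zero]
      exact (hP.2 j).symm
  · have hfix : ∀ j, X (Sum.inr (Sum.inl j)) - rename (R := ℂ) (baseEmb ι) (P j) ∈
        fixedIn (manifold E) P := fun j => by
      rw [← fixFun_eq]
      exact Ideal.mem_sup_right (Ideal.subset_span (Or.inl ⟨j, rfl⟩))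
    rw [graphIdeal, Ideal.span_le]
    rintro _ ⟨(j | j) | (j | j), rfl⟩
    · have : X (Sum.inl (Sum.inl j)) - rename (R := ℂ) (baseEmb ι)
          (leafMap E P (Sum.inl (Sum.inl j))) = 0 := by
        rw [show leafMap E P (Sum.inl (Sum.inl j)) = X j from rfl, rename_X]
        exact sub_self _
      rw [SetLike.mem_coe]
      exact (congrArg (· ∈ fixedIn (manifold E) P) this).mpr (zero_mem _)
    · have h1 : graphFun E j ∈ fixedIn (manifold E) P :=
        Ideal.mem_sup_left (Ideal.subset_span (Or.inl ⟨j, rfl⟩))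
      have h2 := subst_sub_subst_mem (fixedIn (manifold E) P)
        (u := X ∘ (Sum.map Sum.inl Sum.inl : ι ⊕ ι → (ι ⊕ ι) ⊕ (ι ⊕ ι)))
        (v := fun t => rename (R := ℂ) (baseEmb ι) (Sum.elim X P t)) (fun i => by simp)
        (fun i => by rcases i with i | i <;> simp [hP.1]) (by
          rintro (k | k)
          · simp [baseEmb]
          · exact hfix k) (E j)
      rw [← rename_eq_subst, ← rename_subst (constantCoeff_sumElim (by simp) hP.1)] at h2
      have := Ideal.add_mem _ h1 h2
      rw [graphFun, evalBar, sub_add_sub_cancel] at this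
      exact this
    · exact hfix j
    · have h1 : conjSeries (graphFun E j) ∈ fixedIn (manifold E) P :=
        Ideal.mem_sup_left (Ideal.subset_span (Or.inr ⟨j, rfl⟩))
      have h2 := subst_sub_subst_mem (fixedIn (manifold E) P)
        (u := X ∘ (Sum.elim (Sum.inr ∘ Sum.inl) (Sum.inl ∘ Sum.inl) :
          ι ⊕ ι → (ι ⊕ ι) ⊕ (ι ⊕ ι)))
        (v := fun t => rename (R := ℂ) (baseEmb ι) (Sum.elim P X t)) (fun i => by simp)
        (fun i => by rcases i with i | i <;> simp [hP.1]) (by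
          rintro (k | k)
          · exact hfix k
          · simp [baseEmb]) (MvPowerSeries.map (starRingEnd ℂ) (E j))
      rw [← rename_eq_subst, ← rename_subst (constantCoeff_sumElim hP.1 (by simp))] at h2
      have := Ideal.add_mem _ h1 h2
      rw [conjSeries_graphFun, sub_add_sub_cancel] at this
      exact this

/-- The subset `z' = ρ(z')` of `M` determines `ρ`. -/
theorem fixedIn_injective (hE : ∀ j, constantCoeff (E j) = 0) {P P' : ι → MvPowerSeries ι ℂ}
    (hP : IsAntiholomorphicInvolution P)
    (h : fixedIn (manifold E) P = fixedIn (manifold E) P') : P = P' := by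
  funext j
  have h1 : fixFun P' j ∈ fixedIn (manifold E) P := by
    rw [h]
    exact Ideal.mem_sup_right (Ideal.subset_span (Or.inl ⟨j, rfl⟩))
  have hp := constantCoeff_leafMap hE hP.1
  have hs := hasSubst_of_constantCoeff_zero hp
  rw [fixedIn_eq_graphIdeal hE hP, mem_graphIdeal hp leafMap_baseEmb, fixFun_eq, subst_sub hs,
    subst_X hs, subst_rename hp] at h1
  have h2 : leafMap E P ∘ baseEmb ι = X := rfl
  rw [h2, subst_self, sub_eq_zero] at h1
  exact h1

theorem conjSeries_mem_fixedIn {f : RealSeries (ι ⊕ ι)} (hf : f ∈ fixedIn (manifold E) P) :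
    conjSeries f ∈ fixedIn (manifold E) P := by
  have h : fixedIn (manifold E) P ≤ (fixedIn (manifold E) P).comap conjSeries := by
    rw [fixedIn, sup_le_iff]
    exact ⟨(span_union_conj_le_comap _).trans (Ideal.comap_mono le_sup_left),
      (span_union_conj_le_comap _).trans (Ideal.comap_mono le_sup_right)⟩
  exact h hf

theorem linearPart_map_conj (P : ι → MvPowerSeries ι ℂ) :
    linearPart (fun j => MvPowerSeries.map (starRingEnd ℂ) (P j)) = (linearPart P).map conj := by
  ext i j
  simp [linearPart, linCoeff_map]

theorem IsAntiholomorphicInvolution.linearPart_mul [DecidableEq ι]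
    (hP : IsAntiholomorphicInvolution P) : (linearPart P).map conj * linearPart P = 1 := by
  rw [← linearPart_map_conj]
  exact linearPart_mul_of_subst_eq_X hP.1 hP.2

end Leaf

section Leaf

variable {ι : Type} [Fintype ι] {E : ι → MvPowerSeries (ι ⊕ ι) ℂ} {P : ι → MvPowerSeries ι ℂ}

theorem linCoeff_leafMap (hE : ∀ j, E j ∈ ordIdeal (ι ⊕ ι) 2)
    (hP : ∀ j, constantCoeff (P j) = 0) (k : ι) (t : (ι ⊕ ι) ⊕ (ι ⊕ ι)) :
    linCoeff k (leafMap E P t) = Sum.elim (Sum.elim (fun j => linCoeff k (X j)) 0)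
      (Sum.elim (fun j => linCoeff k (P j)) 0) t := by
  have h1 := constantCoeff_sumElim (u := X) (fun i : ι => by simp) hP
  have h2 := constantCoeff_sumElim (v := X) hP (fun i : ι => by simp)
  rcases t with (j | j) | (j | j)
  · rfl
  · exact linCoeff_of_mem (subst_mem_ordIdeal h1 (hE j))
  · rfl
  · exact linCoeff_of_mem (subst_mem_ordIdeal h2 (map_mem_ordIdeal _ (hE j)))

theorem linCoeff_graphFun [DecidableEq ι] (hE : ∀ j, E j ∈ ordIdeal (ι ⊕ ι) 2) (j : ι)
    (t : (ι ⊕ ι) ⊕ (ι ⊕ ι)) :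
    linCoeff t (graphFun E j) = if t = Sum.inl (Sum.inr j) then 1 else 0 := by
  rw [graphFun, evalBar, linCoeff_sub, linCoeff_of_mem (rename_mem_ordIdeal _ (hE j)), sub_zero,
    linCoeff_X]

theorem constantCoeff_of_mem_two {σ : Type} {f : MvPowerSeries σ ℂ} (hf : f ∈ ordIdeal σ 2) :
    constantCoeff f = 0 := mem_ordIdeal_one.1 (ordIdeal_mono (by norm_num) hf)

/-- The differentials of the elements of an ideal. -/
theorem sum_linCoeff_mul_eq_zero_of_mem_span {σ κ : Type} [Fintype σ] [Fintype κ]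
    {r : κ → MvPowerSeries σ ℂ} (hr : ∀ i, constantCoeff (r i) = 0) {x : σ → ℂ}
    (hx : ∀ i, ∑ t, linCoeff t (r i) * x t = 0) {f : MvPowerSeries σ ℂ}
    (hf : f ∈ Ideal.span (Set.range r)) : ∑ t, linCoeff t f * x t = 0 := by
  obtain ⟨c, rfl⟩ := Ideal.mem_span_range_iff_exists_fun.1 hf
  simp only [linCoeff_sum, linCoeff_mul, hr, mul_zero, add_zero, Finset.sum_mul]
  rw [Finset.sum_comm]
  refine Finset.sum_eq_zero fun i _ => ?_
  simp only [mul_assoc]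
  rw [← Finset.mul_sum, hx, mul_zero]

/-- A totally real formal submanifold of dimension `p` of `M` is defined by an antiholomorphic
involution. -/
theorem exists_eq_fixedIn (hE : ∀ j, E j ∈ ordIdeal (ι ⊕ ι) 2)
    {I : Ideal (RealSeries (ι ⊕ ι))} (hI : IsFormalSubmanifold (3 * Fintype.card ι) I)
    (hT : IsTotallyReal I) (hM : manifold E ≤ I) :
    ∃ P, IsAntiholomorphicInvolution P ∧ I = fixedIn (manifold E) P := by
  classical
  have hE0 : ∀ j, constantCoeff (E j) = 0 := fun j => constantCoeff_of_mem_two (hE j)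
  obtain ⟨r, hr0, hrc, hlin, hIr⟩ := hI
  have hconj : ∀ f ∈ I, conjSeries f ∈ I := by
    have : I ≤ I.comap conjSeries := by
      rw [hIr, Ideal.span_le]
      rintro _ ⟨i, rfl⟩
      exact Ideal.subset_span ⟨i, (hrc i).symm⟩
    exact fun f hf => this hf
  have hgr : ∀ j, graphFun E j ∈ I := fun j => hM (Ideal.subset_span (Or.inl ⟨j, rfl⟩))
  -- To show that `z'` are coordinates: a complexified tangent vector with zero `z'`-part has zero
  -- `z''`- and `z̄''`-parts since `M` is tangent to `z'' = 0`. Its `z̄'`-part remains to be killed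
  -- by total reality.
  obtain ⟨p, hp, hpe, hpI⟩ := exists_span_range_eq_graphIdeal (baseEmb ι) r hr0
    (by simp only [Fintype.card_fin, Fintype.card_sum]; ring) hlin (by
      intro x hx0 hx
      have hall : ∀ f ∈ I, ∑ t, linCoeff t f * x t = 0 := fun f hf =>
        sum_linCoeff_mul_eq_zero_of_mem_span hr0 hx (hIr ▸ hf)
      have hx1 : ∀ j, x (Sum.inl (Sum.inr j)) = 0 := fun j => by
        simpa [linCoeff_graphFun hE, ite_mul] using hall _ (hgr j)
      have hx2 : ∀ j, x (Sum.inr (Sum.inr j)) = 0 := fun j => by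
        have := hall _ (hconj _ (hgr j))
        simp only [linCoeff_conjSeries, linCoeff_graphFun hE] at this
        simpa [apply_ite, ite_mul, Fintype.sum_sum_type] using this
      have hx0' : ∀ j, x (Sum.inl (Sum.inl j)) = 0 := hx0
      have h3 : ∀ f ∈ I, ∑ k, linCoeff (Sum.inr (Sum.inl k)) f * x (Sum.inr (Sum.inl k)) = 0 := by
        intro f hf
        have := hall f hf
        simpa [Fintype.sum_sum_type, hx0', hx1, hx2] using this
      have h4 : ∀ f ∈ I,
          ∑ k, linCoeff (Sum.inl (Sum.inl k)) f * conj (x (Sum.inr (Sum.inl k))) = 0 := by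
        intro f hf
        have := congrArg conj (h3 _ (hconj f hf))
        simpa [linCoeff_conjSeries] using this
      -- For this vector the holomorphic and antiholomorphic halves of every differential vanish
      -- separately, by `h4` and `h3`, so its multiple by `i` is tangent as well.
      have hv := hT (Sum.elim (fun k => conj (x (Sum.inr (Sum.inl k)))) 0)
        (fun f hf => by
          simp [diffAtZero, Fintype.sum_sum_type, h3 f hf, h4 f hf])
        (fun f hf => by
          have h3' := congrArg (Complex.I * ·) (h3 f hf)
          have h4' := congrArg (Complex.I * ·) (h4 f hf)
          simp only [Finset.mul_sum, mul_zero] at h3' h4'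
          simp only [diffAtZero, Fintype.sum_sum_type, Pi.smul_apply, Sum.elim_inl, Sum.elim_inr,
            smul_eq_mul, map_mul, Complex.conj_conj, Complex.conj_I, Pi.zero_apply, mul_zero,
            map_zero, Finset.sum_const_zero, add_zero, neg_mul, mul_neg, Finset.sum_neg_distrib]
          simp only [mul_left_comm _ Complex.I]
          rw [h3', h4', neg_zero, add_zero])
      funext t
      rcases t with (j | j) | (j | j)
      · exact hx0' j
      · exact hx1 j
      · simpa using congrFun hv (Sum.inl j)
      · exact hx2 j)
  have hs := hasSubst_of_constantCoeff_zero hp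
  have hmem : ∀ f, f ∈ I ↔ subst p f = 0 := fun f => by
    rw [hIr, hpI, mem_graphIdeal hp hpe]
  have hpe' : (fun k => p (Sum.inl (Sum.inl k))) = X := funext hpe
  set P : ι → MvPowerSeries ι ℂ := fun k => p (Sum.inr (Sum.inl k)) with hPdef
  have hP : IsAntiholomorphicInvolution P := by
    refine ⟨fun j => hp _, fun j => ?_⟩
    have h1 : fixFun P j ∈ I := by
      rw [hIr, hpI, fixFun_eq]
      exact Ideal.subset_span ⟨Sum.inr (Sum.inl j), rfl⟩
    have h2 := (hmem _).1 (hconj _ h1)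
    rw [conjSeries_fixFun, subst_sub hs, subst_X hs, subst_rename hp, sub_eq_zero] at h2
    exact h2.symm.trans (hpe j)
  refine ⟨P, hP, ?_⟩
  have hleaf : p = leafMap E P := by
    funext t
    rcases t with (j | j) | (j | j)
    · exact hpe j
    · have := (hmem _).1 (hgr j)
      rw [subst_graphFun _ hp, sub_eq_zero, hpe'] at this
      exact this
    · rfl
    · have := (hmem _).1 (hconj _ (hgr j))
      rw [subst_conjSeries_graphFun _ hp, sub_eq_zero, hpe'] at this
      exact this
  rw [fixedIn_eq_graphIdeal hE0 hP, hIr, hpI, hleaf]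

/-- Independent differentials that avoid the coordinates `e a` form, by the count of dimensions, an
invertible matrix in the remaining ones; so the values of the `f i` determine these coordinates. -/
theorem eq_of_subst_eq {σ α τ κ : Type} [Fintype α] [Fintype τ] [Fintype κ] (e : α ↪ τ)
    (f : κ → MvPowerSeries τ ℂ) (hlin : LinearIndependent ℂ fun i => fun t => linCoeff t (f i))
    (hcard : Fintype.card κ + Fintype.card α = Fintype.card τ)
    (hz : ∀ i a, linCoeff (e a) (f i) = 0) {p p' : τ → MvPowerSeries σ ℂ}
    (hp : ∀ t, constantCoeff (p t) = 0) (hp' : ∀ t, constantCoeff (p' t) = 0)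
    (he : ∀ a, p (e a) = p' (e a)) (h : ∀ i, subst p (f i) = subst p' (f i)) : p = p' := by
  classical
  obtain ⟨L, hL, hL'⟩ := exists_two_sided_inverse (normalMatrix e f).transpose
    (by have := card_compl_range_add e; omega) (by
      intro x hx
      have := Fintype.linearIndependent_iff.1 hlin x (by
        funext t
        simp only [Finset.sum_apply, Pi.smul_apply, smul_eq_mul, Pi.zero_apply]
        by_cases ht : t ∈ Set.range e
        · obtain ⟨k, rfl⟩ := ht
          exact Finset.sum_eq_zero fun i _ => by rw [hz, mul_zero]
        · rw [← hx ⟨t, ht⟩]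
          exact Finset.sum_congr rfl fun i _ => mul_comm _ _)
      exact funext this)
  refine implicit_unique e f L.transpose ?_ hp hp' he h
  have := congrArg Matrix.transpose hL'
  rwa [Matrix.transpose_mul, Matrix.transpose_transpose, Matrix.transpose_one] at this

/-- The leaves of `M` in a complex submanifold of dimension `p` have the same `z''`-coordinates. -/
theorem subst_eq_subst_of_le (hE : ∀ j, E j ∈ ordIdeal (ι ⊕ ι) 2)
    {K : Ideal (RealSeries (ι ⊕ ι))} (hK : IsFormalComplexSubmanifold (Fintype.card ι) K)
    {P₁ P₂ : ι → MvPowerSeries ι ℂ} (hP₁ : IsAntiholomorphicInvolution P₁)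
    (hP₂ : IsAntiholomorphicInvolution P₂) (h₁ : K ≤ fixedIn (manifold E) P₁)
    (h₂ : K ≤ fixedIn (manifold E) P₂) (j : ι) :
    subst (Sum.elim X P₁) (E j) = subst (Sum.elim X P₂) (E j) := by
  classical
  have hE0 : ∀ j, constantCoeff (E j) = 0 := fun j => constantCoeff_of_mem_two (hE j)
  obtain ⟨f, hf0, hlin, rfl⟩ := hK
  have key : ∀ P, IsAntiholomorphicInvolution P →
      Ideal.span (Set.range (fun i => ofHol (f i)) ∪
        Set.range (fun i => conjSeries (ofHol (f i)))) ≤ fixedIn (manifold E) P →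
      ∀ i, subst (leafMap E P ∘ Sum.inl) (f i) = 0 := by
    intro P hP h i
    have h1 : ofHol (f i) ∈ fixedIn (manifold E) P := h (Ideal.subset_span (Or.inl ⟨i, rfl⟩))
    rwa [fixedIn_eq_graphIdeal hE0 hP,
      mem_graphIdeal (constantCoeff_leafMap hE0 hP.1) leafMap_baseEmb, ofHol,
      subst_rename (constantCoeff_leafMap hE0 hP.1)] at h1
  have hc : ∀ P, IsAntiholomorphicInvolution P → ∀ t : ι ⊕ ι,
      constantCoeff ((leafMap E P ∘ Sum.inl) t) = 0 :=
    fun P hP t => constantCoeff_leafMap hE0 hP.1 (Sum.inl t)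
  -- `K` contains a leaf, whose tangent directions lie in `z'' = 0` and span `z'` over the complex
  -- numbers; hence `K` is tangent to `z'' = 0` and is a graph over `z'`.
  have hz : ∀ i k, linCoeff (Sum.inl k) (f i) = 0 := by
    intro i k
    have h1 := congrArg (linCoeff k) (key P₁ hP₁ h₁ i)
    rw [linCoeff_subst (hc P₁ hP₁)] at h1
    simpa [linCoeff_leafMap hE hP₁.1, Fintype.sum_sum_type, linCoeff_X] using h1
  have hFF : leafMap E P₁ ∘ Sum.inl = leafMap E P₂ ∘ Sum.inl :=
    eq_of_subst_eq (Function.Embedding.inl : ι ↪ ι ⊕ ι) f hlin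
      (by rw [Fintype.card_fin, Fintype.card_sum]) hz (hc P₁ hP₁) (hc P₂ hP₂) (fun a => by simp [leafMap])
      (fun i => (key P₁ hP₁ h₁ i).trans (key P₂ hP₂ h₂ i).symm)
  exact congrFun hFF (Sum.inr j)

end Leaf

/-! ### Real generators of the ideal of a graph -/

section RealGenerators

variable {α σ : Type} [Fintype α] [Fintype σ]

/-- The real and imaginary parts of a family of series. -/
def realParts {κ : Type} (G : κ → RealSeries σ) : κ ⊕ κ → RealSeries σ :=
  Sum.elim (fun t => G t + conjSeries (G t)) fun t => Complex.I • (G t - conjSeries (G t))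

theorem conjSeries_realParts {κ : Type} (G : κ → RealSeries σ) (t : κ ⊕ κ) :
    conjSeries (realParts G t) = realParts G t := by
  rcases t with t | t
  · simp [realParts, add_comm]
  · simp only [realParts, Sum.elim_inr, conjSeries_smul, map_sub, conjSeries_conjSeries,
      Complex.conj_I, neg_smul]
    rw [← smul_neg, neg_sub]

/-- The vector of linear coefficients. -/
def linVec {τ : Type} : MvPowerSeries τ ℂ →ₗ[ℂ] (τ → ℂ) where
  toFun f t := linCoeff t f
  map_add' f g := by ext; simp
  map_smul' c f := by ext; simp

theorem linVec_mem_span {τ κ : Type} [Fintype τ] [Fintype κ] {G : κ → MvPowerSeries τ ℂ}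
    (hG : ∀ i, constantCoeff (G i) = 0) {f : MvPowerSeries τ ℂ}
    (hf : f ∈ Ideal.span (Set.range G)) :
    linVec f ∈ Submodule.span ℂ (Set.range (linVec ∘ G)) := by
  obtain ⟨c, rfl⟩ := Ideal.mem_span_range_iff_exists_fun.1 hf
  rw [map_sum]
  refine Submodule.sum_mem _ fun i _ => ?_
  have : linVec (c i * G i) = constantCoeff (c i) • linVec (G i) := by
    ext t
    simp [linVec, linCoeff_mul, hG]
  rw [this]
  exact Submodule.smul_mem _ _ (Submodule.subset_span ⟨i, rfl⟩)

theorem finrank_span_linVec_graph {τ : Type} [Fintype τ] {e : α ↪ τ}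
    {p : τ → MvPowerSeries α ℂ} (hpe : ∀ a, p (e a) = X a) :
    Module.finrank ℂ (Submodule.span ℂ (Set.range
      (linVec ∘ fun t => X t - rename (R := ℂ) e (p t)))) + Fintype.card α = Fintype.card τ := by
  classical
  let v : {t // t ∉ Set.range e} → τ → ℂ := fun t => linVec (X t.1 - rename (R := ℂ) e (p t.1))
  have hv : ∀ t s : {t // t ∉ Set.range e}, v t s.1 = if s = t then 1 else 0 := by
    intro t s
    have h1 : linCoeff s.1 (rename (R := ℂ) e (p t.1)) = 0 := by
      rw [linCoeff_rename]
      refine Finset.sum_eq_zero fun a _ => ?_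
      rw [if_neg (fun h => s.2 ⟨a, h.symm⟩), mul_zero]
    simp only [v, linVec, LinearMap.coe_mk, AddHom.coe_mk, linCoeff_sub, linCoeff_X, h1, sub_zero,
      Subtype.ext_iff]
  have hind : LinearIndependent ℂ v := by
    rw [Fintype.linearIndependent_iff]
    intro c hc s
    have := congrFun hc s.1
    simpa [hv] using this
  have hspan : Submodule.span ℂ (Set.range (linVec ∘ fun t => X t - rename (R := ℂ) e (p t))) =
      Submodule.span ℂ (Set.range v) := by
    apply le_antisymm
    · rw [Submodule.span_le]
      rintro _ ⟨t, rfl⟩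
      by_cases ht : t ∈ Set.range e
      · obtain ⟨a, rfl⟩ := ht
        simp [hpe]
      · exact Submodule.subset_span ⟨⟨t, ht⟩, rfl⟩
    · refine Submodule.span_mono ?_
      rintro _ ⟨t, rfl⟩
      exact ⟨t.1, rfl⟩
  rw [hspan, finrank_span_eq_card hind, card_compl_range_add]

/-- The ideal of a graph that is invariant under conjugation is generated by real and imaginary
parts of its equations, as many as its codimension. -/
theorem exists_real_generators {e : α ↪ σ ⊕ σ} {p : σ ⊕ σ → MvPowerSeries α ℂ}
    (hp : ∀ t, constantCoeff (p t) = 0) (hpe : ∀ a, p (e a) = X a)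
    (hconj : ∀ f ∈ graphIdeal e p, conjSeries f ∈ graphIdeal e p) {k : ℕ}
    (hk : k + Fintype.card α = Fintype.card (σ ⊕ σ)) :
    ∃ c : Fin k → (σ ⊕ σ) ⊕ (σ ⊕ σ),
      LinearIndependent ℂ (fun i t => linCoeff t
        (realParts (fun t => X t - rename (R := ℂ) e (p t)) (c i))) ∧
      graphIdeal e p = Ideal.span (Set.range fun i =>
        realParts (fun t => X t - rename (R := ℂ) e (p t)) (c i)) := by
  classical
  set G : σ ⊕ σ → RealSeries σ := fun t => X t - rename (R := ℂ) e (p t) with hG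
  have hG0 : ∀ t, constantCoeff (G t) = 0 := fun t => by simp [G, hp]
  have hGm : ∀ t, G t ∈ graphIdeal e p := fun t => Ideal.subset_span ⟨t, rfl⟩
  have hRm : ∀ t, realParts G t ∈ graphIdeal e p := by
    rintro (t | t)
    · exact Ideal.add_mem _ (hGm t) (hconj _ (hGm t))
    · simp only [realParts, Sum.elim_inr, smul_eq_C_mul]
      exact Ideal.mul_mem_left _ _ (Ideal.sub_mem _ (hGm t) (hconj _ (hGm t)))
  have hspan : Submodule.span ℂ (Set.range (linVec ∘ realParts G)) =
      Submodule.span ℂ (Set.range (linVec ∘ G)) := by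
    apply le_antisymm
    · rw [Submodule.span_le]
      rintro _ ⟨t, rfl⟩
      exact linVec_mem_span hG0 (hRm t)
    · rw [Submodule.span_le]
      rintro _ ⟨t, rfl⟩
      have : G t = (1 / 2 : ℂ) • (realParts G (Sum.inl t) -
          Complex.I • realParts G (Sum.inr t)) := by
        simp only [realParts, Sum.elim_inl, Sum.elim_inr, smul_smul, Complex.I_mul_I]
        module
      rw [Function.comp, this, map_smul, map_sub, map_smul]
      exact Submodule.smul_mem _ _ (Submodule.sub_mem _ (Submodule.subset_span ⟨_, rfl⟩)
        (Submodule.smul_mem _ _ (Submodule.subset_span ⟨_, rfl⟩)))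
  -- A basis is extracted from the differentials of the real and imaginary parts; its size is the
  -- codimension, so `span_range_eq_graphIdeal` applies.
  obtain ⟨κ, a, ha, hsp, hind⟩ := exists_linearIndependent' ℂ (linVec ∘ realParts G)
  have : Finite κ := Finite.of_injective a ha
  have : Fintype κ := Fintype.ofFinite κ
  have hcard : Fintype.card κ = k := by
    have h1 := finrank_span_eq_card hind
    have h2 := finrank_span_linVec_graph (e := e) hpe
    rw [← hG, ← hspan, ← hsp, h1] at h2
    omega
  let w : Fin k ≃ κ := (Fintype.equivFinOfCardEq hcard).symm
  have hind' := hind.comp w w.injective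
  refine ⟨fun i => a (w i), hind', ?_⟩
  exact (span_range_eq_graphIdeal hp hpe _ (fun i => hRm _)
    (by rw [Fintype.card_fin]; exact hk) hind').symm

end RealGenerators

/-! ### Convergence of polynomials -/

section Convergent

variable {τ σ : Type}

/-- The subring of polynomials in the ring of power series. -/
def polySubalgebra (τ : Type) : Subalgebra ℂ (MvPowerSeries τ ℂ) :=
  (MvPolynomial.coeToMvPowerSeries.algHom (σ := τ) ℂ (R := ℂ)).range

theorem X_mem_polySubalgebra (i : τ) : (X i : MvPowerSeries τ ℂ) ∈ polySubalgebra τ :=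
  ⟨MvPolynomial.X i, by simp⟩

/-- Analyticity is needed only for linear leaves of the quadric, where all equations are polynomial.
With finitely many coefficients, ratio one and the sum of their norms suffice. -/
theorem isConvergent_of_mem {f : MvPowerSeries τ ℂ} (hf : f ∈ polySubalgebra τ) :
    IsConvergent f := by
  obtain ⟨q, rfl⟩ := hf
  refine ⟨∑ n ∈ q.support, ‖q.coeff n‖, 1, fun n => ?_⟩
  simp only [AlgHom.toRingHom_eq_coe, RingHom.coe_coe, MvPolynomial.coeToMvPowerSeries.algHom_apply,
    Algebra.algebraMap_self, map_id, RingHom.id_apply, MvPolynomial.coeff_coe, one_pow, mul_one]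
  by_cases h : n ∈ q.support
  · exact Finset.single_le_sum (f := fun n => ‖q.coeff n‖) (fun _ _ => norm_nonneg _) h
  · rw [MvPolynomial.notMem_support_iff.1 h, norm_zero]
    exact Finset.sum_nonneg fun _ _ => norm_nonneg _

theorem map_mem_polySubalgebra (φ : MvPowerSeries τ ℂ →+* MvPowerSeries σ ℂ)
    (hC : ∀ c, φ (C c) ∈ polySubalgebra σ) (hX : ∀ i, φ (X i) ∈ polySubalgebra σ)
    {f : MvPowerSeries τ ℂ} (hf : f ∈ polySubalgebra τ) : φ f ∈ polySubalgebra σ := by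
  obtain ⟨q, rfl⟩ := hf
  induction q using MvPolynomial.induction_on with
  | C a => simpa [MvPowerSeries.algebraMap_apply] using hC a
  | add p q hp hq =>
    simp only [map_add] at hp hq ⊢
    exact add_mem hp hq
  | mul_X p i hp =>
    simp only [map_mul] at hp ⊢
    exact mul_mem hp (by simpa using hX i)

theorem C_mem_polySubalgebra (c : ℂ) : (C c : MvPowerSeries τ ℂ) ∈ polySubalgebra τ :=
  (polySubalgebra τ).algebraMap_mem c

theorem rename_mem_polySubalgebra [Finite τ] (c : τ → σ) {f : MvPowerSeries τ ℂ}
    (hf : f ∈ polySubalgebra τ) : rename (R := ℂ) c f ∈ polySubalgebra σ :=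
  map_mem_polySubalgebra (rename (R := ℂ) c).toRingHom
    (fun a => by simpa using C_mem_polySubalgebra a)
    (fun i => by simpa using X_mem_polySubalgebra (c i)) hf

theorem map_conj_mem_polySubalgebra {f : MvPowerSeries τ ℂ}
    (hf : f ∈ polySubalgebra τ) :
    MvPowerSeries.map (starRingEnd ℂ) f ∈ polySubalgebra τ :=
  map_mem_polySubalgebra (MvPowerSeries.map (starRingEnd ℂ))
    (fun a => by simpa using C_mem_polySubalgebra (conj a))
    (fun i => by simpa using X_mem_polySubalgebra i) hf

theorem subst_mem_polySubalgebra [Finite τ] {a : τ → MvPowerSeries σ ℂ}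
    (ha : ∀ i, constantCoeff (a i) = 0) (ha' : ∀ i, a i ∈ polySubalgebra σ)
    {f : MvPowerSeries τ ℂ} (hf : f ∈ polySubalgebra τ) : subst a f ∈ polySubalgebra σ := by
  have hs := hasSubst_of_constantCoeff_zero ha
  rw [← substAlgHom_apply (R := ℂ) hs]
  exact map_mem_polySubalgebra (substAlgHom (R := ℂ) hs).toRingHom
    (fun c => by simpa using C_mem_polySubalgebra c) (fun i => by
      simpa [subst_X hs] using ha' i) hf

theorem conjSeries_mem_polySubalgebra [Finite τ] {f : RealSeries τ}
    (hf : f ∈ polySubalgebra (τ ⊕ τ)) : conjSeries f ∈ polySubalgebra (τ ⊕ τ) :=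
  rename_mem_polySubalgebra _ (map_conj_mem_polySubalgebra hf)

end Convergent

/-! ### Geometry of the leaves -/

section Leaf

variable {ι : Type} [Fintype ι] {E : ι → MvPowerSeries (ι ⊕ ι) ℂ} {P : ι → MvPowerSeries ι ℂ}

/-- Since `E` has order two, `z''` does not contribute to first order and only the linear part of
`z̄' = P(z')` remains. -/
theorem mem_tangentSpace_fixedIn (hE : ∀ j, E j ∈ ordIdeal (ι ⊕ ι) 2)
    (hP : IsAntiholomorphicInvolution P) (v : ι ⊕ ι → ℂ) :
    v ∈ tangentSpace (fixedIn (manifold E) P) ↔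
      (∀ j, v (Sum.inr j) = 0) ∧
        (linearPart P).mulVec (v ∘ Sum.inl) = fun j => conj (v (Sum.inl j)) := by
  classical
  have hE0 : ∀ j, constantCoeff (E j) = 0 := fun j => constantCoeff_of_mem_two (hE j)
  constructor
  · intro hv
    constructor
    · intro j
      have := hv (graphFun E j) (Ideal.mem_sup_left (Ideal.subset_span (Or.inl ⟨j, rfl⟩)))
      simpa [diffAtZero, linCoeff_graphFun hE] using this
    · funext j
      have := hv (fixFun P j) (Ideal.mem_sup_right (Ideal.subset_span (Or.inl ⟨j, rfl⟩)))
      simp only [diffAtZero, fixFun_eq, linCoeff_sub, linCoeff_X, linCoeff_rename,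
        Fintype.sum_sum_type] at this
      simp [baseEmb] at this
      rw [Matrix.mulVec, dotProduct]
      simp only [linearPart, Matrix.of_apply, Function.comp]
      linear_combination -this
  · rintro ⟨hv1, hv2⟩ f hf
    have hp := constantCoeff_leafMap hE0 hP.1
    rw [fixedIn_eq_graphIdeal hE0 hP, mem_graphIdeal hp leafMap_baseEmb] at hf
    have h1 : ∑ k, linCoeff k (subst (leafMap E P) f) * v (Sum.inl k) = 0 := by simp [hf]
    simp only [linCoeff_subst hp, linCoeff_leafMap hE hP.1, Finset.sum_mul] at h1
    rw [Finset.sum_comm] at h1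
    simp only [mul_assoc, ← Finset.mul_sum] at h1
    rw [diffAtZero, ← h1]
    have h2 : ∀ j, ∑ k, linCoeff k (P j) * v (Sum.inl k) = conj (v (Sum.inl j)) :=
      fun j => congrFun hv2 j
    simp [Fintype.sum_sum_type, linCoeff_X, hv1, h2]

/-- The linear part of `P` is complex linear while conjugation is antilinear, so the tangency
conditions for `v` and for `i v` are incompatible unless `v = 0`. -/
theorem isTotallyReal_fixedIn (hE : ∀ j, E j ∈ ordIdeal (ι ⊕ ι) 2)
    (hP : IsAntiholomorphicInvolution P) : IsTotallyReal (fixedIn (manifold E) P) := by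
  intro v hv hv'
  rw [mem_tangentSpace_fixedIn hE hP] at hv hv'
  have h : ∀ j, v (Sum.inl j) = 0 := by
    intro j
    have h1 : (Complex.I • v) ∘ Sum.inl = Complex.I • (v ∘ Sum.inl : ι → ℂ) := rfl
    have h2 := congrFun hv'.2 j
    rw [h1, Matrix.mulVec_smul, hv.2] at h2
    simp only [Pi.smul_apply, smul_eq_mul, map_mul, Complex.conj_I] at h2
    have h3 : (2 * Complex.I) * conj (v (Sum.inl j)) = 0 := by linear_combination h2
    simpa using h3
  funext t
  rcases t with j | j
  · exact h j
  · exact hv.1 j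

/-- Transversality of two leaves in terms of the linear parts of the involutions. -/
theorem tangentSpace_inf_eq_bot_iff (hE : ∀ j, E j ∈ ordIdeal (ι ⊕ ι) 2)
    {P₁ P₂ : ι → MvPowerSeries ι ℂ}
    (hP₁ : IsAntiholomorphicInvolution P₁) (hP₂ : IsAntiholomorphicInvolution P₂) :
    tangentSpace (fixedIn (manifold E) P₁) ⊓ tangentSpace (fixedIn (manifold E) P₂) = ⊥ ↔
      ∀ u, (linearPart P₁).mulVec u = (linearPart P₂).mulVec u → u = 0 := by
  classical
  constructor
  · intro h u hu
    set w : ι → ℂ := (linearPart P₁).mulVec u with hw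
    have hconj : ∀ P, IsAntiholomorphicInvolution P → (linearPart P).mulVec u = w →
        (linearPart P).mulVec (fun j => conj (w j)) = fun j => conj (u j) := by
      intro P hP hPw
      have h1 := congrArg (fun A => A.mulVec u) hP.linearPart_mul
      simp only [← Matrix.mulVec_mulVec, Matrix.one_mulVec, hPw] at h1
      funext j
      have := congrArg conj (congrFun h1 j)
      simpa [Matrix.mulVec, dotProduct] using this
    -- A common value `w` of the two linear parts at `u` produces, for every scalar `c`, a vector
    -- fixed by both antilinear involutions. The choices `c = 1` and `c = i` then give `u = 0`.
    have key : ∀ c : ℂ, ∀ j, c * u j + conj (c * w j) = 0 := by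
      intro c
      have hmem : ∀ P, IsAntiholomorphicInvolution P → (linearPart P).mulVec u = w →
          (Sum.elim (fun j => c * u j + conj (c * w j)) 0 : ι ⊕ ι → ℂ) ∈
            tangentSpace (fixedIn (manifold E) P) := by
        intro P hP hPw
        rw [mem_tangentSpace_fixedIn hE hP]
        refine ⟨fun j => rfl, ?_⟩
        have h1 : (Sum.elim (fun j => c * u j + conj (c * w j)) 0 : ι ⊕ ι → ℂ) ∘ Sum.inl =
            c • u + conj c • fun j => conj (w j) := by
          funext j; simp
        rw [h1, Matrix.mulVec_add, Matrix.mulVec_smul, Matrix.mulVec_smul, hPw, hconj P hP hPw]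
        funext j
        simp [add_comm]
      have h2 : (Sum.elim (fun j => c * u j + conj (c * w j)) 0 : ι ⊕ ι → ℂ) ∈
          tangentSpace (fixedIn (manifold E) P₁) ⊓ tangentSpace (fixedIn (manifold E) P₂) :=
        ⟨hmem P₁ hP₁ rfl, hmem P₂ hP₂ hu.symm⟩
      rw [h, Submodule.mem_bot] at h2
      exact fun j => congrFun h2 (Sum.inl j)
    funext j
    have h1 := key 1 j
    have h2 := key Complex.I j
    simp only [one_mul, map_mul, Complex.conj_I] at h1 h2
    have h3 : (2 * Complex.I) * u j = 0 := by linear_combination Complex.I * h1 + h2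
    simpa using h3
  · intro h
    rw [eq_bot_iff]
    rintro v ⟨hv1, hv2⟩
    rw [SetLike.mem_coe, mem_tangentSpace_fixedIn hE hP₁] at hv1
    rw [SetLike.mem_coe, mem_tangentSpace_fixedIn hE hP₂] at hv2
    have h1 := h _ (hv1.2.trans hv2.2.symm)
    rw [Submodule.mem_bot]
    funext t
    rcases t with j | j
    · exact congrFun h1 j
    · exact hv1.1 j

theorem exists_real_generators_fixedIn (hE : ∀ j, constantCoeff (E j) = 0)
    (hP : IsAntiholomorphicInvolution P) :
    ∃ c : Fin (3 * Fintype.card ι) → ((ι ⊕ ι) ⊕ (ι ⊕ ι)) ⊕ ((ι ⊕ ι) ⊕ (ι ⊕ ι)),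
      LinearIndependent ℂ (fun i t => linCoeff t
        (realParts (fun t => X t - rename (R := ℂ) (baseEmb ι) (leafMap E P t)) (c i))) ∧
      fixedIn (manifold E) P = Ideal.span (Set.range fun i =>
        realParts (fun t => X t - rename (R := ℂ) (baseEmb ι) (leafMap E P t)) (c i)) := by
  have h := fixedIn_eq_graphIdeal hE hP
  rw [h]
  refine exists_real_generators (constantCoeff_leafMap hE hP.1) leafMap_baseEmb ?_ ?_
  · rw [← h]
    exact fun f hf => conjSeries_mem_fixedIn hf
  · simp only [Fintype.card_sum]; ring

theorem constantCoeff_realParts {κ σ : Type} [Fintype σ] {G : κ → RealSeries σ}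
    (hG : ∀ t, constantCoeff (G t) = 0) (t : κ ⊕ κ) : constantCoeff (realParts G t) = 0 := by
  rcases t with t | t <;> simp [realParts, constantCoeff_conjSeries, hG]

theorem isFormalSubmanifold_fixedIn (hE : ∀ j, constantCoeff (E j) = 0)
    (hP : IsAntiholomorphicInvolution P) :
    IsFormalSubmanifold (3 * Fintype.card ι) (fixedIn (manifold E) P) := by
  obtain ⟨c, h1, h2⟩ := exists_real_generators_fixedIn hE hP
  have hp := constantCoeff_leafMap hE hP.1
  exact ⟨_, fun i => constantCoeff_realParts (fun t => by simp [hp]) _,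
    fun i => conjSeries_realParts _ _, h1, h2⟩

theorem isAnalyticSubmanifold_fixedIn (hE : ∀ j, constantCoeff (E j) = 0)
    (hP : IsAntiholomorphicInvolution P) (hEp : ∀ j, E j ∈ polySubalgebra (ι ⊕ ι))
    (hPp : ∀ j, P j ∈ polySubalgebra ι) :
    IsAnalyticSubmanifold (3 * Fintype.card ι) (fixedIn (manifold E) P) := by
  obtain ⟨c, h1, h2⟩ := exists_real_generators_fixedIn hE hP
  have hp := constantCoeff_leafMap hE hP.1
  have hc1 := constantCoeff_sumElim (u := X) (fun i : ι => by simp) hP.1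
  have hc2 := constantCoeff_sumElim (v := X) hP.1 (fun i : ι => by simp)
  have hX : ∀ j : ι, (X j : MvPowerSeries ι ℂ) ∈ polySubalgebra ι := X_mem_polySubalgebra
  have hleaf : ∀ t, leafMap E P t ∈ polySubalgebra ι := by
    rintro ((j | j) | (j | j))
    · exact hX j
    · exact subst_mem_polySubalgebra hc1 (by rintro (k | k); exacts [hX k, hPp k]) (hEp j)
    · exact hPp j
    · exact subst_mem_polySubalgebra hc2 (by rintro (k | k); exacts [hPp k, hX k])
        (map_conj_mem_polySubalgebra (hEp j))
  have hG : ∀ t, X t - rename (R := ℂ) (baseEmb ι) (leafMap E P t) ∈ polySubalgebra _ :=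
    fun t => sub_mem (X_mem_polySubalgebra t) (rename_mem_polySubalgebra _ (hleaf t))
  refine ⟨_, fun i => isConvergent_of_mem ?_,
    fun i => constantCoeff_realParts (fun t => by simp [hp]) _,
    fun i => conjSeries_realParts _ _, h1, h2⟩
  rcases c i with t | t
  · exact add_mem (hG t) (conjSeries_mem_polySubalgebra (hG t))
  · exact (polySubalgebra _).smul_mem (sub_mem (hG t) (conjSeries_mem_polySubalgebra (hG t))) _

/-- The ideal of the complex submanifold `z'' = F(z')`. -/
def complexGraph (F : ι → MvPowerSeries ι ℂ) : Ideal (RealSeries (ι ⊕ ι)) :=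
  Ideal.span (Set.range (fun j => ofHol (X (Sum.inr j) - rename (R := ℂ) Sum.inl (F j))) ∪
    Set.range (fun j => conjSeries (ofHol (X (Sum.inr j) - rename (R := ℂ) Sum.inl (F j)))))

theorem linearIndependent_complexGraph (F : ι → MvPowerSeries ι ℂ) :
    LinearIndependent ℂ fun j => fun x : ι ⊕ ι =>
      linCoeff x (X (Sum.inr j) - rename (R := ℂ) Sum.inl (F j)) := by
  classical
  rw [Fintype.linearIndependent_iff]
  intro c hc s
  have := congrFun hc (Sum.inr s)
  simpa [linCoeff_X, linCoeff_rename] using this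

theorem isComplexSubmanifold_complexGraph {F : ι → MvPowerSeries ι ℂ}
    (hF : ∀ j, constantCoeff (F j) = 0) (hFp : ∀ j, F j ∈ polySubalgebra ι) :
    IsComplexSubmanifold (Fintype.card ι) (complexGraph F) := by
  let w : Fin (Fintype.card ι) ≃ ι := (Fintype.equivFin ι).symm
  refine ⟨fun i => X (Sum.inr (w i)) - rename (R := ℂ) Sum.inl (F (w i)), fun i =>
    isConvergent_of_mem (sub_mem (X_mem_polySubalgebra _) (rename_mem_polySubalgebra _ (hFp _))),
    fun i => by simp [hF], (linearIndependent_complexGraph F).comp w w.injective, ?_⟩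
  rw [complexGraph, ← w.surjective.range_comp, ← w.surjective.range_comp]
  rfl

theorem isFormalComplexSubmanifold_complexGraph {F : ι → MvPowerSeries ι ℂ}
    (hF : ∀ j, constantCoeff (F j) = 0) :
    IsFormalComplexSubmanifold (Fintype.card ι) (complexGraph F) := by
  let w : Fin (Fintype.card ι) ≃ ι := (Fintype.equivFin ι).symm
  refine ⟨fun i => X (Sum.inr (w i)) - rename (R := ℂ) Sum.inl (F (w i)),
    fun i => by simp [hF], (linearIndependent_complexGraph F).comp w w.injective, ?_⟩
  rw [complexGraph, ← w.surjective.range_comp, ← w.surjective.range_comp]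
  rfl

theorem complexGraph_le_fixedIn (hE : ∀ j, constantCoeff (E j) = 0)
    (hP : IsAntiholomorphicInvolution P) {F : ι → MvPowerSeries ι ℂ}
    (h : ∀ j, subst (Sum.elim X P) (E j) = F j) :
    complexGraph F ≤ fixedIn (manifold E) P := by
  have hp := constantCoeff_leafMap hE hP.1
  have hs := hasSubst_of_constantCoeff_zero hp
  have hmem : ∀ j, ofHol (X (Sum.inr j) - rename (R := ℂ) Sum.inl (F j)) ∈
      fixedIn (manifold E) P := by
    intro j
    rw [fixedIn_eq_graphIdeal hE hP, mem_graphIdeal hp leafMap_baseEmb, ofHol, map_sub, rename_X,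
      rename_rename, subst_sub hs, subst_X hs, subst_rename hp]
    have h2 : leafMap E P ∘ (Sum.inl ∘ Sum.inl) = X := rfl
    rw [h2, subst_self, sub_eq_zero, id]
    exact h j
  rw [complexGraph, Ideal.span_le]
  rintro _ (⟨j, rfl⟩ | ⟨j, rfl⟩)
  · exact hmem j
  · exact conjSeries_mem_fixedIn (hmem j)

/-- The constructive half of the dictionary: the attached submanifold is `z'' = F(z')` for the
common restriction `F` of `E` to both leaves. -/
theorem isAttachedAlong_complexGraph (hE : ∀ j, E j ∈ ordIdeal (ι ⊕ ι) 2)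
    {P₁ P₂ F : ι → MvPowerSeries ι ℂ}
    (hP₁ : IsAntiholomorphicInvolution P₁) (hP₂ : IsAntiholomorphicInvolution P₂)
    (h₁ : ∀ j, subst (Sum.elim X P₁) (E j) = F j) (h₂ : ∀ j, subst (Sum.elim X P₂) (E j) = F j)
    (hT : ∀ u, (linearPart P₁).mulVec u = (linearPart P₂).mulVec u → u = 0) :
    IsAttachedAlong (manifold E) (complexGraph F) (fixedIn (manifold E) P₁)
      (fixedIn (manifold E) P₂) := by
  have hE0 : ∀ j, constantCoeff (E j) = 0 := fun j => constantCoeff_of_mem_two (hE j)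
  have hc := constantCoeff_sumElim (u := X) (fun i : ι => by simp) hP₁.1
  refine ⟨isFormalComplexSubmanifold_complexGraph fun j => ?_, isFormalSubmanifold_fixedIn hE0 hP₁,
    isFormalSubmanifold_fixedIn hE0 hP₂, isTotallyReal_fixedIn hE hP₁,
    isTotallyReal_fixedIn hE hP₂, sup_le (complexGraph_le_fixedIn hE0 hP₁ h₁) le_sup_left,
    sup_le (complexGraph_le_fixedIn hE0 hP₂ h₂) le_sup_left,
    (tangentSpace_inf_eq_bot_iff hE hP₁ hP₂).2 hT⟩
  rw [← h₁]
  exact constantCoeff_subst_eq_zero (hasSubst_of_constantCoeff_zero hc) hc (hE0 j)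

/-- A pair of asymptotic submanifolds is a pair of leaves. -/
theorem IsAttachedAlong.exists_involutions (hE : ∀ j, E j ∈ ordIdeal (ι ⊕ ι) 2)
    {K K₁ K₂ : Ideal (RealSeries (ι ⊕ ι))} (h : IsAttachedAlong (manifold E) K K₁ K₂) :
    ∃ P₁ P₂ : ι → MvPowerSeries ι ℂ,
      IsAntiholomorphicInvolution P₁ ∧ IsAntiholomorphicInvolution P₂ ∧
      K₁ = fixedIn (manifold E) P₁ ∧ K₂ = fixedIn (manifold E) P₂ ∧
      (∀ j, subst (Sum.elim X P₁) (E j) = subst (Sum.elim X P₂) (E j)) ∧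
      ∀ u, (linearPart P₁).mulVec u = (linearPart P₂).mulVec u → u = 0 := by
  obtain ⟨hK, hK₁, hK₂, hT₁, hT₂, hle₁, hle₂, hT⟩ := h
  obtain ⟨P₁, hP₁, rfl⟩ := exists_eq_fixedIn hE hK₁ hT₁ (le_sup_right.trans hle₁)
  obtain ⟨P₂, hP₂, rfl⟩ := exists_eq_fixedIn hE hK₂ hT₂ (le_sup_right.trans hle₂)
  exact ⟨P₁, P₂, hP₁, hP₂, rfl, rfl, subst_eq_subst_of_le hE hK hP₁ hP₂
    (le_sup_left.trans hle₁) (le_sup_left.trans hle₂),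
    (tangentSpace_inf_eq_bot_iff hE hP₁ hP₂).1 hT⟩

end Leaf

/-! ### Perturbations of quadrics `z''_j = q_j (w_{π j} + g_j z_j / 2)²` -/

section Quadric

variable {ι : Type} [Fintype ι]

/-- `E` is a third order perturbation of the quadric `q_j (w_{π j} + g_j z_j / 2)²`. -/
structure IsPerturbation (π : ι → ι) (g q : ι → ℂ) (E : ι → MvPowerSeries (ι ⊕ ι) ℂ) : Prop where
  involutive : Function.Involutive π
  q_ne : ∀ j, q j ≠ 0
  mem : ∀ j, E j - q j • (X (Sum.inr (π j)) + (g j / 2) • X (Sum.inl j)) ^ 2 ∈ ordIdeal (ι ⊕ ι) 3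

variable {π : ι → ι} {g q : ι → ℂ} {E : ι → MvPowerSeries (ι ⊕ ι) ℂ}

theorem IsPerturbation.mem_two (hE : IsPerturbation π g q E) (j : ι) :
    E j ∈ ordIdeal (ι ⊕ ι) 2 := by
  have h1 : (X (Sum.inr (π j)) + (g j / 2) • X (Sum.inl j) : MvPowerSeries (ι ⊕ ι) ℂ) ∈
      ordIdeal (ι ⊕ ι) 1 :=
    Ideal.add_mem _ (X_mem_ordIdeal _) (smul_mem_ordIdeal _ (X_mem_ordIdeal _))
  have h2 := smul_mem_ordIdeal (q j) (mul_mem_ordIdeal h1 h1 le_rfl)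
  rw [← pow_two] at h2
  simpa using Ideal.add_mem _ (ordIdeal_mono (by norm_num) (hE.mem j)) h2

section

variable {σ : Type} {u v v' : ι → MvPowerSeries σ ℂ}

/-- The difference of two values of `E` with the same `z'`. -/
theorem IsPerturbation.mul_mem (hE : IsPerturbation π g q E)
    (hu : ∀ i, constantCoeff (u i) = 0) (hv : ∀ i, constantCoeff (v i) = 0)
    (hv' : ∀ i, constantCoeff (v' i) = 0)
    (h : ∀ j, subst (Sum.elim u v) (E j) = subst (Sum.elim u v') (E j)) {k : ℕ}
    (hk : ∀ j, v j - v' j ∈ ordIdeal σ k) (j : ι) :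
    (v (π j) - v' (π j)) * (v (π j) + v' (π j) + g j • u j) ∈ ordIdeal σ (k + 2) := by
  have hc := constantCoeff_sumElim hu hv
  have hc' := constantCoeff_sumElim hu hv'
  have hs := hasSubst_of_constantCoeff_zero hc
  have hs' := hasSubst_of_constantCoeff_zero hc'
  have h1 := subst_sub_mem hc hc' (k := k) (by
    rintro (i | i)
    · simp
    · exact hk i) 2 (k + 2) le_rfl _ (hE.mem j)
  rw [subst_sub hs, subst_sub hs', h, subst_smul hs, subst_smul hs', subst_pow hs, subst_pow hs',
    subst_add hs, subst_add hs', subst_smul hs, subst_smul hs', subst_X hs, subst_X hs',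
    subst_X hs, subst_X hs'] at h1
  simp only [Sum.elim_inl, Sum.elim_inr] at h1
  -- The values of `E` have cancelled; what is left is `-q j` times a difference of two squares,
  -- whose factors are the two factors of the claim.
  have h2 := smul_mem_ordIdeal (-(q j)⁻¹) h1
  convert h2 using 1
  have hq : C (σ := σ) (q j)⁻¹ * C (q j) = 1 := by
    rw [← map_mul, inv_mul_cancel₀ (hE.q_ne j), map_one]
  have hg : C (σ := σ) (g j) = 2 * C (g j / 2) := by
    rw [show (2 : MvPowerSeries σ ℂ) = C 2 from (map_ofNat C 2).symm, ← map_mul]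
    congr 1; ring
  simp only [smul_eq_C_mul, map_neg, hg]
  linear_combination (-(v (π j) - v' (π j)) * (v (π j) + v' (π j) + 2 * C (g j / 2) * u j)) * hq

/-- Orders add, so a product of order at least three has a factor of order at least two: to first
order, each form is either kept or reflected. -/
theorem IsPerturbation.mem_or_mem (hE : IsPerturbation π g q E)
    (hu : ∀ i, constantCoeff (u i) = 0) (hv : ∀ i, constantCoeff (v i) = 0)
    (hv' : ∀ i, constantCoeff (v' i) = 0)
    (h : ∀ j, subst (Sum.elim u v) (E j) = subst (Sum.elim u v') (E j)) (j : ι) :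
    v (π j) - v' (π j) ∈ ordIdeal σ 2 ∨ v (π j) + v' (π j) + g j • u j ∈ ordIdeal σ 2 := by
  have h1 := hE.mul_mem hu hv hv' h (k := 1) (fun j => mem_ordIdeal_one.2 (by simp [hv, hv'])) j
  by_contra! hc
  exact hc.1 (mem_ordIdeal_of_mul_mem (k := 2) (l := 1) h1 hc.2)

/-- When the sum factor has order one, agreement to order `k` makes the product of order `k + 2` and
so improves the agreement to order `k + 1`. This one argument yields all the uniqueness statements
about deck transformations and second leaves. -/
theorem IsPerturbation.eq_of_notMem (hE : IsPerturbation π g q E)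
    (hu : ∀ i, constantCoeff (u i) = 0) (hv : ∀ i, constantCoeff (v i) = 0)
    (hv' : ∀ i, constantCoeff (v' i) = 0)
    (h : ∀ j, subst (Sum.elim u v) (E j) = subst (Sum.elim u v') (E j))
    (hn : ∀ j, v (π j) + v' (π j) + g j • u j ∉ ordIdeal σ 2) : v = v' := by
  refine eq_of_forall_ordIdeal_succ 1 (fun j => mem_ordIdeal_one.2 (by simp [hv, hv'])) ?_
  intro k _ hk i
  have h1 := hE.mul_mem hu hv hv' h hk (π i)
  have h2 := mem_ordIdeal_of_mul_mem (k := k + 1) (l := 1) h1 (hn _)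
  rwa [hE.involutive] at h2

end

/-! ### Linear algebra of the involutions -/

/-- The matrix `Γ` with `Γ_{π j, j} = g_j`. -/
def gammaMat [DecidableEq ι] (π : ι → ι) (g : ι → ℂ) : Matrix ι ι ℂ :=
  Matrix.of fun i k => if k = π i then g k else 0

/-- The matrix `A` with `A_{π j, j} = - (1 + ν_j) / conj g_{π j}`. -/
def leafMatrix [DecidableEq ι] (π : ι → ι) (g ν : ι → ℂ) : Matrix ι ι ℂ :=
  Matrix.of fun i k => if k = π i then -(1 + ν k) / conj (g i) else 0

/-- The eigenvalues of `σ` on a real leaf of the quadric. -/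
structure IsAdmissible (π : ι → ι) (g ν : ι → ℂ) : Prop where
  eq : ∀ j, (1 + ν j) ^ 2 = g j * conj (g (π j)) * ν j
  conj_mul : ∀ j, conj (ν (π j)) * ν j = 1

/-- The numbers `γ_j⁻¹ conj γ_{π j}⁻¹` are distinct, and different from `0` and `4`. -/
structure IsRegular (π : ι → ι) (g : ι → ℂ) : Prop where
  inj : Function.Injective fun j => g j * conj (g (π j))
  g_ne : ∀ j, g j ≠ 0
  ne_four : ∀ j, g j * conj (g (π j)) ≠ 4

theorem IsAdmissible.ne_zero {ν : ι → ℂ} (h : IsAdmissible π g ν) (j : ι) : ν j ≠ 0 :=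
  right_ne_zero_of_mul_eq_one (h.conj_mul j)

theorem IsAdmissible.conj_eq {ν : ι → ℂ} (h : IsAdmissible π g ν) (j : ι) :
    conj (ν (π j)) = (ν j)⁻¹ := eq_inv_of_mul_eq_one_left (h.conj_mul j)

theorem IsAdmissible.inv {ν : ι → ℂ} (h : IsAdmissible π g ν) : IsAdmissible π g ν⁻¹ := by
  refine ⟨fun j => ?_, fun j => ?_⟩
  · have h0 := h.ne_zero j
    have h1 := h.eq j
    simp only [Pi.inv_apply]
    field_simp
    linear_combination h1
  · rw [Pi.inv_apply, Pi.inv_apply, map_inv₀, ← mul_inv, h.conj_mul, inv_one]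

/-- The values `1` and `-1` are the double roots of $(1+x)^2=Gx$, for $G=4$ and $G=0$. -/
theorem IsAdmissible.sq_ne_one {ν : ι → ℂ} (h : IsAdmissible π g ν) (hg : IsRegular π g) (j : ι) :
    ν j ^ 2 ≠ 1 := by
  intro h1
  have h2 := h.eq j
  rcases sq_eq_one_iff.1 h1 with h3 | h3
  · rw [h3] at h2
    exact hg.ne_four j (by linear_combination -h2)
  · rw [h3] at h2
    have h4 : g j * conj (g (π j)) = 0 := by linear_combination h2
    rcases mul_eq_zero.1 h4 with h5 | h5
    · exact hg.g_ne _ h5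
    · exact hg.g_ne _ ((_root_.map_eq_zero _).1 h5)

variable [DecidableEq ι]

/-- The linear part of `τ₁` exchanges the leaves of $\nu$ and $\nu^{-1}$, because
$2+\nu+\nu^{-1}=(1+\nu)^2/\nu=G$. -/
theorem leafMatrix_inv_eq {ν : ι → ℂ} (hπ : Function.Involutive π) (hg : IsRegular π g)
    (h : IsAdmissible π g ν) : leafMatrix π g ν⁻¹ = -leafMatrix π g ν - gammaMat π g := by
  ext i k
  simp only [leafMatrix, gammaMat, Matrix.of_apply, Matrix.sub_apply, Matrix.neg_apply,
    Pi.inv_apply]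
  split_ifs with hk
  · subst hk
    have h0 := h.ne_zero (π i)
    have h1 := h.eq (π i)
    rw [hπ i] at h1
    have h2 : conj (g i) ≠ 0 := (map_ne_zero _).2 (hg.g_ne i)
    field_simp
    linear_combination -h1
  · simp

theorem leafMatrix_mul {ν ν' : ι → ℂ} (hπ : Function.Involutive π) :
    (leafMatrix π g ν').map conj * leafMatrix π g ν =
      Matrix.diagonal fun j => (1 + conj (ν' (π j))) * (1 + ν j) / (g j * conj (g (π j))) := by
  ext i k
  rw [Matrix.mul_apply, Finset.sum_eq_single (π i)]
  · simp only [leafMatrix, Matrix.map_apply, Matrix.of_apply, if_true, hπ i, Matrix.diagonal_apply]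
    by_cases hk : i = k
    · subst hk
      simp only [if_true, map_div₀, map_neg, map_add, map_one, Complex.conj_conj,
        div_mul_div_comm, neg_mul_neg]
    · rw [if_neg (Ne.symm hk), if_neg hk, mul_zero]
  · intro b _ hb
    simp [leafMatrix, hb]
  · simp

theorem leafMatrix_conj_mul_self {ν : ι → ℂ} (hπ : Function.Involutive π) (hg : IsRegular π g)
    (h : IsAdmissible π g ν) : (leafMatrix π g ν).map conj * leafMatrix π g ν = 1 := by
  rw [leafMatrix_mul hπ, ← Matrix.diagonal_one]
  congr 1
  funext j
  have h0 := h.ne_zero j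
  have h1 := h.eq j
  have h2 : conj (g (π j)) ≠ 0 := (map_ne_zero _).2 (hg.g_ne _)
  have h3 := hg.g_ne j
  rw [h.conj_eq]
  field_simp
  linear_combination h1

/-- The inverse of the linear part of an involution is its conjugate, and $(1+\nu)^2/G=\nu$; hence
the eigenvalues of $\bar\rho_2^{-1}\bar\rho_1$ are the $\nu_j$. -/
theorem leafMatrix_inv_mul {ν : ι → ℂ} (hπ : Function.Involutive π) (hg : IsRegular π g)
    (h : IsAdmissible π g ν) :
    (leafMatrix π g ν⁻¹)⁻¹ * leafMatrix π g ν = Matrix.diagonal ν := by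
  rw [Matrix.inv_eq_left_inv (leafMatrix_conj_mul_self hπ hg h.inv), leafMatrix_mul hπ]
  congr 1
  funext j
  have h0 := h.ne_zero j
  have h1 := h.eq j
  have h2 : conj (g (π j)) ≠ 0 := (map_ne_zero _).2 (hg.g_ne _)
  have h3 := hg.g_ne j
  rw [Pi.inv_apply, map_inv₀, h.conj_eq, inv_inv]
  field_simp
  linear_combination h1

theorem leafMatrix_injective (hπ : Function.Involutive π) (hg : IsRegular π g) {ν ν' : ι → ℂ}
    (h : leafMatrix π g ν = leafMatrix π g ν') : ν = ν' := by
  funext j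
  have h1 := congrFun (congrFun h (π j)) j
  have h2 : conj (g (π j)) ≠ 0 := (map_ne_zero _).2 (hg.g_ne _)
  simp only [leafMatrix, Matrix.of_apply, hπ j, if_true] at h1
  rw [div_left_inj' h2] at h1
  linear_combination -h1

theorem leafMatrix_mulVec (ν u : ι → ℂ) (i : ι) :
    (leafMatrix π g ν).mulVec u i = -(1 + ν (π i)) / conj (g i) * u (π i) := by
  rw [Matrix.mulVec, dotProduct, Finset.sum_eq_single (π i)]
  · simp [leafMatrix]
  · intro b _ hb
    simp [leafMatrix, hb]
  · simp

/-- Transversality of the leaves of $\nu$ and $\nu^{-1}$ comes down to $\nu_j^2\ne1$. -/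
theorem eq_zero_of_leafMatrix_mulVec_eq (hπ : Function.Involutive π) (hg : IsRegular π g)
    {ν : ι → ℂ} (h : IsAdmissible π g ν) (u : ι → ℂ)
    (hu : (leafMatrix π g ν).mulVec u = (leafMatrix π g ν⁻¹).mulVec u) : u = 0 := by
  funext j
  have h1 := congrFun hu (π j)
  rw [leafMatrix_mulVec, leafMatrix_mulVec, hπ j] at h1
  have h0 := h.ne_zero j
  have h2 : conj (g (π j)) ≠ 0 := (map_ne_zero _).2 (hg.g_ne _)
  have h3 := h.sq_ne_one hg j
  simp only [Pi.inv_apply] at h1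
  field_simp at h1
  have h4 : (ν j ^ 2 - 1) * u j = 0 := by linear_combination -h1
  exact (mul_eq_zero.1 h4).resolve_left (sub_ne_zero.2 h3)

/-- The linear parts of a pair of involutions interchanged by `τ₁`. -/
theorem exists_eq_leafMatrix (hπ : Function.Involutive π) (hg : IsRegular π g)
    {A B : Matrix ι ι ℂ} (hA : A.map conj * A = 1) (hB : B.map conj * B = 1)
    (hAB : B = -A - gammaMat π g) :
    ∃ ν, IsAdmissible π g ν ∧ A = leafMatrix π g ν ∧ B = leafMatrix π g ν⁻¹ := by
  set Γ := gammaMat π g with hΓ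
  have hA' : A * A.map conj = 1 := mul_eq_one_comm.1 hA
  have hB' : B * B.map conj = 1 := mul_eq_one_comm.1 hB
  have hBc : B.map conj = -A.map conj - Γ.map conj := by
    rw [hAB]; ext; simp
  rw [hBc, hAB] at hB hB'
  have e1 : A.map conj * Γ + Γ.map conj * A + Γ.map conj * Γ = 0 := by
    have : (-A.map conj - Γ.map conj) * (-A - Γ) =
      A.map conj * A + (A.map conj * Γ + Γ.map conj * A + Γ.map conj * Γ) := by noncomm_ring
    rw [this, hA] at hB
    simpa using hB
  have e2 : A * Γ.map conj + Γ * A.map conj + Γ * Γ.map conj = 0 := by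
    have : (-A - Γ) * (-A.map conj - Γ.map conj) =
      A * A.map conj + (A * Γ.map conj + Γ * A.map conj + Γ * Γ.map conj) := by noncomm_ring
    rw [this, hA'] at hB'
    simpa using hB'
  have hG : Γ.map conj * Γ = Matrix.diagonal fun j => g j * conj (g (π j)) := by
    ext i k
    rw [Matrix.mul_apply, Finset.sum_eq_single (π i)]
    · simp only [hΓ, gammaMat, Matrix.map_apply, Matrix.of_apply, if_true, hπ i,
        Matrix.diagonal_apply]
      by_cases hk : i = k
      · subst hk
        simp [mul_comm]
      · rw [if_neg (Ne.symm hk), if_neg hk, mul_zero]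
    · intro b _ hb
      simp [hΓ, gammaMat, hb]
    · simp
  set G : Matrix ι ι ℂ := Γ.map conj * Γ with hGdef
  set T : Matrix ι ι ℂ := Γ.map conj * A with hT
  -- Both orders of multiplication in `A.map conj * A = 1` and `B.map conj * B = 1` are used. They
  -- give the same quadratic equation for `T` with `G` on the right and on the left, so `T` commutes
  -- with `G`.
  have e3 : T * T + T * G + G = 0 := by
    have : T * T + T * G + G = Γ.map conj * A * (A.map conj * Γ + Γ.map conj * A + Γ.map conj * Γ)
        + Γ.map conj * (1 - A * A.map conj) * Γ := by
      rw [hT, hGdef]; noncomm_ring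
    rw [this, e1, hA']; simp
  have e4 : T * T + G * T + G = 0 := by
    have : T * T + G * T + G = Γ.map conj * (A * Γ.map conj + Γ * A.map conj + Γ * Γ.map conj) * A
        + Γ.map conj * Γ * (1 - A.map conj * A) := by
      rw [hT, hGdef]; noncomm_ring
    rw [this, e2, hA]; simp
  have e5 : T * G = G * T := by
    have : T * G - G * T = (T * T + T * G + G) - (T * T + G * T + G) := by abel
    rw [e3, e4, sub_self, sub_eq_zero] at this
    exact this
  -- A matrix commuting with a diagonal matrix with distinct entries is diagonal.
  have hTd : ∀ i k, i ≠ k → T i k = 0 := by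
    intro i k hik
    have := congrFun (congrFun e5 i) k
    rw [hG, Matrix.mul_diagonal, Matrix.diagonal_mul] at this
    have h1 : T i k * (g k * conj (g (π k)) - g i * conj (g (π i))) = 0 := by
      linear_combination this
    refine (mul_eq_zero.1 h1).resolve_right (sub_ne_zero.2 fun h => hik ?_)
    exact (hg.inj h).symm
  have hTA : ∀ i k, T i k = conj (g (π i)) * A (π i) k := by
    intro i k
    rw [hT, Matrix.mul_apply, Finset.sum_eq_single (π i)]
    · simp [hΓ, gammaMat]
    · intro b _ hb
      simp [hΓ, gammaMat, hb]
    · simp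
  have hcg : ∀ i, conj (g i) ≠ 0 := fun i => (map_ne_zero _).2 (hg.g_ne i)
  have hAd : ∀ i k, k ≠ π i → A i k = 0 := by
    intro i k hk
    have h1 := hTA (π i) k
    rw [hπ i, hTd _ _ hk.symm] at h1
    exact (mul_eq_zero.1 h1.symm).resolve_left (hcg i)
  have hquad : ∀ j, T j j ^ 2 + g j * conj (g (π j)) * T j j + g j * conj (g (π j)) = 0 := by
    intro j
    have := congrFun (congrFun e4 j) j
    rw [hG, Matrix.add_apply, Matrix.add_apply, Matrix.diagonal_mul, Matrix.mul_apply,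
      Finset.sum_eq_single j (fun b _ hb => by rw [hTd j b hb.symm, zero_mul]) (by simp),
      Matrix.diagonal_apply_eq, Matrix.zero_apply] at this
    linear_combination this
  have hTne : ∀ j, T j j ≠ 0 := by
    intro j hj
    have := hquad j
    rw [hj] at this
    exact mul_ne_zero (hg.g_ne j) (hcg (π j)) (by linear_combination this)
  have hTT : ∀ j, conj (T (π j) (π j)) * T j j = g j * conj (g (π j)) := by
    intro j
    have h1 := congrFun (congrFun hA j) j
    rw [Matrix.mul_apply, Finset.sum_eq_single (π j)
      (fun b _ hb => by rw [Matrix.map_apply, hAd j b hb, map_zero, zero_mul]) (by simp),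
      Matrix.map_apply, Matrix.one_apply_eq] at h1
    rw [hTA, hTA, hπ j, map_mul, Complex.conj_conj]
    linear_combination (g j * conj (g (π j))) * h1
  -- The choice is forced: the entry of `leafMatrix` at `(π j, j)` is `-(1 + ν j) / conj (g (π j))`,
  -- and that of `A` is `T j j / conj (g (π j))`.
  have hadm : IsAdmissible π g fun j => -(1 + T j j) := by
    refine ⟨fun j => ?_, fun j => ?_⟩
    · have := hquad j
      linear_combination this
    · have h1 := hTT j
      have h2 := hquad j
      have h3 : T j j * (conj (-(1 + T (π j) (π j))) * -(1 + T j j) - 1) = 0 := by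
        simp only [map_neg, map_add, map_one]
        linear_combination (1 + T j j) * h1 + h2
      exact sub_eq_zero.1 ((mul_eq_zero.1 h3).resolve_left (hTne j))
  have hAeq : A = leafMatrix π g fun j => -(1 + T j j) := by
    ext i k
    simp only [leafMatrix, Matrix.of_apply]
    split_ifs with hk
    · subst hk
      rw [hTA, hπ i]
      have := hcg i
      field_simp
      ring
    · exact hAd i k hk
  refine ⟨_, hadm, hAeq, ?_⟩
  rw [leafMatrix_inv_eq hπ hg hadm, ← hAeq, hAB]

/-- The leaves of a perturbation that lie in one complex submanifold are interchanged by `τ₁`, to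
first order. -/
theorem IsPerturbation.add_mem (hE : IsPerturbation π g q E) {P₁ P₂ : ι → MvPowerSeries ι ℂ}
    (hP₁ : ∀ i, constantCoeff (P₁ i) = 0) (hP₂ : ∀ i, constantCoeff (P₂ i) = 0)
    (h : ∀ j, subst (Sum.elim X P₁) (E j) = subst (Sum.elim X P₂) (E j))
    (hT : ∀ u, (linearPart P₁).mulVec u = (linearPart P₂).mulVec u → u = 0) (j : ι) :
    P₁ (π j) - P₂ (π j) ∉ ordIdeal ι 2 ∧ P₁ (π j) + P₂ (π j) + g j • X j ∈ ordIdeal ι 2 := by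
  -- Otherwise the difference of the linear parts has a zero row, against transversality.
  have h1 : ∀ j, P₁ j - P₂ j ∉ ordIdeal ι 2 := by
    intro j hj
    have hinj : Function.Injective (linearPart P₁ - linearPart P₂).mulVec := by
      refine (injective_iff_map_eq_zero (linearPart P₁ - linearPart P₂).mulVecLin).2 fun u hu => ?_
      refine hT u ?_
      rwa [Matrix.mulVecLin_apply, Matrix.sub_mulVec, sub_eq_zero] at hu
    rw [Matrix.mulVec_injective_iff_isUnit, Matrix.isUnit_iff_isUnit_det, isUnit_iff_ne_zero] at hinj
    refine hinj (Matrix.det_eq_zero_of_row_eq_zero j fun k => ?_)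
    exact (linCoeff_sub k (P₁ j) (P₂ j)).symm.trans (linCoeff_of_mem hj)
  exact ⟨h1 _, (hE.mem_or_mem (fun i => by simp) hP₁ hP₂ h j).resolve_left (h1 _)⟩

theorem IsPerturbation.linearPart_eq (hE : IsPerturbation π g q E) {P₁ P₂ : ι → MvPowerSeries ι ℂ}
    (h : ∀ j, P₁ (π j) + P₂ (π j) + g j • X j ∈ ordIdeal ι 2) :
    linearPart P₂ = -linearPart P₁ - gammaMat π g := by
  ext i k
  have h1 := h (π i)
  rw [hE.involutive i] at h1
  have h2 := linCoeff_of_mem (i := k) h1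
  simp only [linCoeff_add, linCoeff_smul, linCoeff_X, mul_ite, mul_one, mul_zero] at h2
  simp only [linearPart, gammaMat, Matrix.of_apply, Matrix.sub_apply, Matrix.neg_apply]
  have h3 : (if k = π i then g k else 0) = if k = π i then g (π i) else 0 := by
    split_ifs with hk
    · rw [hk]
    · rfl
  rw [h3]
  linear_combination h2

/-- The linear parts of a pair of asymptotic submanifolds. -/
theorem IsPerturbation.exists_admissible (hE : IsPerturbation π g q E) (hg : IsRegular π g)
    {P₁ P₂ : ι → MvPowerSeries ι ℂ} (hP₁ : IsAntiholomorphicInvolution P₁)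
    (hP₂ : IsAntiholomorphicInvolution P₂)
    (h : ∀ j, subst (Sum.elim X P₁) (E j) = subst (Sum.elim X P₂) (E j))
    (hT : ∀ u, (linearPart P₁).mulVec u = (linearPart P₂).mulVec u → u = 0) :
    ∃ ν, IsAdmissible π g ν ∧ linearPart P₁ = leafMatrix π g ν ∧
      linearPart P₂ = leafMatrix π g ν⁻¹ :=
  exists_eq_leafMatrix hE.involutive hg hP₁.linearPart_mul hP₂.linearPart_mul
    (hE.linearPart_eq fun j => (hE.add_mem hP₁.1 hP₂.1 h hT j).2)

end Quadric

/-! ### Composition of formal maps and conjugation of coefficients. -/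

section Compose

variable {ι σ τ : Type} [Fintype ι] [Fintype σ]

/-- The composition `f(u, v)`. -/
def comp₂ (f : ι → MvPowerSeries (ι ⊕ ι) ℂ) (u v : ι → MvPowerSeries σ ℂ) (j : ι) :
    MvPowerSeries σ ℂ := subst (Sum.elim u v) (f j)

/-- Conjugation of the coefficients of a family of series. -/
def cj {κ : Type} (P : κ → MvPowerSeries τ ℂ) (j : κ) : MvPowerSeries τ ℂ :=
  MvPowerSeries.map (starRingEnd ℂ) (P j)

theorem cj_cj {κ : Type} (P : κ → MvPowerSeries τ ℂ) : cj (cj P) = P :=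
  funext fun j => map_conj_map_conj (P j)

theorem cj_X : cj (X : ι → MvPowerSeries ι ℂ) = X := funext fun j => map_X _ j

theorem constantCoeff_cj {κ : Type} {P : κ → MvPowerSeries τ ℂ}
    (hP : ∀ j, constantCoeff (P j) = 0) (j : κ) : constantCoeff (cj P j) = 0 := by
  simp [cj, hP]

theorem constantCoeff_X' (j : τ) : constantCoeff (X j : MvPowerSeries τ ℂ) = 0 :=
  constantCoeff_X j

variable {f : ι → MvPowerSeries (ι ⊕ ι) ℂ} {u v : ι → MvPowerSeries σ ℂ}
  {w : σ → MvPowerSeries τ ℂ}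

theorem constantCoeff_subst' {a : MvPowerSeries σ ℂ} (ha : constantCoeff a = 0)
    (hw : ∀ j, constantCoeff (w j) = 0) : constantCoeff (subst w a) = 0 :=
  constantCoeff_subst_eq_zero (hasSubst_of_constantCoeff_zero hw) hw ha

theorem constantCoeff_comp₂ (hf : ∀ j, constantCoeff (f j) = 0)
    (hu : ∀ j, constantCoeff (u j) = 0) (hv : ∀ j, constantCoeff (v j) = 0) (j : ι) :
    constantCoeff (comp₂ f u v j) = 0 :=
  constantCoeff_subst' (hf j) (constantCoeff_sumElim hu hv)

theorem subst_subst {a : MvPowerSeries ι ℂ} (hu : ∀ j, constantCoeff (u j) = 0)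
    (hw : ∀ j, constantCoeff (w j) = 0) :
    subst w (subst u a) = subst (fun i => subst w (u i)) a :=
  subst_comp_subst_apply (hasSubst_of_constantCoeff_zero hu) (hasSubst_of_constantCoeff_zero hw) a

theorem subst_comp₂ (hu : ∀ j, constantCoeff (u j) = 0) (hv : ∀ j, constantCoeff (v j) = 0)
    (hw : ∀ j, constantCoeff (w j) = 0) (j : ι) :
    subst w (comp₂ f u v j) = comp₂ f (fun i => subst w (u i)) (fun i => subst w (v i)) j := by
  rw [comp₂, subst_subst (constantCoeff_sumElim hu hv) hw, comp₂]
  congr 1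
  funext t; rcases t with i | i <;> rfl

theorem cj_comp₂ (hu : ∀ j, constantCoeff (u j) = 0) (hv : ∀ j, constantCoeff (v j) = 0) :
    cj (comp₂ f u v) = comp₂ (cj f) (cj u) (cj v) := by
  funext j
  rw [cj, comp₂, map_subst (hasSubst_of_constantCoeff_zero (constantCoeff_sumElim hu hv)), comp₂]
  congr 1
  funext t; rcases t with i | i <;> rfl

theorem subst_X_self (a : MvPowerSeries ι ℂ) : subst (X : ι → MvPowerSeries ι ℂ) a = a := by
  rw [subst_self]; rfl

theorem subst_X_apply (hw : ∀ j, constantCoeff (w j) = 0) (j : σ) :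
    subst w (X j : MvPowerSeries σ ℂ) = w j :=
  subst_X (hasSubst_of_constantCoeff_zero hw) j

/-- `f(z, f(z, w)) = w`. -/
def IsFiberInvolution (f : ι → MvPowerSeries (ι ⊕ ι) ℂ) : Prop :=
  ∀ j, subst (Sum.elim (fun i => X (Sum.inl i)) f) (f j) = X (Sum.inr j)

theorem IsFiberInvolution.comp₂_comp₂ (h : IsFiberInvolution f)
    (hf : ∀ j, constantCoeff (f j) = 0)
    (hu : ∀ j, constantCoeff (u j) = 0) (hv : ∀ j, constantCoeff (v j) = 0) :
    comp₂ f u (comp₂ f u v) = v := by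
  have hc := constantCoeff_sumElim hu hv
  funext j
  have h1 := congrArg (subst (Sum.elim u v)) (h j)
  rw [subst_subst (constantCoeff_sumElim (by simp) hf) hc, subst_X_apply hc] at h1
  rw [← Sum.elim_inr u v j, ← h1, comp₂]
  congr 1
  funext t
  rcases t with i | i
  · exact (subst_X_apply hc (Sum.inl i)).symm
  · rfl

theorem IsFiberInvolution.cj (h : IsFiberInvolution f) (hf : ∀ j, constantCoeff (f j) = 0) :
    IsFiberInvolution (cj f) := by
  intro j
  have h1 := congrArg (MvPowerSeries.map (starRingEnd ℂ)) (h j)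
  rw [map_X, map_subst (hasSubst_of_constantCoeff_zero
    (constantCoeff_sumElim (by simp) hf))] at h1
  rw [← h1, CRSing.cj]
  congr 1
  funext t
  rcases t with i | i
  · exact (map_X _ _).symm
  · rfl

end Compose

/-! ### Real leaves and invariant graphs of `σ`. -/

section Dynamics

variable {ι : Type} [Fintype ι]
  {f : ι → MvPowerSeries (ι ⊕ ι) ℂ} {P P₂ : ι → MvPowerSeries ι ℂ}

/-- The equation that expresses that `w = P(z)` is invariant under `σ⁻¹`, where
`σ = τ₁ τ₂`, `τ₁(z, w) = (z, f(z, w))` and `τ₂(z, w) = (f̄(w, z), w)`. -/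
def IsInvariantGraph (f : ι → MvPowerSeries (ι ⊕ ι) ℂ) (P : ι → MvPowerSeries ι ℂ) : Prop :=
  ∀ j, subst (comp₂ (cj f) (comp₂ f X P) X) (P j) = comp₂ f X P j

theorem IsAntiholomorphicInvolution.subst_cj (hP : IsAntiholomorphicInvolution P) (j : ι) :
    subst (cj P) (P j) = X j := by
  have h1 := congrArg (MvPowerSeries.map (starRingEnd ℂ)) (hP.2 j)
  rw [map_subst (hasSubst_of_constantCoeff_zero hP.1), map_conj_map_conj, map_X] at h1
  exact h1

/-- A pair of real leaves interchanged by `τ₁` is invariant under `σ`. -/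
theorem IsAntiholomorphicInvolution.isInvariantGraph (hf : ∀ j, constantCoeff (f j) = 0)
    (hinv : IsFiberInvolution f) (hP : IsAntiholomorphicInvolution P)
    (hP₂ : IsAntiholomorphicInvolution (comp₂ f X P)) : IsInvariantGraph f P := by
  set Q := comp₂ f X P with hQ
  have h1 : comp₂ (cj f) Q (fun i => subst Q (cj P i)) = X := by
    funext j
    have h2 : subst Q (cj Q j) = X j := hP₂.2 j
    rw [hQ, cj_comp₂ constantCoeff_X' hP.1, cj_X, ← hQ,
      subst_comp₂ constantCoeff_X' (constantCoeff_cj hP.1) hP₂.1] at h2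
    rw [← h2]
    congr 1
    funext i
    exact (subst_X_apply hP₂.1 i).symm
  -- Applying the fibre involution to `h1` solves for the second argument. Composition with `P`,
  -- which inverts `cj P`, then turns this into the invariance equation.
  have h3 : comp₂ (cj f) Q X = fun i => subst Q (cj P i) := by
    rw [← h1]
    exact (hinv.cj hf).comp₂_comp₂ (constantCoeff_cj hf) hP₂.1
      fun i => constantCoeff_subst' (constantCoeff_cj hP.1 i) hP₂.1
  intro j
  rw [h3, ← subst_subst (constantCoeff_cj hP.1) hP₂.1, hP.subst_cj, subst_X_apply hP₂.1]

/-- If the invariant graph with a given linear part is unique, it is real. -/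
theorem IsInvariantGraph.isAntiholomorphicInvolution [DecidableEq ι]
    (hf : ∀ j, constantCoeff (f j) = 0)
    (hinv : IsFiberInvolution f) (hP : ∀ j, constantCoeff (P j) = 0)
    (hlin : (linearPart P).map conj * linearPart P = 1) (h : IsInvariantGraph f P)
    (huniq : ∀ R : ι → MvPowerSeries ι ℂ, (∀ j, constantCoeff (R j) = 0) →
      linearPart R = linearPart P → IsInvariantGraph f R → R = P) :
    IsAntiholomorphicInvolution P ∧ IsAntiholomorphicInvolution (comp₂ f X P) := by
  have hcf := constantCoeff_cj hf
  have hcP := constantCoeff_cj hP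
  have hX := fun j : ι => constantCoeff_X' j
  have hlin' : linearPart (cj P) = (linearPart P).map conj := linearPart_map_conj P
  -- The graph of `R` is the image of the graph of `P` under $\rho_0(z,w)=(\bar w,\bar z)$. Since
  -- $\rho_0$ conjugates $\sigma$ to its inverse, this graph is invariant too. Its linear part is
  -- that of `P`, by `hlin`.
  obtain ⟨R, hR, hR1, hR2⟩ := exists_inverse (cj P) hcP
    (by rw [hlin']; exact IsUnit.of_mul_eq_one _ hlin)
  have hRlin : linearPart R = linearPart P := by
    have h1 := linearPart_mul_of_subst_eq_X hR hR1
    rw [hlin'] at h1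
    have h2 := mul_eq_one_comm.1 hlin
    calc linearPart R = linearPart P * (linearPart P).map conj * linearPart R := by
          rw [h2, one_mul]
      _ = linearPart P := by rw [mul_assoc, h1, mul_one]
  set u := comp₂ (cj f) R X with hu
  have hu0 : ∀ j, constantCoeff (u j) = 0 := constantCoeff_comp₂ hcf hR hX
  have hV0 : ∀ j, constantCoeff (comp₂ f X R j) = 0 := constantCoeff_comp₂ hf hX hR
  have hfu0 : ∀ j, constantCoeff (comp₂ f u R j) = 0 := constantCoeff_comp₂ hf hu0 hR
  have hPR : ∀ i, subst (comp₂ f u R) (cj P i) = u i := by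
    intro i
    have h1 := congrArg (MvPowerSeries.map (starRingEnd ℂ)) (h i)
    have hA := constantCoeff_comp₂ hf hX hP
    have hB := constantCoeff_comp₂ hcf hA hX
    rw [map_subst (hasSubst_of_constantCoeff_zero hB)] at h1
    have e1 : (fun i => MvPowerSeries.map (starRingEnd ℂ) (comp₂ (cj f) (comp₂ f X P) X i)) =
        comp₂ f (comp₂ (cj f) X (cj P)) X := by
      change cj (comp₂ (cj f) (comp₂ f X P) X) = _
      rw [cj_comp₂ hA hX, cj_comp₂ hX hP, cj_cj, cj_X]
    have e2 : MvPowerSeries.map (starRingEnd ℂ) (comp₂ f X P i) = comp₂ (cj f) X (cj P) i := by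
      change cj (comp₂ f X P) i = _
      rw [cj_comp₂ hX hP, cj_X]
    rw [e1, e2] at h1
    have hC := constantCoeff_comp₂ hcf hX hcP
    have h2 := congrArg (subst R) h1
    have e3 : ∀ i, subst R (comp₂ (cj f) X (cj P) i) = u i := by
      intro i
      rw [subst_comp₂ hX hcP hR]
      simp only [hR1, subst_X_apply hR]
      rfl
    rw [subst_subst (constantCoeff_comp₂ hf hC hX) hR, e3] at h2
    rw [← h2]
    congr 1
    funext k
    rw [subst_comp₂ hC hX hR]
    simp only [e3, subst_X_apply hR]
  -- The map $\tau_1\tau_2$ sends $(z,R)$ first to $(u,R)$, then to $(u,f(u,R))$; the identity says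
  -- that the image lies on the graph of `R`.
  have hRu : ∀ j, subst u (R j) = comp₂ f u R j := by
    intro j
    have h1 := congrArg (subst (comp₂ f u R)) (hR2 j)
    rw [subst_subst hcP hfu0, subst_X_apply hfu0] at h1
    rw [← h1]
    congr 1
    funext i
    exact (hPR i).symm
  have hVu : ∀ j, subst u (comp₂ f X R j) = R j := by
    intro j
    rw [subst_comp₂ hX hR hu0]
    simp only [hRu, subst_X_apply hu0]
    exact congrFun (hinv.comp₂_comp₂ hf hu0 hR) j
  -- The `z`-component of $\sigma^{-1}$ on the graph of `R`. It inverts `u`, so invariance under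
  -- $\sigma$ passes to invariance under $\sigma^{-1}$, as `IsInvariantGraph` requires.
  set u' := comp₂ (cj f) (comp₂ f X R) X with hu'
  have hu'0 : ∀ j, constantCoeff (u' j) = 0 := constantCoeff_comp₂ hcf hV0 hX
  have hu'u : ∀ j, subst u (u' j) = X j := by
    intro j
    rw [hu', subst_comp₂ hV0 hX hu0]
    simp only [hVu, subst_X_apply hu0]
    exact congrFun ((hinv.cj hf).comp₂_comp₂ hcf hR hX) j
  obtain ⟨w, hw, hw1, hw2⟩ := exists_inverse u hu0
    (IsUnit.of_mul_eq_one _ (mul_eq_one_comm.1 (linearPart_mul_of_subst_eq_X hu0 hu'u)))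
  have hRinv : IsInvariantGraph f R := by
    intro j
    have h1 : subst u (subst u' (R j)) = subst u (comp₂ f X R j) := by
      rw [subst_subst hu'0 hu0, hVu]
      simp only [hu'u]
      exact subst_X_self _
    have h2 := congrArg (subst w) h1
    rw [subst_subst hu0 hw, subst_subst hu0 hw] at h2
    simp only [hw1] at h2
    rw [show (fun i => X i : ι → MvPowerSeries ι ℂ) = X from rfl, subst_X_self,
      subst_X_self] at h2
    exact h2
  have hRP := huniq R hR hRlin hRinv
  rw [hRP] at hR1
  have hPinv : IsAntiholomorphicInvolution P := ⟨hP, hR1⟩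
  refine ⟨hPinv, constantCoeff_comp₂ hf hX hP, fun j => ?_⟩
  set Q := comp₂ f X P with hQ
  have hQ0 : ∀ j, constantCoeff (Q j) = 0 := constantCoeff_comp₂ hf hX hP
  have hB := constantCoeff_comp₂ hcf hQ0 hX
  change subst Q (cj Q j) = X j
  -- Invariance writes `Q` as `P` composed with `comp₂ (cj f) Q X`, and `cj P` inverts `P`. The
  -- fibre involution then shows that the second leaf is real as well.
  have h1 : ∀ i, subst Q (cj P i) = comp₂ (cj f) Q X i := by
    intro i
    have h2 : Q = fun j => subst (comp₂ (cj f) Q X) (P j) := funext fun j => (h j).symm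
    conv_lhs => rw [h2]
    rw [← subst_subst hP hB]
    rw [show subst P (cj P i) = X i from hR1 i, subst_X_apply hB]
  rw [hQ, cj_comp₂ hX hP, cj_X, ← hQ, subst_comp₂ hX hcP hQ0]
  simp only [h1, subst_X_apply hQ0]
  exact congrFun ((hinv.cj hf).comp₂_comp₂ hcf hQ0 hX) j

end Dynamics

/-! ### Order by order solution of the invariance equation. -/

section Solve

variable {ι σ : Type} [Fintype ι] [Fintype σ] {π : ι → ι}

/-- The linear part of `f` is `(z, w) ↦ -w - Γ z`. -/
def HasReflectionPart (π : ι → ι) (c : ι → ℂ) (f : ι → MvPowerSeries (ι ⊕ ι) ℂ) : Prop :=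
  ∀ i, f i + X (Sum.inr i) + c i • X (Sum.inl (π i)) ∈ ordIdeal (ι ⊕ ι) 2

variable {c : ι → ℂ} {f : ι → MvPowerSeries (ι ⊕ ι) ℂ}

theorem HasReflectionPart.cj (h : HasReflectionPart π c f) :
    HasReflectionPart π (fun i => conj (c i)) (cj f) := by
  intro i
  have h1 := map_mem_ordIdeal (starRingEnd ℂ) (h i)
  simpa only [map_add, map_X, smul_eq_C_mul, map_mul, map_C, CRSing.cj] using h1

theorem HasReflectionPart.comp₂_mem (h : HasReflectionPart π c f) {u v : ι → MvPowerSeries σ ℂ}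
    (hu : ∀ i, constantCoeff (u i) = 0) (hv : ∀ i, constantCoeff (v i) = 0) (i : ι) :
    comp₂ f u v i + v i + c i • u (π i) ∈ ordIdeal σ 2 := by
  have hc := constantCoeff_sumElim hu hv
  have hs := hasSubst_of_constantCoeff_zero hc
  have h1 := subst_mem_ordIdeal hc (h i)
  rwa [subst_add hs, subst_add hs, subst_smul hs, subst_X hs, subst_X hs] at h1

theorem HasReflectionPart.comp₂_sub_mem (h : HasReflectionPart π c f)
    {u v u' v' : ι → MvPowerSeries σ ℂ}
    (hu : ∀ i, constantCoeff (u i) = 0) (hv : ∀ i, constantCoeff (v i) = 0)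
    (hu' : ∀ i, constantCoeff (u' i) = 0) (hv' : ∀ i, constantCoeff (v' i) = 0) {k : ℕ}
    (hku : ∀ i, u i - u' i ∈ ordIdeal σ k) (hkv : ∀ i, v i - v' i ∈ ordIdeal σ k) (i : ι) :
    comp₂ f u v i - comp₂ f u' v' i + (v i - v' i) + c i • (u (π i) - u' (π i)) ∈
      ordIdeal σ (k + 1) := by
  have hc := constantCoeff_sumElim hu hv
  have hs := hasSubst_of_constantCoeff_zero hc
  have hc' := constantCoeff_sumElim hu' hv'
  have hs' := hasSubst_of_constantCoeff_zero hc'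
  have h1 := subst_sub_mem hc hc' (k := k) (by
    rintro (i | i)
    · exact hku i
    · exact hkv i) 1 (k + 1) le_rfl _ (h i)
  rw [subst_add hs, subst_add hs, subst_smul hs, subst_X hs, subst_X hs,
    subst_add hs', subst_add hs', subst_smul hs', subst_X hs', subst_X hs'] at h1
  convert h1 using 1
  simp only [comp₂, Sum.elim_inl, Sum.elim_inr]
  module

theorem coeff_rescale_inv_sub (ν : ι → ℂ) (t : ℂ) (D : MvPowerSeries ι ℂ) (n : ι →₀ ℕ) :
    coeff n (rescale ν⁻¹ D - t • D) = ((n.prod fun s m => ν⁻¹ s ^ m) - t) * coeff n D := by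
  rw [map_sub, coeff_rescale, coeff_smul, sub_mul]

/-- Replacement of a linear substitution by a substitution with the same linear part. -/
theorem subst_sub_rescale_mem {a : ι → ℂ} {φ : ι → MvPowerSeries ι ℂ}
    (hφ : ∀ i, φ i - a i • X i ∈ ordIdeal ι 2) {k : ℕ} (hk : 1 ≤ k) {D : MvPowerSeries ι ℂ}
    (hD : D ∈ ordIdeal ι k) : subst φ D - rescale a D ∈ ordIdeal ι (k + 1) := by
  have h0 : ∀ i, constantCoeff ((a • X : ι → MvPowerSeries ι ℂ) i) = 0 := fun i => by
    simp [Pi.smul_apply']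
  have hφ0 : ∀ i, constantCoeff (φ i) = 0 := fun i => by
    have := (mem_ordIdeal_two.1 (hφ i)).1
    simpa using this
  rw [rescale_eq_subst]
  obtain ⟨m, rfl⟩ := Nat.exists_eq_add_of_le' hk
  exact subst_sub_mem hφ0 h0 hφ m _ (by omega) _ hD

variable [DecidableEq ι] {g ν : ι → ℂ}

/-- The defect of the equation `IsInvariantGraph`. -/
def invariantDefect (f : ι → MvPowerSeries (ι ⊕ ι) ℂ) (P : ι → MvPowerSeries ι ℂ) (i : ι) :
    MvPowerSeries ι ℂ :=
  subst (comp₂ (cj f) (comp₂ f X P) X) (P i) - comp₂ f X P i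

/-- The linear leaf with linear part `leafMatrix π g ν`. -/
def linearLeaf (π : ι → ι) (g ν : ι → ℂ) (i : ι) : MvPowerSeries ι ℂ :=
  (-(1 + ν (π i)) / conj (g i)) • X (π i)

theorem constantCoeff_linearLeaf (i : ι) : constantCoeff (linearLeaf π g ν i) = 0 := by
  simp [linearLeaf]

theorem linearPart_linearLeaf : linearPart (linearLeaf π g ν) = leafMatrix π g ν := by
  ext i k
  simp only [linearPart, linearLeaf, leafMatrix, Matrix.of_apply, linCoeff_smul, linCoeff_X,
    mul_ite, mul_one, mul_zero]
  split_ifs with h <;> simp_all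

theorem sub_linearLeaf_mem_iff {P : ι → MvPowerSeries ι ℂ} :
    (∀ i, P i - linearLeaf π g ν i ∈ ordIdeal ι 2) ↔
      (∀ i, constantCoeff (P i) = 0) ∧ linearPart P = leafMatrix π g ν := by
  simp only [mem_ordIdeal_two, map_sub, constantCoeff_linearLeaf, sub_zero, forall_and,
    linCoeff_sub, sub_eq_zero]
  refine and_congr_right fun _ => ?_
  rw [← linearPart_linearLeaf, ← Matrix.ext_iff]
  rfl

section

variable {P P' : ι → MvPowerSeries ι ℂ}

theorem comp₂_leaf_mem (hπ : Function.Involutive π) (hg : IsRegular π g)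
    (hν : IsAdmissible π g ν) (hl : HasReflectionPart π (fun i => g (π i)) f)
    (hP : ∀ i, P i - linearLeaf π g ν i ∈ ordIdeal ι 2) (i : ι) :
    comp₂ f X P i - linearLeaf π g ν⁻¹ i ∈ ordIdeal ι 2 := by
  have hP0 := (sub_linearLeaf_mem_iff.1 hP).1
  have h1 := Ideal.sub_mem _ (hl.comp₂_mem constantCoeff_X' hP0 i) (hP i)
  convert h1 using 1
  have h2 := congrFun (congrFun (leafMatrix_inv_eq hπ hg hν) i) (π i)
  simp only [leafMatrix, gammaMat, Matrix.of_apply, Matrix.sub_apply, Matrix.neg_apply,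
    if_true] at h2
  simp only [linearLeaf]
  rw [h2]
  module

theorem linearLeaf_smul (hπ : Function.Involutive π) (hg : IsRegular π g) (i : ι) :
    conj (g (π i)) • linearLeaf π g ν (π i) = (-(1 + ν i)) • X i := by
  have h2 : conj (g (π i)) ≠ 0 := (_root_.map_ne_zero _).2 (hg.g_ne _)
  rw [linearLeaf, hπ i, smul_smul, mul_div_cancel₀ _ h2]

/-- To first order $\sigma^{-1}$ acts on the graph, in the coordinate $z$, as
$-1+(1+\nu_i^{-1})=\nu_i^{-1}$. -/
theorem comp₂_cj_leaf_mem (hπ : Function.Involutive π) (hg : IsRegular π g)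
    (hν : IsAdmissible π g ν) (hf : ∀ i, constantCoeff (f i) = 0)
    (hl : HasReflectionPart π (fun i => g (π i)) f)
    (hP : ∀ i, P i - linearLeaf π g ν i ∈ ordIdeal ι 2) (i : ι) :
    comp₂ (cj f) (comp₂ f X P) X i - ν⁻¹ i • X i ∈ ordIdeal ι 2 := by
  have hP0 := (sub_linearLeaf_mem_iff.1 hP).1
  have h1 := hl.cj.comp₂_mem (constantCoeff_comp₂ hf constantCoeff_X' hP0) constantCoeff_X' i
  have h2 := smul_mem_ordIdeal (conj (g (π i))) (comp₂_leaf_mem hπ hg hν hl hP (π i))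
  rw [smul_sub, linearLeaf_smul hπ hg] at h2
  convert Ideal.sub_mem _ h1 h2 using 1
  module

/-- The linearised equation. With `D` the change of `P i`, the change of the outer series
contributes `rescale ν⁻¹ D`, that of the inner map contributes `-(1 + ν (π i)) • D` through the
linear part of the leaf, and that of `comp₂ f X P` contributes `D`. -/
theorem invariantDefect_sub_mem (hπ : Function.Involutive π) (hg : IsRegular π g)
    (hν : IsAdmissible π g ν) (hf : ∀ i, constantCoeff (f i) = 0)
    (hl : HasReflectionPart π (fun i => g (π i)) f)
    (hP : ∀ i, P i - linearLeaf π g ν i ∈ ordIdeal ι 2)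
    (hP' : ∀ i, P' i - linearLeaf π g ν i ∈ ordIdeal ι 2) {k : ℕ} (hk : 1 ≤ k)
    (hD : ∀ i, P i - P' i ∈ ordIdeal ι k) (i : ι) :
    invariantDefect f P i - invariantDefect f P' i -
      (rescale ν⁻¹ (P i - P' i) - ν (π i) • (P i - P' i)) ∈ ordIdeal ι (k + 1) := by
  have hP0 := (sub_linearLeaf_mem_iff.1 hP).1
  have hP0' := (sub_linearLeaf_mem_iff.1 hP').1
  have hX := fun j : ι => constantCoeff_X' j
  have hV := constantCoeff_comp₂ hf hX hP0
  have hV' := constantCoeff_comp₂ hf hX hP0'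
  have hcf := constantCoeff_cj hf
  have hφ := constantCoeff_comp₂ hcf hV hX
  have hφ' := constantCoeff_comp₂ hcf hV' hX
  have hs := hasSubst_of_constantCoeff_zero hφ
  have hs' := hasSubst_of_constantCoeff_zero hφ'
  have hXX : ∀ i, (X i : MvPowerSeries ι ℂ) - X i ∈ ordIdeal ι k := fun i => by simp
  have eV : ∀ i, comp₂ f X P i - comp₂ f X P' i + (P i - P' i) ∈ ordIdeal ι (k + 1) := by
    intro i
    simpa using hl.comp₂_sub_mem hX hP0 hX hP0' hXX hD i
  have hVk : ∀ i, comp₂ f X P i - comp₂ f X P' i ∈ ordIdeal ι k := by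
    intro i
    simpa using Ideal.sub_mem _ (ordIdeal_mono (Nat.le_succ k) (eV i)) (hD i)
  have eφ : ∀ i, comp₂ (cj f) (comp₂ f X P) X i - comp₂ (cj f) (comp₂ f X P') X i -
      conj (g (π i)) • (P (π i) - P' (π i)) ∈ ordIdeal ι (k + 1) := by
    intro i
    have h1 := hl.cj.comp₂_sub_mem hV hX hV' hX hVk hXX i
    have h2 := smul_mem_ordIdeal (conj (g (π i))) (eV (π i))
    convert Ideal.sub_mem _ h1 h2 using 1
    module
  have hφk : ∀ i, comp₂ (cj f) (comp₂ f X P) X i - comp₂ (cj f) (comp₂ f X P') X i ∈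
      ordIdeal ι k := by
    intro i
    simpa using Ideal.add_mem _ (ordIdeal_mono (Nat.le_succ k) (eφ i))
      (smul_mem_ordIdeal (conj (g (π i))) (hD (π i)))
  have h1 := subst_sub_mem hφ hφ' hφk 1 (k + 1) le_rfl _ (hP i)
  rw [linearLeaf, subst_sub hs, subst_sub hs', subst_smul hs, subst_smul hs', subst_X hs,
    subst_X hs'] at h1
  have h2 := subst_sub_rescale_mem (comp₂_cj_leaf_mem hπ hg hν hf hl hP') hk (hD i)
  rw [subst_sub hs'] at h2
  have h3 := smul_mem_ordIdeal (-(1 + ν (π i)) / conj (g i)) (eφ (π i))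
  rw [hπ i, smul_sub, smul_smul,
    div_mul_cancel₀ _ ((_root_.map_ne_zero (starRingEnd ℂ)).2 (hg.g_ne i))] at h3
  convert Ideal.sub_mem _ (Ideal.add_mem _ (Ideal.add_mem _ h1 h2) h3) (eV i) using 1
  simp only [invariantDefect]
  module

theorem invariantDefect_mem (hπ : Function.Involutive π) (hg : IsRegular π g)
    (hν : IsAdmissible π g ν) (hf : ∀ i, constantCoeff (f i) = 0)
    (hl : HasReflectionPart π (fun i => g (π i)) f)
    (hP : ∀ i, P i - linearLeaf π g ν i ∈ ordIdeal ι 2) (i : ι) :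
    invariantDefect f P i ∈ ordIdeal ι 2 := by
  have hP0 := (sub_linearLeaf_mem_iff.1 hP).1
  have hφ := constantCoeff_comp₂ (constantCoeff_cj hf)
    (constantCoeff_comp₂ hf constantCoeff_X' hP0) constantCoeff_X'
  have hs := hasSubst_of_constantCoeff_zero hφ
  have h1 := subst_mem_ordIdeal hφ (hP i)
  rw [linearLeaf, subst_sub hs, subst_smul hs, subst_X hs] at h1
  have h2 := smul_mem_ordIdeal (-(1 + ν (π i)) / conj (g i))
    (comp₂_cj_leaf_mem hπ hg hν hf hl hP (π i))
  have h3 := comp₂_leaf_mem hπ hg hν hl hP i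
  convert Ideal.sub_mem _ (Ideal.add_mem _ h1 h2) h3 using 1
  have h4 := hν.ne_zero (π i)
  have h5 : -(1 + ν⁻¹ (π i)) / conj (g i) = -(1 + ν (π i)) / conj (g i) * ν⁻¹ (π i) := by
    rw [Pi.inv_apply]
    field_simp
    ring
  simp only [invariantDefect, linearLeaf]
  rw [h5]
  module

end

/-- A vanishing divisor $\nu^{-n}-\nu_j$ is a resonance $\nu^n=\nu_j^{-1}$. -/
theorem IsNonResonant.sub_ne_zero (h : IsNonResonant ν) {n : ι →₀ ℕ} (hn : n ≠ 0) (j : ι) :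
    (n.prod fun s m => ν⁻¹ s ^ m) - ν j ≠ 0 := by
  intro h1
  refine h n (fun h2 => hn (DFunLike.coe_injective h2)) j ?_
  rw [Finsupp.prod_fintype _ _ fun _ => pow_zero _] at h1
  rw [← sub_eq_zero.1 h1, ← Finset.prod_inv_distrib]
  exact Finset.prod_congr rfl fun i _ => by rw [Pi.inv_apply, inv_pow, inv_inv]

/-- Division of the coefficients by the divisors of the linearised equation. -/
def smallDivision (ν : ι → ℂ) (t : ℂ) (D : MvPowerSeries ι ℂ) : MvPowerSeries ι ℂ :=
  -- The divisor at `n = 0` is outside the scope of nonresonance; the inversion lemmas below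
  -- therefore assume that the constant term is zero.
  fun n => ((n.prod fun s m => ν⁻¹ s ^ m) - t)⁻¹ * coeff n D

theorem coeff_smallDivision (t : ℂ) (D : MvPowerSeries ι ℂ) (n : ι →₀ ℕ) :
    coeff n (smallDivision ν t D) = ((n.prod fun s m => ν⁻¹ s ^ m) - t)⁻¹ * coeff n D := rfl

theorem smallDivision_mem (t : ℂ) {D : MvPowerSeries ι ℂ} {k : ℕ} (hD : D ∈ ordIdeal ι k) :
    smallDivision ν t D ∈ ordIdeal ι k := fun d hd => by
  rw [coeff_smallDivision, hD d hd, mul_zero]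

theorem smallDivision_sub (t : ℂ) (D D' : MvPowerSeries ι ℂ) :
    smallDivision ν t (D - D') = smallDivision ν t D - smallDivision ν t D' := by
  ext n
  simp only [coeff_smallDivision, map_sub, mul_sub]

theorem smallDivision_rescale (h : IsNonResonant ν) (j : ι) {D : MvPowerSeries ι ℂ}
    (hD : constantCoeff D = 0) :
    smallDivision ν (ν j) (rescale ν⁻¹ D - ν j • D) = D := by
  ext n
  rw [coeff_smallDivision, coeff_rescale_inv_sub]
  by_cases hn : n = 0
  · subst hn
    rw [coeff_zero_eq_constantCoeff_apply, hD, mul_zero, mul_zero]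
  · rw [inv_mul_cancel_left₀ (h.sub_ne_zero hn j)]

theorem eq_zero_of_smallDivision_eq_zero (h : IsNonResonant ν) (j : ι) {D : MvPowerSeries ι ℂ}
    (hD : constantCoeff D = 0) (h0 : smallDivision ν (ν j) D = 0) : D = 0 := by
  ext n
  by_cases hn : n = 0
  · subst hn
    rw [coeff_zero_eq_constantCoeff_apply, hD, map_zero]
  · have h1 := congrArg (coeff n) h0
    rw [coeff_smallDivision, map_zero] at h1
    rw [map_zero]
    exact (mul_eq_zero.1 h1).resolve_left (inv_ne_zero (h.sub_ne_zero hn j))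

/-- There is one and only one invariant graph with a given nonresonant linear part. -/
theorem exists_isInvariantGraph (hπ : Function.Involutive π) (hg : IsRegular π g)
    (hν : IsAdmissible π g ν) (hn : IsNonResonant ν) (hf : ∀ i, constantCoeff (f i) = 0)
    (hl : HasReflectionPart π (fun i => g (π i)) f) :
    ∃ P : ι → MvPowerSeries ι ℂ, (∀ i, constantCoeff (P i) = 0) ∧
      linearPart P = leafMatrix π g ν ∧ IsInvariantGraph f P ∧
      ∀ R : ι → MvPowerSeries ι ℂ, (∀ i, constantCoeff (R i) = 0) →
        linearPart R = leafMatrix π g ν → IsInvariantGraph f R → R = P := by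
  let L := fun (i : ι) (D : MvPowerSeries ι ℂ) => smallDivision ν (ν (π i)) D
  -- Subtracting the divided defect cancels the linearised difference exactly, so the iteration
  -- gains one order. The same estimate yields existence, through the fixed point, and uniqueness.
  have key : ∀ k, 2 ≤ k → ∀ P P' : ι → MvPowerSeries ι ℂ,
      (∀ i, P i - linearLeaf π g ν i ∈ ordIdeal ι 2) →
      (∀ i, P' i - linearLeaf π g ν i ∈ ordIdeal ι 2) → (∀ i, P i - P' i ∈ ordIdeal ι k) →
      ∀ i, (P i - L i (invariantDefect f P i)) - (P' i - L i (invariantDefect f P' i)) ∈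
        ordIdeal ι (k + 1) := by
    intro k hk P P' hP hP' hD i
    have h1 := smallDivision_mem (ν := ν) (ν (π i))
      (invariantDefect_sub_mem hπ hg hν hf hl hP hP' (by omega) hD i)
    have h0 : constantCoeff (P i - P' i) = 0 := by
      rw [map_sub, (sub_linearLeaf_mem_iff.1 hP).1, (sub_linearLeaf_mem_iff.1 hP').1, sub_zero]
    rw [smallDivision_sub, smallDivision_sub, smallDivision_rescale hn _ h0] at h1
    convert Ideal.neg_mem_iff _ |>.2 h1 using 1
    simp only [L]
    ring
  obtain ⟨P, hP, hfix⟩ := exists_fixedPoint (fun P i => P i - L i (invariantDefect f P i))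
    (linearLeaf π g ν) 2 (by
      intro P hP i
      have h1 := smallDivision_mem (ν := ν) (ν (π i)) (invariantDefect_mem hπ hg hν hf hl hP i)
      convert Ideal.sub_mem _ (hP i) h1 using 1
      simp only [L]
      ring) key
  have hP2 := sub_linearLeaf_mem_iff.1 hP
  refine ⟨P, hP2.1, hP2.2, fun i => ?_, fun R hR0 hR1 hR2 => ?_⟩
  · have h1 := congrFun hfix i
    simp only [sub_eq_self] at h1
    have h2 := eq_zero_of_smallDivision_eq_zero hn _
      (mem_ordIdeal_two.1 (invariantDefect_mem hπ hg hν hf hl hP i)).1 h1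
    exact sub_eq_zero.1 h2
  · have hR : ∀ i, R i - linearLeaf π g ν i ∈ ordIdeal ι 2 :=
      sub_linearLeaf_mem_iff.2 ⟨hR0, hR1⟩
    have hL0 : ∀ i, L i 0 = 0 := fun i => by
      ext n
      simp only [L, coeff_smallDivision, map_zero, mul_zero]
    have hRfix : ∀ i, L i (invariantDefect f R i) = 0 := fun i => by
      rw [show invariantDefect f R i = 0 from sub_eq_zero.2 (hR2 i), hL0]
    refine eq_of_forall_ordIdeal_succ 2 (fun i => ?_) fun k hk hD i => ?_
    · convert Ideal.sub_mem _ (hR i) (hP i) using 1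
      ring
    · have h1 := key k hk R P hR hP hD i
      have h2 : P i - L i (invariantDefect f P i) = P i := congrFun hfix i
      rwa [hRfix, h2, sub_zero] at h1

end Solve

/-! ### Counting unordered pairs. -/

section Counting

/-- An involution without fixed points groups the elements of a finite set in pairs. -/
theorem two_mul_encard_image_pair {α β : Type*} {A : Set α} (hA : A.Finite) {n : α → α}
    (hn : ∀ a ∈ A, n a ∈ A) (hne : ∀ a ∈ A, n a ≠ a) (hnn : ∀ a ∈ A, n (n a) = a)
    {K : α → β} (hK : Set.InjOn K A) :
    2 * ((fun a => s(K a, K (n a))) '' A).encard = A.encard := by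
  classical
  lift A to Finset α using hA
  rw [← Finset.coe_image, Set.encard_coe_eq_coe_finsetCard, Set.encard_coe_eq_coe_finsetCard]
  simp only [Finset.mem_coe] at hn hne hnn
  rw [Finset.card_eq_sum_card_image (fun a => s(K a, K (n a))) A,
    Finset.sum_congr rfl (g := fun _ => 2), Finset.sum_const, smul_eq_mul, mul_comm]
  · push_cast; rfl
  · intro b hb
    obtain ⟨a, ha, rfl⟩ := Finset.mem_image.1 hb
    rw [← Finset.card_pair (hne a ha)]
    congr 1
    ext c
    simp only [Finset.mem_filter, Finset.mem_insert, Finset.mem_singleton, Sym2.eq_iff]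
    constructor
    · rintro ⟨hc, ⟨h1, -⟩ | ⟨h1, -⟩⟩
      · exact Or.inr (hK hc ha h1)
      · exact Or.inl (hK hc (hn a ha) h1)
    · rintro (rfl | rfl)
      · exact ⟨hn a ha, Or.inr ⟨rfl, by rw [hnn a ha]⟩⟩
      · exact ⟨ha, Or.inl ⟨rfl, rfl⟩⟩

end Counting

/-! ### The deck transformation that reflects all forms. -/

section Deck

variable {ι : Type} [Fintype ι] {π : ι → ι} {g q : ι → ℂ} {E : ι → MvPowerSeries (ι ⊕ ι) ℂ}

theorem subst_sumElim_X (a : MvPowerSeries (ι ⊕ ι) ℂ) :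
    subst (Sum.elim (fun i => X (Sum.inl i)) fun i => X (Sum.inr i)) a = a := by
  rw [show (Sum.elim (fun i => X (Sum.inl i)) fun i => X (Sum.inr i) :
    ι ⊕ ι → MvPowerSeries (ι ⊕ ι) ℂ) = X from funext fun t => by rcases t with i | i <;> rfl]
  exact subst_X_self a

/-- A linear form that contains `w_j` has order one. -/
theorem notMem_of_linCoeff_ne {σ : Type} {a : MvPowerSeries σ ℂ} {t : σ} (h : linCoeff t a ≠ 0) :
    a ∉ ordIdeal σ 2 := fun h1 => h (linCoeff_of_mem h1)

theorem linCoeff_add_smul [DecidableEq ι] (c : ℂ) (i j : ι) :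
    linCoeff (Sum.inr i) (X (Sum.inr i) + X (Sum.inr i) + c • X (Sum.inl j) :
      MvPowerSeries (ι ⊕ ι) ℂ) = 2 := by
  simp only [linCoeff_add, linCoeff_smul, linCoeff_X, if_true, reduceCtorEq, if_false]
  norm_num

theorem add_add_smul_notMem [DecidableEq ι] (c : ℂ) (i j : ι) :
    (X (Sum.inr i) + X (Sum.inr i) + c • X (Sum.inl j) : MvPowerSeries (ι ⊕ ι) ℂ) ∉
      ordIdeal (ι ⊕ ι) 2 :=
  notMem_of_linCoeff_ne (t := Sum.inr i) (by rw [linCoeff_add_smul]; norm_num)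

/-- If the number of deck transformations is maximal, one of them changes all signs. -/
theorem IsPerturbation.exists_deck [DecidableEq ι] (hE : IsPerturbation π g q E)
    (h : HasMaximalDeck E) :
    ∃ f : ι → MvPowerSeries (ι ⊕ ι) ℂ, (∀ i, constantCoeff (f i) = 0) ∧
      HasReflectionPart π (fun i => g (π i)) f ∧
      ∀ j, subst (Sum.elim (fun i => X (Sum.inl i)) f) (E j) = E j := by
  have hu : ∀ i : ι, constantCoeff (X (Sum.inl i) : MvPowerSeries (ι ⊕ ι) ℂ) = 0 :=
    fun i => constantCoeff_X _
  have hw : ∀ i : ι, constantCoeff (X (Sum.inr i) : MvPowerSeries (ι ⊕ ι) ℂ) = 0 :=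
    fun i => constantCoeff_X _
  -- The set of forms reflected to first order. It determines the deck transformation, since two
  -- deck transformations with the same signs coincide by `eq_of_notMem`; so $2^p$ of them exhaust
  -- all subsets, in particular the full one.
  let sgn : (ι → MvPowerSeries (ι ⊕ ι) ℂ) → Set ι := fun f =>
    {j | f (π j) + X (Sum.inr (π j)) + g j • X (Sum.inl j) ∈ ordIdeal (ι ⊕ ι) 2}
  have hor : ∀ f ∈ formalDeckTransformations E, ∀ j,
      f (π j) - X (Sum.inr (π j)) ∈ ordIdeal (ι ⊕ ι) 2 ∨ j ∈ sgn f := fun f hf j =>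
    hE.mem_or_mem hu hf.1 hw (fun j => by rw [hf.2.2 j, subst_sumElim_X]) j
  have hinj : Set.InjOn sgn (formalDeckTransformations E) := by
    intro f hf f' hf' hs
    refine hE.eq_of_notMem hu hf.1 hf'.1 (fun j => by rw [hf.2.2 j, hf'.2.2 j]) fun j hj => ?_
    by_cases hj1 : j ∈ sgn f
    · have hj2 : j ∈ sgn f' := hs ▸ hj1
      refine add_add_smul_notMem (g j) (π j) j ?_
      convert Ideal.sub_mem _ (Ideal.add_mem _ hj1 hj2) hj using 1
      ring
    · have hj2 : j ∉ sgn f' := hs ▸ hj1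
      have h1 := (hor f hf j).resolve_right hj1
      have h2 := (hor f' hf' j).resolve_right hj2
      refine add_add_smul_notMem (g j) (π j) j ?_
      convert Ideal.sub_mem _ hj (Ideal.add_mem _ h1 h2) using 1
      ring
  have himg : sgn '' formalDeckTransformations E = Set.univ := by
    refine Set.Finite.eq_of_subset_of_encard_le (Set.toFinite _) (Set.subset_univ _) ?_
    rw [hinj.encard_image, h, Set.encard_univ, ENat.card_eq_coe_fintype_card, Fintype.card_set]
    push_cast; rfl
  obtain ⟨f, hf, hfu⟩ := himg.symm ▸ Set.mem_univ (Set.univ : Set ι)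
  refine ⟨f, hf.1, fun i => ?_, hf.2.2⟩
  have h1 : π i ∈ sgn f := by rw [hfu]; exact Set.mem_univ _
  have h2 : f (π (π i)) + X (Sum.inr (π (π i))) + g (π i) • X (Sum.inl (π i)) ∈
    ordIdeal (ι ⊕ ι) 2 := h1
  rwa [hE.involutive] at h2

variable {f : ι → MvPowerSeries (ι ⊕ ι) ℂ}

/-- The square of the reflection preserves `E` and agrees with the identity to first order, hence is
the identity. -/
theorem IsPerturbation.isFiberInvolution [DecidableEq ι] (hE : IsPerturbation π g q E)
    (hf : ∀ i, constantCoeff (f i) = 0) (hl : HasReflectionPart π (fun i => g (π i)) f)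
    (h : ∀ j, subst (Sum.elim (fun i => X (Sum.inl i)) f) (E j) = E j) : IsFiberInvolution f := by
  have hu : ∀ i : ι, constantCoeff (X (Sum.inl i) : MvPowerSeries (ι ⊕ ι) ℂ) = 0 :=
    fun i => constantCoeff_X _
  have hw : ∀ i : ι, constantCoeff (X (Sum.inr i) : MvPowerSeries (ι ⊕ ι) ℂ) = 0 :=
    fun i => constantCoeff_X _
  have hc := constantCoeff_sumElim hu hf
  have hv := constantCoeff_comp₂ hf hu hf
  refine fun i => congrFun (hE.eq_of_notMem hu hv hw (fun j => ?_) fun j hj => ?_) i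
  · rw [subst_sumElim_X]
    have h1 := congrArg (subst (Sum.elim (fun i => X (Sum.inl i)) f)) (h j)
    rw [subst_subst hc hc, h] at h1
    rw [← h1]
    congr 1
    funext t
    rcases t with i | i
    · exact (subst_X_apply hc (Sum.inl i)).symm
    · rfl
  · have h1 := hl.comp₂_mem hu hf (π j)
    have h2 := hl (π j)
    simp only [hE.involutive j] at h1 h2
    refine add_add_smul_notMem (g j) (π j) j ?_
    convert Ideal.add_mem _ (Ideal.sub_mem _ hj h1) h2 using 1
    ring

theorem subst_comp₂_of_deck (hf : ∀ i, constantCoeff (f i) = 0)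
    (hdeck : ∀ j, subst (Sum.elim (fun i => X (Sum.inl i)) f) (E j) = E j)
    {P : ι → MvPowerSeries ι ℂ} (hP : ∀ i, constantCoeff (P i) = 0) (j : ι) :
    subst (Sum.elim X (comp₂ f X P)) (E j) = subst (Sum.elim X P) (E j) := by
  have hc := constantCoeff_sumElim (fun j : ι => constantCoeff_X' j) hP
  have h1 := congrArg (subst (Sum.elim X P)) (hdeck j)
  rw [subst_subst (constantCoeff_sumElim (fun i => constantCoeff_X _) hf) hc] at h1
  rw [← h1]
  congr 1
  funext t
  rcases t with i | i
  · exact (subst_X_apply hc (Sum.inl i)).symm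
  · rfl

/-- The second leaf is the image of the first one under the deck transformation. -/
theorem IsPerturbation.eq_comp₂ [DecidableEq ι] (hE : IsPerturbation π g q E)
    (hf : ∀ i, constantCoeff (f i) = 0) (hl : HasReflectionPart π (fun i => g (π i)) f)
    (hdeck : ∀ j, subst (Sum.elim (fun i => X (Sum.inl i)) f) (E j) = E j)
    {P₁ P₂ : ι → MvPowerSeries ι ℂ}
    (hP₁ : ∀ i, constantCoeff (P₁ i) = 0) (hP₂ : ∀ i, constantCoeff (P₂ i) = 0)
    (h : ∀ j, subst (Sum.elim X P₁) (E j) = subst (Sum.elim X P₂) (E j))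
    (hT : ∀ u, (linearPart P₁).mulVec u = (linearPart P₂).mulVec u → u = 0) :
    P₂ = comp₂ f X P₁ := by
  have hX := fun j : ι => constantCoeff_X' j
  refine hE.eq_of_notMem hX hP₂ (constantCoeff_comp₂ hf hX hP₁) (fun j => ?_) fun j hj => ?_
  · rw [← h, subst_comp₂_of_deck hf hdeck hP₁]
  · have h1 := hl.comp₂_mem hX hP₁ (π j)
    rw [hE.involutive] at h1
    refine (hE.add_mem hP₁ hP₂ h hT j).1 ?_
    rw [← neg_sub]
    refine (Ideal.neg_mem_iff _).2 ?_
    convert Ideal.sub_mem _ hj h1 using 1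
    ring

end Deck

/-! ### Asymptotic pairs and admissible eigenvalues. -/

section Pairs

variable {ι : Type} [Fintype ι] [DecidableEq ι] {π : ι → ι} {g q ν : ι → ℂ}
  {E f : ι → MvPowerSeries (ι ⊕ ι) ℂ}

theorem IsAdmissible.inv_ne {ν : ι → ℂ} [Nonempty ι] (h : IsAdmissible π g ν)
    (hg : IsRegular π g) : ν⁻¹ ≠ ν := by
  intro h1
  obtain ⟨j⟩ := ‹Nonempty ι›
  refine h.sq_ne_one hg j ?_
  have h2 := congrFun h1 j
  rw [Pi.inv_apply] at h2
  rw [pow_two]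
  nth_rw 1 [← h2]
  exact inv_mul_cancel₀ (h.ne_zero j)

/-- An admissible vector is determined by its set of entries. -/
theorem IsAdmissible.eq_of_prod_eq {ν ν' : ι → ℂ} (hg : IsRegular π g) (h : IsAdmissible π g ν)
    (h' : IsAdmissible π g ν') (hp : ∏ j, (Polynomial.X - Polynomial.C (ν j)) =
      ∏ j, (Polynomial.X - Polynomial.C (ν' j))) : ν = ν' := by
  funext j
  have h1 := congrArg (Polynomial.eval (ν j)) hp
  rw [Polynomial.eval_prod, Polynomial.eval_prod,
    Finset.prod_eq_zero (Finset.mem_univ j) (by simp)] at h1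
  obtain ⟨i, -, hi⟩ := Finset.prod_eq_zero_iff.1 h1.symm
  have h2 : ν j = ν' i := by simpa [sub_eq_zero] using hi
  -- A common root `x` determines `G`, because `(1 + x) ^ 2 = G * x` and `x ≠ 0`; distinctness of
  -- the `G` then matches the indices.
  have h3 := h.eq j
  rw [h2, h'.eq i] at h3
  rw [h2, hg.inj (mul_right_cancel₀ (h'.ne_zero i) h3)]

/-- The deck transformation that changes all signs. -/
structure IsReflection (π : ι → ι) (g : ι → ℂ) (E f : ι → MvPowerSeries (ι ⊕ ι) ℂ) : Prop where
  constantCoeff_eq : ∀ i, constantCoeff (f i) = 0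
  hasReflectionPart : HasReflectionPart π (fun i => g (π i)) f
  subst_eq : ∀ j, subst (Sum.elim (fun i => X (Sum.inl i)) f) (E j) = E j

/-- `{P, f(z, P)}` is a pair of real leaves with linear part given by `ν`. -/
structure IsLeaf (π : ι → ι) (g ν : ι → ℂ) (f : ι → MvPowerSeries (ι ⊕ ι) ℂ)
    (P : ι → MvPowerSeries ι ℂ) : Prop where
  fst : IsAntiholomorphicInvolution P
  snd : IsAntiholomorphicInvolution (comp₂ f X P)
  linearPart_eq : linearPart P = leafMatrix π g ν

variable {P P' : ι → MvPowerSeries ι ℂ}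

theorem IsLeaf.linearPart_snd (hπ : Function.Involutive π) (hg : IsRegular π g)
    (hν : IsAdmissible π g ν) (hf : IsReflection π g E f) (h : IsLeaf π g ν f P) :
    linearPart (comp₂ f X P) = leafMatrix π g ν⁻¹ :=
  (sub_linearLeaf_mem_iff.1 (comp₂_leaf_mem hπ hg hν hf.hasReflectionPart
    (sub_linearLeaf_mem_iff.2 ⟨h.fst.1, h.linearPart_eq⟩))).2

theorem IsLeaf.inv (hE : IsPerturbation π g q E) (hg : IsRegular π g)
    (hν : IsAdmissible π g ν) (hf : IsReflection π g E f) (h : IsLeaf π g ν f P) :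
    IsLeaf π g ν⁻¹ f (comp₂ f X P) := by
  refine ⟨h.snd, ?_, h.linearPart_snd hE.involutive hg hν hf⟩
  have := hE.isFiberInvolution hf.constantCoeff_eq hf.hasReflectionPart hf.subst_eq
  rw [this.comp₂_comp₂ hf.constantCoeff_eq constantCoeff_X' h.fst.1]
  exact h.fst

/-- A formal invariant graph exists, and its uniqueness makes it real. Conversely every pair of real
leaves exchanged by `f` is invariant, so the uniqueness is inherited. -/
theorem IsReflection.exists_isLeaf (hE : IsPerturbation π g q E) (hg : IsRegular π g)
    (hν : IsAdmissible π g ν) (hn : IsNonResonant ν) (hf : IsReflection π g E f) :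
    ∃ P, IsLeaf π g ν f P ∧ ∀ R, IsLeaf π g ν f R → R = P := by
  obtain ⟨P, hP0, hP1, hP2, huniq⟩ := exists_isInvariantGraph hE.involutive hg hν hn
    hf.constantCoeff_eq hf.hasReflectionPart
  have hfib := hE.isFiberInvolution hf.constantCoeff_eq hf.hasReflectionPart hf.subst_eq
  obtain ⟨h1, h2⟩ := hP2.isAntiholomorphicInvolution hf.constantCoeff_eq hfib hP0
    (by rw [hP1]; exact leafMatrix_conj_mul_self hE.involutive hg hν)
    (fun R hR0 hR1 hR2 => huniq R hR0 (hR1.trans hP1) hR2)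
  exact ⟨P, ⟨h1, h2, hP1⟩, fun R hR => huniq R hR.fst.1 hR.linearPart_eq
    (hR.fst.isInvariantGraph hf.constantCoeff_eq hfib hR.snd)⟩

theorem IsLeaf.isAsymptoticPair (hE : IsPerturbation π g q E) (hg : IsRegular π g)
    (hν : IsAdmissible π g ν) (hf : IsReflection π g E f) (h : IsLeaf π g ν f P) :
    IsAsymptoticPair (manifold E) (fixedIn (manifold E) P)
      (fixedIn (manifold E) (comp₂ f X P)) := by
  refine ⟨_, isAttachedAlong_complexGraph hE.mem_two h.fst h.snd (fun j => rfl)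
    (fun j => subst_comp₂_of_deck hf.constantCoeff_eq hf.subst_eq h.fst.1 j) fun u hu => ?_⟩
  rw [h.linearPart_eq, h.linearPart_snd hE.involutive hg hν hf] at hu
  exact eq_zero_of_leafMatrix_mulVec_eq hE.involutive hg hν u hu

theorem IsPerturbation.exists_isLeaf (hE : IsPerturbation π g q E) (hg : IsRegular π g)
    (hf : IsReflection π g E f) {K₁ K₂ : Ideal (RealSeries (ι ⊕ ι))}
    (h : IsAsymptoticPair (manifold E) K₁ K₂) :
    ∃ ν P, IsAdmissible π g ν ∧ IsLeaf π g ν f P ∧ K₁ = fixedIn (manifold E) P ∧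
      K₂ = fixedIn (manifold E) (comp₂ f X P) := by
  obtain ⟨K, hK⟩ := h
  obtain ⟨P₁, P₂, h₁, h₂, e₁, e₂, heq, hT⟩ := hK.exists_involutions hE.mem_two
  obtain ⟨ν, hν, hl, -⟩ := hE.exists_admissible hg h₁ h₂ heq hT
  obtain rfl := hE.eq_comp₂ hf.constantCoeff_eq hf.hasReflectionPart hf.subst_eq h₁.1 h₂.1 heq hT
  exact ⟨ν, P₁, hν, ⟨h₁, h₂, hl⟩, e₁, e₂⟩

/-- The characteristic polynomial determines $\nu$, which determines the linear part of the first
leaf, hence the leaf, hence its partner through `f`. Uniqueness can hold for ordered pairs because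
exchanging the leaves replaces $\nu$ by $\nu^{-1}\ne\nu$. -/
theorem IsPerturbation.existsUnique_pair (hE : IsPerturbation π g q E) (hg : IsRegular π g)
    (hdeck : HasMaximalDeck E) (hν : IsAdmissible π g ν) (hn : IsNonResonant ν) :
    ∃! K : Ideal (RealSeries (ι ⊕ ι)) × Ideal (RealSeries (ι ⊕ ι)),
      IsAsymptoticPair (manifold E) K.1 K.2 ∧
      ∃ P₁ P₂ : ι → MvPowerSeries ι ℂ,
        IsAntiholomorphicInvolution P₁ ∧ IsAntiholomorphicInvolution P₂ ∧
        K.1 = fixedIn (manifold E) P₁ ∧ K.2 = fixedIn (manifold E) P₂ ∧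
        ((linearPart P₂)⁻¹ * linearPart P₁).charpoly =
          ∏ j, (Polynomial.X - Polynomial.C (ν j)) := by
  have hE0 : ∀ j, constantCoeff (E j) = 0 := fun j => constantCoeff_of_mem_two (hE.mem_two j)
  obtain ⟨f, hf0, hf1, hf2⟩ := hE.exists_deck hdeck
  have hf : IsReflection π g E f := ⟨hf0, hf1, hf2⟩
  have hchar : ∀ ν P, IsAdmissible π g ν → IsLeaf π g ν f P →
      ((linearPart (comp₂ f X P))⁻¹ * linearPart P).charpoly =
        ∏ j, (Polynomial.X - Polynomial.C (ν j)) := fun ν P hν h => by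
    rw [h.linearPart_eq, h.linearPart_snd hE.involutive hg hν hf,
      leafMatrix_inv_mul hE.involutive hg hν, Matrix.charpoly_diagonal]
  obtain ⟨P, hP, huniq⟩ := hf.exists_isLeaf hE hg hν hn
  refine ⟨(fixedIn (manifold E) P, fixedIn (manifold E) (comp₂ f X P)),
    ⟨hP.isAsymptoticPair hE hg hν hf, P, _, hP.fst, hP.snd, rfl, rfl, hchar ν P hν hP⟩, ?_⟩
  rintro ⟨K₁, K₂⟩ ⟨hK, R₁, R₂, hR₁, hR₂, e₁, e₂, hR⟩
  obtain ⟨ν', P', hν', hP', e₁', e₂'⟩ := hE.exists_isLeaf hg hf hK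
  simp only at e₁ e₂ e₁' e₂'
  obtain rfl := fixedIn_injective hE0 hR₁ (e₁.symm.trans e₁')
  obtain rfl := fixedIn_injective hE0 hR₂ (e₂.symm.trans e₂')
  rw [hchar ν' R₁ hν' hP'] at hR
  obtain rfl := hν'.eq_of_prod_eq hg hν hR
  rw [e₁, e₂, huniq R₁ hP']

/-- Admissible vectors correspond to ordered pairs, and inversion, which has no fixed point, to the
exchange of the two leaves; hence the factor two. -/
theorem IsPerturbation.two_mul_encard_asymptoticPairs [Nonempty ι] (hE : IsPerturbation π g q E)
    (hg : IsRegular π g) (hdeck : HasMaximalDeck E) (hfin : {ν | IsAdmissible π g ν}.Finite)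
    (hn : ∀ ν, IsAdmissible π g ν → IsNonResonant ν) :
    2 * (asymptoticPairs (manifold E)).encard = {ν | IsAdmissible π g ν}.encard := by
  have hE0 : ∀ j, constantCoeff (E j) = 0 := fun j => constantCoeff_of_mem_two (hE.mem_two j)
  obtain ⟨f, hf0, hf1, hf2⟩ := hE.exists_deck hdeck
  have hf : IsReflection π g E f := ⟨hf0, hf1, hf2⟩
  have hex : ∀ ν, ∃ P, IsAdmissible π g ν → IsLeaf π g ν f P ∧ ∀ R, IsLeaf π g ν f R → R = P := by
    intro ν
    by_cases hν : IsAdmissible π g ν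
    · obtain ⟨P, hP⟩ := hf.exists_isLeaf hE hg hν (hn ν hν)
      exact ⟨P, fun _ => hP⟩
    · exact ⟨fun _ => 0, fun h => absurd h hν⟩
  choose P hP using hex
  have hinv : ∀ ν, IsAdmissible π g ν → comp₂ f X (P ν) = P ν⁻¹ := fun ν hν =>
    (hP ν⁻¹ hν.inv).2 _ ((hP ν hν).1.inv hE hg hν hf)
  rw [← two_mul_encard_image_pair (K := fun ν => fixedIn (manifold E) (P ν)) hfin
    (fun ν hν => IsAdmissible.inv hν) (fun ν hν => IsAdmissible.inv_ne hν hg)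
    (fun ν _ => inv_inv ν)]
  · congr 2
    ext S
    constructor
    · rintro ⟨K₁, K₂, rfl, hK⟩
      obtain ⟨ν, R, hν, hR, rfl, rfl⟩ := hE.exists_isLeaf hg hf hK
      refine ⟨ν, hν, ?_⟩
      rw [(hP ν hν).2 R hR, hinv ν hν]
    · rintro ⟨ν, hν, rfl⟩
      refine ⟨_, _, rfl, ?_⟩
      rw [← hinv ν hν]
      exact (hP ν hν).1.isAsymptoticPair hE hg hν hf
  · intro ν hν ν' hν' h
    have h1 := fixedIn_injective hE0 (hP ν hν).1.fst h
    refine leafMatrix_injective hE.involutive hg ?_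
    rw [← (hP ν hν).1.linearPart_eq, ← (hP ν' hν').1.linearPart_eq, h1]

end Pairs

/-! ### Linear leaves of the quadric and the elliptic obstruction. -/

section LinearLeaves

variable {ι : Type} [Fintype ι] [DecidableEq ι] {π : ι → ι} {g q ν : ι → ℂ}
  {E : ι → MvPowerSeries (ι ⊕ ι) ℂ}

theorem isAntiholomorphicInvolution_linearLeaf (hπ : Function.Involutive π) (hg : IsRegular π g)
    (hν : IsAdmissible π g ν) : IsAntiholomorphicInvolution (linearLeaf π g ν) := by
  refine ⟨fun i => constantCoeff_linearLeaf i, fun i => ?_⟩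
  have hs := hasSubst_of_constantCoeff_zero (constantCoeff_linearLeaf (π := π) (g := g) (ν := ν))
  have h1 := congrFun (congrFun (leafMatrix_conj_mul_self hπ hg hν) i) i
  rw [leafMatrix_mul hπ, Matrix.diagonal_apply_eq, Matrix.one_apply_eq] at h1
  rw [linearLeaf, smul_eq_C_mul, map_mul, map_C, map_X, ← smul_eq_C_mul, subst_smul hs, subst_X hs,
    linearLeaf, smul_smul, hπ i]
  convert one_smul ℂ (X i : MvPowerSeries ι ℂ) using 2
  refine Eq.trans ?_ h1
  rw [map_div₀, map_neg, map_add, map_one, Complex.conj_conj, div_mul_div_comm, neg_mul_neg]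

/-- The complex submanifold that contains all linear leaves of the quadric. -/
def leafGraph (π : ι → ι) (g q : ι → ℂ) (j : ι) : MvPowerSeries ι ℂ :=
  (q j * ((g j * conj (g (π j))) ^ 2 - 4 * (g j * conj (g (π j)))) / (4 * conj (g (π j)) ^ 2)) •
    X j ^ 2

/-- The dependence on $\nu$ cancels: $(G/2-(1+\nu))^2=G^2/4-G(1+\nu)+G\nu=G^2/4-G$. Thus all linear
leaves lie in one complex submanifold. -/
theorem subst_linearLeaf (hπ : Function.Involutive π) (hg : IsRegular π g)
    (hν : IsAdmissible π g ν) (j : ι) :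
    subst (Sum.elim X (linearLeaf π g ν))
      (q j • (X (Sum.inr (π j)) + (g j / 2) • X (Sum.inl j)) ^ 2 : MvPowerSeries (ι ⊕ ι) ℂ) =
      leafGraph π g q j := by
  have hs := hasSubst_of_constantCoeff_zero (constantCoeff_sumElim (fun j : ι => constantCoeff_X' j)
    (constantCoeff_linearLeaf (π := π) (g := g) (ν := ν)))
  rw [subst_smul hs, subst_pow hs, subst_add hs, subst_smul hs, subst_X hs, subst_X hs,
    Sum.elim_inl, Sum.elim_inr, linearLeaf, hπ j, ← add_smul, smul_pow, smul_smul, leafGraph]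
  congr 1
  have h2 : conj (g (π j)) ≠ 0 := (_root_.map_ne_zero _).2 (hg.g_ne _)
  have h3 := hν.eq j
  field_simp
  linear_combination 16 * q j * h3

theorem encard_le_two_mul_encard_analyticAsymptoticPairsIn [Nonempty ι]
    (hπ : Function.Involutive π) (hg : IsRegular π g)
    (hE : ∀ j, E j = q j • (X (Sum.inr (π j)) + (g j / 2) • X (Sum.inl j)) ^ 2)
    (hfin : {ν | IsAdmissible π g ν}.Finite) :
    {ν | IsAdmissible π g ν}.encard ≤
      2 * (analyticAsymptoticPairsIn (manifold E) (complexGraph (leafGraph π g q))).encard := by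
  have hE2 : ∀ j, E j ∈ ordIdeal (ι ⊕ ι) 2 := by
    intro j
    have h1 : (X (Sum.inr (π j)) + (g j / 2) • X (Sum.inl j) : MvPowerSeries (ι ⊕ ι) ℂ) ∈
        ordIdeal (ι ⊕ ι) 1 :=
      Ideal.add_mem _ (X_mem_ordIdeal _) (smul_mem_ordIdeal _ (X_mem_ordIdeal _))
    rw [hE, pow_two]
    exact smul_mem_ordIdeal _ (mul_mem_ordIdeal h1 h1 le_rfl)
  have hE0 : ∀ j, constantCoeff (E j) = 0 := fun j => constantCoeff_of_mem_two (hE2 j)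
  have hEp : ∀ j, E j ∈ polySubalgebra (ι ⊕ ι) := fun j => by
    rw [hE]
    exact Subalgebra.smul_mem _ (pow_mem (add_mem (X_mem_polySubalgebra _)
      (Subalgebra.smul_mem _ (X_mem_polySubalgebra _) _)) _) _
  have hPp : ∀ ν j, linearLeaf π g ν j ∈ polySubalgebra ι := fun ν j =>
    Subalgebra.smul_mem _ (X_mem_polySubalgebra _) _
  have hP : ∀ ν, IsAdmissible π g ν → IsAntiholomorphicInvolution (linearLeaf π g ν) :=
    fun ν hν => isAntiholomorphicInvolution_linearLeaf hπ hg hν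
  rw [← two_mul_encard_image_pair (K := fun ν => fixedIn (manifold E) (linearLeaf π g ν)) hfin
    (fun ν hν => IsAdmissible.inv hν) (fun ν hν => IsAdmissible.inv_ne hν hg)
    (fun ν _ => inv_inv ν)]
  · gcongr
    rintro _ ⟨ν, hν, rfl⟩
    refine ⟨_, _, rfl, isAttachedAlong_complexGraph hE2 (hP _ hν) (hP _ (IsAdmissible.inv hν))
      (fun j => ?_) (fun j => ?_) (fun u hu => ?_),
      isAnalyticSubmanifold_fixedIn hE0 (hP _ hν) hEp (hPp _),
      isAnalyticSubmanifold_fixedIn hE0 (hP _ (IsAdmissible.inv hν)) hEp (hPp _)⟩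
    · rw [hE, subst_linearLeaf hπ hg hν]
    · rw [hE, subst_linearLeaf hπ hg (IsAdmissible.inv hν)]
    · rw [linearPart_linearLeaf, linearPart_linearLeaf] at hu
      exact eq_zero_of_leafMatrix_mulVec_eq hπ hg hν u hu
  · intro ν hν ν' hν' h
    have h1 := fixedIn_injective hE0 (hP ν hν) h
    refine leafMatrix_injective hπ hg ?_
    rw [← linearPart_linearLeaf, ← linearPart_linearLeaf, h1]

theorem isComplexSubmanifold_leafGraph :
    IsComplexSubmanifold (Fintype.card ι) (complexGraph (leafGraph π g q)) :=
  isComplexSubmanifold_complexGraph (fun j => by simp [leafGraph])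
    fun j => Subalgebra.smul_mem _ (pow_mem (X_mem_polySubalgebra _) _) _

/-- There are no elliptic components. -/
theorem IsAdmissible.norm_le (hν : IsAdmissible π g ν) {j : ι} (hj : π j = j) : ‖g j‖ ≤ 2 := by
  have h1 := hν.eq j
  have h2 := hν.conj_mul j
  rw [hj] at h1 h2
  -- At an index fixed by `π` the reality condition is `conj (ν j) * ν j = 1`; the bound then comes
  -- from $|g|^2=|1+\nu|^2$.
  have h3 : ‖ν j‖ = 1 := by
    have := congrArg norm h2
    rw [norm_mul, Complex.norm_conj, norm_one] at this
    nlinarith [norm_nonneg (ν j)]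
  have h4 := congrArg norm h1
  rw [norm_mul, norm_mul, Complex.norm_conj, h3, norm_pow, mul_one, ← pow_two] at h4
  have h5 : ‖1 + ν j‖ ≤ 2 := (norm_add_le _ _).trans (by rw [h3, norm_one]; norm_num)
  rw [← (pow_left_inj₀ (norm_nonneg _) (norm_nonneg _) two_ne_zero).1 h4]
  exact h5

theorem IsPerturbation.exists_admissible_of_isAttached (hE : IsPerturbation π g q E)
    (hg : IsRegular π g) (h : ∃ K, IsAttached (manifold E) K) : ∃ ν, IsAdmissible π g ν := by
  obtain ⟨K, K₁, K₂, hK⟩ := h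
  obtain ⟨P₁, P₂, h₁, h₂, -, -, heq, hT⟩ := hK.exists_involutions hE.mem_two
  obtain ⟨ν, hν, -⟩ := hE.exists_admissible hg h₁ h₂ heq hT
  exact ⟨ν, hν⟩

end LinearLeaves

/-! ### The cubic perturbation without attached submanifolds. -/

section Example

theorem isPerturbation_exampleE {γ₁ γ₂ : ℝ} (h₁ : γ₁ ≠ 0) (h₂ : γ₂ ≠ 0) :
    IsPerturbation id ![(γ₁ : ℂ)⁻¹, (γ₂ : ℂ)⁻¹] ![4 * (γ₁ : ℂ) ^ 2, 4 * (γ₂ : ℂ) ^ 2]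
      (exampleE γ₁ γ₂) := by
  have hγ₁ : (γ₁ : ℂ) ≠ 0 := by exact_mod_cast h₁
  have hγ₂ : (γ₂ : ℂ) ≠ 0 := by exact_mod_cast h₂
  have key : ∀ (γ : ℂ), γ ≠ 0 → ∀ z w : MvPowerSeries (Fin 2 ⊕ Fin 2) ℂ,
      (z + (2 * γ) • w) ^ 2 = (4 * γ ^ 2) • (w + (γ⁻¹ / 2) • z) ^ 2 := by
    intro γ hγ z w
    have : z + (2 * γ) • w = (2 * γ) • (w + (γ⁻¹ / 2) • z) := by
      rw [smul_add, smul_smul, show 2 * γ * (γ⁻¹ / 2) = 1 by field_simp, one_smul, add_comm]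
    rw [this, smul_pow]
    congr 1; ring
  refine ⟨fun _ => rfl, fun j => ?_, fun j => ?_⟩
  · fin_cases j <;> simp [h₁, h₂]
  · fin_cases j
    · have hL : (ProductQuadric.zVar 1 + (2 * (γ₂ : ℂ)) • ProductQuadric.wVar 1 :
          MvPowerSeries (Fin 2 ⊕ Fin 2) ℂ) ∈ ordIdeal (Fin 2 ⊕ Fin 2) 1 :=
        Ideal.add_mem _ (X_mem_ordIdeal _) (smul_mem_ordIdeal _ (X_mem_ordIdeal _))
      have h3 := mul_mem_ordIdeal (mul_mem_ordIdeal hL hL le_rfl) hL (m := 3) le_rfl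
      convert h3 using 1
      simp only [exampleE, Fin.zero_eta, Matrix.cons_val_zero, id, key _ hγ₁]
      simp only [ProductQuadric.zVar, ProductQuadric.wVar]
      ring
    · convert Ideal.zero_mem _ using 1
      simp only [exampleE, Fin.mk_one, Matrix.cons_val_one, Matrix.cons_val_fin_one, id,
        key _ hγ₂]
      simp only [ProductQuadric.zVar, ProductQuadric.wVar, sub_self]

theorem not_isAttached_exampleE {γ₁ γ₂ : ℝ} (h₁ : γ₁ ≠ 0) (h₂ : γ₂ ≠ 0) :
    ¬ ∃ K, IsAttached (manifold (exampleE γ₁ γ₂)) K := by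
  rintro ⟨K, K₁, K₂, hK⟩
  have hE := isPerturbation_exampleE h₁ h₂
  have hγ₁ : (γ₁ : ℂ) ≠ 0 := by exact_mod_cast h₁
  have hγ₂ : (γ₂ : ℂ) ≠ 0 := by exact_mod_cast h₂
  obtain ⟨P, P', hP, hP', -, -, heq, hT⟩ := hK.exists_involutions hE.mem_two
  have hs := hasSubst_of_constantCoeff_zero
    (constantCoeff_sumElim (fun j : Fin 2 => constantCoeff_X' j) hP.1)
  have hs' := hasSubst_of_constantCoeff_zero
    (constantCoeff_sumElim (fun j : Fin 2 => constantCoeff_X' j) hP'.1)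
  have hadd := hE.add_mem hP.1 hP'.1 heq hT
  simp only [id] at hadd
  have e0 := heq 0
  have e1 := heq 1
  simp only [exampleE, Matrix.cons_val_zero, Matrix.cons_val_one, Matrix.cons_val_fin_one,
    ProductQuadric.zVar, ProductQuadric.wVar, subst_add hs, subst_add hs', subst_pow hs,
    subst_pow hs', subst_smul hs, subst_smul hs', subst_X hs, subst_X hs', Sum.elim_inl,
    Sum.elim_inr] at e0 e1
  -- The second equation equates two squares in a domain; equal roots would give `P 1 = P' 1`,
  -- against transversality.
  have hopp : X 1 + (2 * (γ₂ : ℂ)) • P' 1 = -(X 1 + (2 * (γ₂ : ℂ)) • P 1) := by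
    rcases sq_eq_sq_iff_eq_or_eq_neg.1 e1 with h | h
    · exfalso
      refine (hadd 1).1 ?_
      have h3 := smul_right_injective (MvPowerSeries (Fin 2) ℂ)
        (mul_ne_zero two_ne_zero hγ₂) (add_left_cancel h)
      rw [h3, sub_self]
      exact Ideal.zero_mem _
    · rw [h, neg_neg]
  -- The cubed forms are opposite, so each is half of their difference and the cubes add up to a
  -- multiple of `(P 1 - P' 1) ^ 3`, while the squares in `z₁` factor.
  have hprod : (P 0 - P' 0) * (P 0 + P' 0 + (γ₁ : ℂ)⁻¹ • X 0) =
      (-(2 * (γ₂ : ℂ) ^ 3 / (4 * (γ₁ : ℂ) ^ 2))) • (P 1 - P' 1) ^ 3 := by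
    have hA : C (σ := Fin 2) (γ₁ : ℂ) ≠ 0 := fun h => hγ₁ (C_injective (by rw [h, map_zero]))
    have hi : C (σ := Fin 2) (γ₁ : ℂ) * C (γ₁ : ℂ)⁻¹ = 1 := by
      rw [← map_mul, mul_inv_cancel₀ hγ₁, map_one]
    have h2 : (C (σ := Fin 2) (2 : ℂ)) = 2 := map_ofNat C 2
    have hD : C (σ := Fin 2) (2 * (γ₂ : ℂ) ^ 3 / (4 * (γ₁ : ℂ) ^ 2)) * (4 * C (γ₁ : ℂ) ^ 2) =
        2 * C (γ₂ : ℂ) ^ 3 := by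
      rw [show (4 : MvPowerSeries (Fin 2) ℂ) = C 4 from (map_ofNat C 4).symm, ← h2, ← map_pow,
        ← map_pow, ← map_mul, ← map_mul, ← map_mul]
      congr 1
      field_simp
    rw [hopp] at e0
    simp only [smul_eq_C_mul, map_mul, h2, map_neg] at e0 hopp ⊢
    have h8 : (2 * (X 1 + 2 * C (γ₂ : ℂ) * P 1)) ^ 3 = (2 * C (γ₂ : ℂ) * (P 1 - P' 1)) ^ 3 := by
      congr 1
      linear_combination hopp
    have h32 : (32 * C (γ₁ : ℂ) ^ 2 : MvPowerSeries (Fin 2) ℂ) ≠ 0 :=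
      mul_ne_zero (fun h => by
        rw [← map_ofNat C 32, ← map_zero C] at h
        exact absurd (C_injective h) (by norm_num)) (pow_ne_zero _ hA)
    refine mul_left_cancel₀ h32 ?_
    linear_combination 8 * e0 - 2 * h8 + 32 * C (γ₁ : ℂ) * (P 0 - P' 0) * X 0 * hi +
      8 * (P 1 - P' 1) ^ 3 * hD
  have hsurj : Function.Surjective (linearPart P - linearPart P').mulVecLin := by
    refine LinearMap.injective_iff_surjective.1 ((injective_iff_map_eq_zero _).2 fun u hu => ?_)
    refine hT u ?_
    rwa [Matrix.mulVecLin_apply, Matrix.sub_mulVec, sub_eq_zero] at hu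
  -- By transversality there is a direction in which the linear part of `P 0 - P' 0` vanishes and
  -- that of `P 1 - P' 1` equals one.
  obtain ⟨u, hu⟩ := hsurj ![0, 1]
  let a : Fin 2 → MvPowerSeries Unit ℂ := fun i => u i • X ()
  have ha : ∀ i, constantCoeff (a i) = 0 := fun i => by simp [a]
  have has := hasSubst_of_constantCoeff_zero ha
  have hlin : ∀ i, linCoeff () (subst a (P i - P' i)) = ![0, 1] i := by
    intro i
    rw [linCoeff_subst ha, ← hu, Matrix.mulVecLin_apply, Matrix.mulVec, dotProduct]
    refine Finset.sum_congr rfl fun j _ => ?_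
    simp [a, linearPart, linCoeff_X]
  have hc : ∀ i, constantCoeff (subst a (P i - P' i)) = 0 := fun i =>
    constantCoeff_subst' (by rw [map_sub, hP.1, hP'.1, sub_zero]) ha
  have hm0 : subst a (P 0 - P' 0) ∈ ordIdeal Unit 2 :=
    mem_ordIdeal_two.2 ⟨hc 0, fun _ => by rw [hlin]; rfl⟩
  have hm1 : subst a (P 1 - P' 1) ∉ ordIdeal Unit 2 := fun h => by
    have := (mem_ordIdeal_two.1 h).2 ()
    rw [hlin] at this
    simp at this
  have hsum := subst_mem_ordIdeal ha (hadd 0).2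
  have h4 := congrArg (subst a) hprod
  rw [subst_mul has, subst_smul has, subst_pow has] at h4
  -- On this line both factors on the left have order at least two, whereas the right side is a
  -- nonzero multiple of the cube of a series of order one.
  have h5 := mul_mem_ordIdeal hm0 hsum (m := 4) le_rfl
  simp only [Matrix.cons_val_zero] at h5
  rw [h4] at h5
  have hcne : -(2 * (γ₂ : ℂ) ^ 3 / (4 * (γ₁ : ℂ) ^ 2)) ≠ 0 := by
    refine neg_ne_zero.2 (div_ne_zero ?_ ?_) <;> simp [h₁, h₂]
  have h6 := smul_mem_ordIdeal (-(2 * (γ₂ : ℂ) ^ 3 / (4 * (γ₁ : ℂ) ^ 2)))⁻¹ h5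
  rw [smul_smul, inv_mul_cancel₀ hcne, one_smul, pow_succ, pow_two] at h6
  have h7 := mem_ordIdeal_of_mul_mem (k := 3) (l := 1) h6 hm1
  exact hm1 (mem_ordIdeal_of_mul_mem (k := 2) (l := 1) h7 hm1)

end Example

/-! ### Product quadrics in the uniform normal form. -/

namespace ProductQuadric

variable {e h s : ℕ} (D : ProductQuadric e h s)

/-- The involution of the indices that exchanges the two coordinates of a couple of complex type. -/
def partner : Index e h s → Index e h s
  | Sum.inl i => Index.ell i
  | Sum.inr (Sum.inl i) => Index.hyp i
  | Sum.inr (Sum.inr (Sum.inl i)) => Index.snd i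
  | Sum.inr (Sum.inr (Sum.inr i)) => Index.fst i

theorem partner_involutive : Function.Involutive (partner : Index e h s → Index e h s) := by
  rintro (i | i | i | i) <;> rfl

/-- The entries of `γ⁻¹`. -/
def gCoeff : Index e h s → ℂ
  | Sum.inl i => (D.γe i : ℂ)⁻¹
  | Sum.inr (Sum.inl i) => (((D.γh i)⁻¹).toReal : ℂ)
  | Sum.inr (Sum.inr (Sum.inl i)) => (D.γs i)⁻¹
  | Sum.inr (Sum.inr (Sum.inr i)) => (1 - conj (D.γs i))⁻¹

/-- The leading coefficients of the squares. -/
def qCoeff : Index e h s → ℂ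
  | Sum.inl i => (2 * (D.γe i : ℂ)) ^ 2
  | Sum.inr (Sum.inl i) => (2 * ((D.γh i).toReal : ℂ)) ^ 2
  | Sum.inr (Sum.inr (Sum.inl i)) => (2 * D.γs i) ^ 2
  | Sum.inr (Sum.inr (Sum.inr i)) => (2 * (1 - conj (D.γs i))) ^ 2

theorem gammaInv_eq : D.gammaInv = gammaMat partner D.gCoeff := by
  ext (i | i | i | i) (k | k | k | k) <;>
    simp [gammaInv, gammaMat, partner, gCoeff, Index.ell, Index.hyp, Index.fst, Index.snd, eq_comm]
  all_goals
    split_ifs with hk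
    · rw [hk]
    · rfl

theorem one_sub_γs_ne_zero (i : Fin s) : 1 - D.γs i ≠ 0 := by
  intro h1
  have h2 := D.γs_re i
  rw [← sub_eq_zero.1 h1, Complex.one_re] at h2
  norm_num at h2

theorem one_sub_conj_γs_ne_zero (i : Fin s) : 1 - conj (D.γs i) ≠ 0 := by
  intro h1
  refine D.one_sub_γs_ne_zero i ?_
  have h2 := congrArg conj h1
  simpa using h2

theorem smul_add_sq {τ : Type} {γ : ℂ} (hγ : γ ≠ 0) (z w : MvPowerSeries τ ℂ) :
    (z + (2 * γ) • w) ^ 2 = ((2 * γ) ^ 2) • (w + (γ⁻¹ / 2) • z) ^ 2 := by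
  rw [← smul_pow, smul_add, smul_smul, show 2 * γ * (γ⁻¹ / 2) = 1 by field_simp, one_smul, add_comm]

/-- An infinite parameter gives $g=0$, hence a double eigenvalue $-1$. So the exceptional form
$z_h^2+\bar z_h^2$ does not occur under regularity, and the uniform normal form covers all cases. -/
theorem γh_ne_top (hg : IsRegular partner D.gCoeff) (i : Fin h) : D.γh i ≠ ⊤ := by
  intro h1
  refine hg.g_ne (Index.hyp i) ?_
  simp [gCoeff, h1]

theorem half_lt_γh {i : Fin h} (h1 : D.γh i ≠ ⊤) : 1 / 2 < (D.γh i).toReal := by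
  have h2 := (ENNReal.toReal_lt_toReal (by simp) h1).2 (D.lt_γh i)
  simpa using h2

theorem quadric_eq (hg : IsRegular partner D.gCoeff) (j : Index e h s) :
    D.quadric j = D.qCoeff j •
      (X (Sum.inr (partner j)) + (D.gCoeff j / 2) • X (Sum.inl j)) ^ 2 := by
  rcases j with i | i | i | i
  · refine smul_add_sq ?_ _ _
    exact_mod_cast (D.γe_pos i).ne'
  · have h1 := D.γh_ne_top hg i
    have h2 := D.half_lt_γh h1
    simp only [quadric, if_neg h1, gCoeff, ENNReal.toReal_inv, Complex.ofReal_inv]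
    refine smul_add_sq ?_ _ _
    exact_mod_cast (by linarith : (D.γh i).toReal ≠ 0)
  · exact smul_add_sq (D.γs_ne_zero i) _ _
  · exact smul_add_sq (D.one_sub_conj_γs_ne_zero i) _ _

theorem qCoeff_ne (hg : IsRegular partner D.gCoeff) (j : Index e h s) : D.qCoeff j ≠ 0 := by
  rcases j with i | i | i | i <;> refine pow_ne_zero 2 (mul_ne_zero two_ne_zero ?_)
  · exact_mod_cast (D.γe_pos i).ne'
  · have h1 := D.half_lt_γh (D.γh_ne_top hg i)
    exact_mod_cast (by linarith : (D.γh i).toReal ≠ 0)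
  · exact D.γs_ne_zero i
  · exact D.one_sub_conj_γs_ne_zero i

theorem isPerturbation (hg : IsRegular partner D.gCoeff)
    {H : Index e h s → MvPowerSeries (Index e h s ⊕ Index e h s) ℂ} (hH : IsThirdOrder H) :
    IsPerturbation partner D.gCoeff D.qCoeff (D.quadric + H) := by
  refine ⟨partner_involutive, D.qCoeff_ne hg, fun j => ?_⟩
  rw [Pi.add_apply, D.quadric_eq hg, add_sub_cancel_left, mem_ordIdeal_iff_le_order]
  exact_mod_cast hH j

/-! ### The spectrum of `σ` -/

theorem sigma_eq : D.sigma = Matrix.fromBlocks (-1) (-D.gammaInv.map conj) D.gammaInv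
    (D.gammaInv * D.gammaInv.map conj - 1) := by
  rw [sigma, tau₁, tau₂, Matrix.fromBlocks_multiply]
  congr 1 <;> simp [sub_eq_add_neg]

theorem gammaMat_mulVec {ι : Type} [Fintype ι] [DecidableEq ι] (π : ι → ι) (g u : ι → ℂ) (i : ι) :
    (gammaMat π g).mulVec u i = g (π i) * u (π i) := by
  rw [Matrix.mulVec, dotProduct, Finset.sum_eq_single (π i)]
  · simp [gammaMat]
  · intro b _ hb
    simp [gammaMat, hb]
  · simp

theorem gammaMat_map_mulVec {ι : Type} [Fintype ι] [DecidableEq ι] (π : ι → ι) (g u : ι → ℂ)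
    (i : ι) : ((gammaMat π g).map conj).mulVec u i = conj (g (π i)) * u (π i) := by
  rw [Matrix.mulVec, dotProduct, Finset.sum_eq_single (π i)]
  · simp [gammaMat]
  · intro b _ hb
    simp [gammaMat, hb]
  · simp

/-- The linear map couples only $z_j$ and $w_{\pi j}$, by a block of trace $G_j-2$ and determinant
one, whose characteristic equation is $(1+x)^2=G_jx$. -/
theorem exists_of_mem_spectrum {x : ℂ} (hx : x ∈ spectrum ℂ D.sigma) :
    ∃ j, (1 + x) ^ 2 = D.gCoeff j * conj (D.gCoeff (partner j)) * x := by
  rw [← Matrix.spectrum_toLin', ← Module.End.hasEigenvalue_iff_mem_spectrum] at hx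
  obtain ⟨v, hv, hv0⟩ := hx.exists_hasEigenvector
  rw [Module.End.mem_eigenspace_iff, Matrix.toLin'_apply] at hv
  by_contra! hno
  have hπ := partner_involutive (e := e) (h := h) (s := s)
  set g := D.gCoeff
  set z : Index e h s → ℂ := fun i => v (Sum.inl i) with hz
  set w : Index e h s → ℂ := fun i => v (Sum.inr i) with hw
  have hvzw : v = Sum.elim z w := by
    funext t; rcases t with t | t <;> rfl
  rw [hvzw, sigma_eq, Matrix.fromBlocks_mulVec, gammaInv_eq, Matrix.sub_mulVec,
    ← Matrix.mulVec_mulVec, Sum.elim_comp_inl, Sum.elim_comp_inr] at hv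
  have h1 : ∀ i, -z i - conj (g (partner i)) * w (partner i) = x * z i := by
    intro i
    have := congrFun hv (Sum.inl i)
    simp only [Sum.elim_inl, Pi.add_apply, Matrix.neg_mulVec, Matrix.one_mulVec, Pi.neg_apply,
      Pi.smul_apply, smul_eq_mul] at this
    rw [gammaMat_map_mulVec] at this
    linear_combination this
  have h2 : ∀ i, g (partner i) * z (partner i) +
      g (partner i) * (conj (g i) * w i) - w i = x * w i := by
    intro i
    have := congrFun hv (Sum.inr i)
    simp only [Sum.elim_inr, Pi.add_apply, Pi.sub_apply, Matrix.one_mulVec,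
      Pi.smul_apply, smul_eq_mul] at this
    rw [gammaMat_mulVec, gammaMat_mulVec, gammaMat_map_mulVec, hπ i] at this
    linear_combination this
  have hz0 : ∀ i, z i = 0 := by
    intro i
    have h3 := h1 i
    have h4 := h2 (partner i)
    rw [hπ i] at h4
    have h5 : ((1 + x) ^ 2 - g i * conj (g (partner i)) * x) * z i = 0 := by
      linear_combination (-(1 + x) + g i * conj (g (partner i))) * h3 +
        conj (g (partner i)) * h4
    exact (mul_eq_zero.1 h5).resolve_left (sub_ne_zero.2 (hno i))
  -- With `z = 0`, a nonzero `w i` forces `conj (g i) = 0` and `x = -1`, and then the excluded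
  -- equation holds at `partner i`.
  have hw0 : ∀ i, w i = 0 := by
    intro i
    have h3 := h1 (partner i)
    have h4 := h2 i
    rw [hπ i, hz0] at h3
    rw [hz0] at h4
    by_contra hwi
    have h5 : conj (g i) * w i = 0 := by linear_combination -h3
    have h6 : (1 + x) * w i = 0 := by linear_combination -h4 + g (partner i) * h5
    have h7 := (mul_eq_zero.1 h5).resolve_right hwi
    have h8 := (mul_eq_zero.1 h6).resolve_right hwi
    refine hno (partner i) ?_
    rw [hπ i, h7, h8]
    ring
  refine hv0 ?_
  rw [hvzw]
  funext t
  rcases t with t | t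
  · exact hz0 t
  · exact hw0 t

/-- The roots of `(1 + x)² = G x`. -/
def pairRoots (G : ℂ) : Finset ℂ :=
  ((Polynomial.X : Polynomial ℂ) ^ 2 + (Polynomial.C (2 - G) * Polynomial.X + 1)).roots.toFinset

theorem natDegree_pairRoots (G : ℂ) :
    ((Polynomial.X : Polynomial ℂ) ^ 2 + (Polynomial.C (2 - G) * Polynomial.X + 1)).natDegree = 2 := by
  compute_degree!

theorem mem_pairRoots {G x : ℂ} : x ∈ pairRoots G ↔ (1 + x) ^ 2 = G * x := by
  have hne : (Polynomial.X : Polynomial ℂ) ^ 2 + (Polynomial.C (2 - G) * Polynomial.X + 1) ≠ 0 :=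
    fun h => by
      have h1 := natDegree_pairRoots G
      rw [h, Polynomial.natDegree_zero] at h1
      omega
  rw [pairRoots, Multiset.mem_toFinset, Polynomial.mem_roots hne, Polynomial.IsRoot.def]
  simp only [Polynomial.eval_add, Polynomial.eval_pow, Polynomial.eval_X, Polynomial.eval_mul,
    Polynomial.eval_C, Polynomial.eval_one]
  constructor <;> intro h <;> linear_combination h

theorem card_pairRoots_le (G : ℂ) : (pairRoots G).card ≤ 2 :=
  (Multiset.toFinset_card_le _).trans ((Polynomial.card_roots' _).trans (natDegree_pairRoots G).le)

/-- All eigenvalues are roots of $p$ quadratic equations, so $2p$ of them leave no room for a double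
root ($G=0$ or $G=4$) or for two equal equations. -/
theorem HasDistinctEigenvalues.isRegular (hD : D.HasDistinctEigenvalues) :
    IsRegular partner D.gCoeff := by
  set G : Index e h s → ℂ := fun j => D.gCoeff j * conj (D.gCoeff (partner j)) with hG
  -- Representatives of all values of `G` already account for the whole spectrum.
  have hsub : ∀ S : Finset (Index e h s), (∀ j, ∃ i ∈ S, G i = G j) →
      2 * Fintype.card (Index e h s) ≤ ∑ i ∈ S, (pairRoots (G i)).card := by
    intro S hS
    rw [← hD]
    refine le_trans ?_ (Finset.card_biUnion_le (s := S) (t := fun i => pairRoots (G i)))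
    rw [← Set.ncard_coe_finset]
    refine Set.ncard_le_ncard (fun x hx => ?_) (Finset.finite_toSet _)
    obtain ⟨j, hj⟩ := D.exists_of_mem_spectrum hx
    obtain ⟨i, hi, hij⟩ := hS j
    refine Finset.mem_coe.2 (Finset.mem_biUnion.2 ⟨i, hi, mem_pairRoots.2 ?_⟩)
    rw [hij]
    exact hj
  have htwo : ∀ j, (pairRoots (G j)).card = 2 := by
    intro j
    refine le_antisymm (card_pairRoots_le _) ?_
    by_contra! hlt
    have h1 := hsub Finset.univ fun j => ⟨j, Finset.mem_univ _, rfl⟩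
    have h2 : ∑ i, (pairRoots (G i)).card < ∑ _i : Index e h s, 2 :=
      Finset.sum_lt_sum (fun i _ => card_pairRoots_le _) ⟨j, Finset.mem_univ _, hlt⟩
    rw [Finset.sum_const, smul_eq_mul, Finset.card_univ] at h2
    omega
  have hsingle : ∀ j c, (∀ x, (1 + x) ^ 2 = G j * x → x = c) → False := by
    intro j c hc
    have h1 : pairRoots (G j) ⊆ {c} := fun x hx => Finset.mem_singleton.2 (hc x (mem_pairRoots.1 hx))
    have h2 := Finset.card_le_card h1
    rw [htwo, Finset.card_singleton] at h2
    omega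
  refine ⟨fun i j hij => ?_, fun j hj => ?_, fun j hj => ?_⟩
  · by_contra hne
    have h1 := hsub (Finset.univ.erase j) fun k => by
      by_cases hk : k = j
      · exact ⟨i, Finset.mem_erase.2 ⟨hne, Finset.mem_univ _⟩, hk ▸ hij⟩
      · exact ⟨k, Finset.mem_erase.2 ⟨hk, Finset.mem_univ _⟩, rfl⟩
    have h2 : ∑ i ∈ Finset.univ.erase j, (pairRoots (G i)).card ≤
        ∑ _i ∈ Finset.univ.erase j, 2 := Finset.sum_le_sum fun i _ => card_pairRoots_le _
    rw [Finset.sum_const, smul_eq_mul, Finset.card_erase_of_mem (Finset.mem_univ _),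
      Finset.card_univ] at h2
    have h3 : 0 < Fintype.card (Index e h s) := Fintype.card_pos_iff.2 ⟨j⟩
    omega
  · refine hsingle j (-1) fun x hx => ?_
    rw [hG] at hx
    simp only [hj, zero_mul] at hx
    have := pow_eq_zero_iff two_ne_zero |>.1 hx
    linear_combination this
  · refine hsingle j 1 fun x hx => ?_
    have hGj : G j = 4 := hj
    rw [hGj] at hx
    have h3 : (x - 1) ^ 2 = 0 := by linear_combination hx
    have := pow_eq_zero_iff two_ne_zero |>.1 h3
    linear_combination this

end ProductQuadric

/-- The two roots of $(1+x)^2=Gx$ have product one. -/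
theorem IsAdmissible.eq_or_eq_inv {ι : Type} [Fintype ι] {π : ι → ι} {g ν ν' : ι → ℂ}
    (h : IsAdmissible π g ν) (h' : IsAdmissible π g ν') (j : ι) : ν' j = ν j ∨ ν' j = (ν j)⁻¹ := by
  have h1 := h.eq j
  have h2 := h'.eq j
  have h3 := h.ne_zero j
  have h4 : (ν' j - ν j) * (ν j * ν' j - 1) = 0 := by
    linear_combination ν j * h2 - ν' j * h1
  rcases mul_eq_zero.1 h4 with h5 | h5
  · exact Or.inl (sub_eq_zero.1 h5)
  · exact Or.inr (eq_inv_of_mul_eq_one_right (sub_eq_zero.1 h5))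

/-! ### The admissible vectors are the vectors $\nu_\epsilon$. -/

namespace ProductQuadric

section

variable {h s : ℕ} (D : ProductQuadric 0 h s)

theorem muS_ne_zero (i : Fin s) : D.muS i ≠ 0 := by
  have h1 : conj (D.γs i) ≠ 0 := (_root_.map_ne_zero _).2 (D.γs_ne_zero i)
  have h2 := D.one_sub_conj_γs_ne_zero i
  rw [muS, inv_eq_one_div, div_sub_one h1]
  exact div_ne_zero h2 h1

theorem gCoeff_hyp_le (hg : IsRegular partner D.gCoeff) (i : Fin h) :
    0 ≤ ((D.γh i)⁻¹).toReal / 2 ∧ ((D.γh i)⁻¹).toReal / 2 ≤ 1 := by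
  have h1 := D.half_lt_γh (D.γh_ne_top hg i)
  refine ⟨by positivity, ?_⟩
  rw [ENNReal.toReal_inv, div_le_one two_pos]
  exact inv_le_of_inv_le₀ (by linarith) (by linarith)

theorem lamH_mul_conj (hg : IsRegular partner D.gCoeff) (i : Fin h) :
    D.lamH i * conj (D.lamH i) = 1 := by
  obtain ⟨h1, h2⟩ := D.gCoeff_hyp_le hg i
  rw [Complex.mul_conj, Complex.normSq_apply, lamH, Real.mul_self_sqrt (by nlinarith)]
  norm_num
  ring

theorem lamH_add_conj (i : Fin h) :
    D.lamH i + conj (D.lamH i) = (((D.γh i)⁻¹).toReal : ℂ) := by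
  rw [Complex.add_conj, lamH]
  push_cast
  ring

theorem isAdmissible_nu (hg : IsRegular partner D.gCoeff) (εh : Fin h → ℤˣ) (εs : Fin s → ℤˣ) :
    IsAdmissible partner D.gCoeff (D.nu εh εs) := by
  -- The equation is invariant under inversion of `x`, so the signs play no role in it.
  have key : ∀ (x G : ℂ) (ε : ℤˣ), (1 + x) ^ 2 = G * x → x ≠ 0 →
      (1 + x ^ (ε : ℤ)) ^ 2 = G * x ^ (ε : ℤ) := by
    intro x G ε hx hx0
    rcases Int.units_eq_one_or ε with rfl | rfl
    · simpa using hx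
    · simp only [Units.val_neg, Units.val_one, zpow_neg, zpow_one]
      field_simp
      linear_combination hx
  refine ⟨fun j => ?_, fun j => ?_⟩
  · rcases j with i | i | i | i
    · exact i.elim0
    · have h1 := D.lamH_mul_conj hg i
      have h2 := D.lamH_add_conj i
      have h3 : D.lamH i ≠ 0 := left_ne_zero_of_mul_eq_one h1
      refine key _ _ _ ?_ (pow_ne_zero 2 h3)
      simp only [partner, gCoeff, Complex.conj_ofReal, muH]
      rw [← h2]
      linear_combination (-(1 + D.lamH i ^ 2) - D.lamH i * (D.lamH i + conj (D.lamH i))) * h1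
    · refine key _ _ _ ?_ ((_root_.map_ne_zero _).2 (D.muS_ne_zero i))
      have h1 := D.γs_ne_zero i
      have h2 := D.one_sub_γs_ne_zero i
      simp only [partner, gCoeff, muS, map_sub, map_inv₀, Complex.conj_conj, map_one]
      field_simp
      ring
    · have h1 := D.one_sub_conj_γs_ne_zero i
      have h2 : conj (D.γs i) ≠ 0 := (_root_.map_ne_zero _).2 (D.γs_ne_zero i)
      simp only [nu]
      rw [zpow_neg, ← inv_zpow]
      refine key _ _ _ ?_ (inv_ne_zero (D.muS_ne_zero i))
      have h3 : (D.muS i)⁻¹ = conj (D.γs i) / (1 - conj (D.γs i)) := by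
        rw [muS, inv_eq_one_div (conj (D.γs i)), div_sub_one h2, inv_div]
      rw [h3]
      simp only [partner, gCoeff, map_inv₀]
      field_simp
      ring
  · have h0 : ∀ i, conj (D.muS i) ≠ 0 := fun i => (_root_.map_ne_zero _).2 (D.muS_ne_zero i)
    rcases j with i | i | i | i
    · exact i.elim0
    · simp only [partner, nu]
      rw [map_zpow₀, ← mul_zpow, muH, map_pow, ← mul_pow, mul_comm, D.lamH_mul_conj hg, one_pow,
        one_zpow]
    · simp only [partner, nu]
      rw [map_zpow₀, ← zpow_add₀ (h0 i), neg_add_cancel, zpow_zero]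
    · simp only [partner, nu]
      rw [map_zpow₀, Complex.conj_conj, ← zpow_add₀ (D.muS_ne_zero i), add_neg_cancel, zpow_zero]

/-- Each entry is one of two reciprocal roots, which fixes a sign at every hyperbolic index and at
every first coordinate of a couple. The reality condition then forces the second coordinate, so a
couple has a single sign. -/
theorem exists_nu_eq (hg : IsRegular partner D.gCoeff) {ν : Index 0 h s → ℂ}
    (hν : IsAdmissible partner D.gCoeff ν) : ∃ εh εs, D.nu εh εs = ν := by
  have h1 := fun j => (D.isAdmissible_nu hg 1 1).eq_or_eq_inv hν j
  have hh : ∀ i, ∃ ε : ℤˣ, D.muH i ^ (ε : ℤ) = ν (Index.hyp i) := by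
    intro i
    rcases h1 (Index.hyp i) with h2 | h2
    · exact ⟨1, by rw [h2]; rfl⟩
    · exact ⟨-1, by rw [h2]; simp [nu]⟩
  have hs : ∀ i, ∃ ε : ℤˣ, conj (D.muS i) ^ (ε : ℤ) = ν (Index.fst i) := by
    intro i
    rcases h1 (Index.fst i) with h2 | h2
    · exact ⟨1, by rw [h2]; rfl⟩
    · exact ⟨-1, by rw [h2]; simp [nu]⟩
  choose εh hεh using hh
  choose εs hεs using hs
  refine ⟨εh, εs, ?_⟩
  have hA := D.isAdmissible_nu hg εh εs
  funext j
  rcases j with i | i | i | i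
  · exact i.elim0
  · exact hεh i
  · exact hεs i
  · have h2 := hA.conj_eq (Index.snd i)
    have h3 := hν.conj_eq (Index.snd i)
    have h4 : D.nu εh εs (partner (Index.snd i)) = ν (partner (Index.snd i)) := hεs i
    rw [h4, h3] at h2
    exact (inv_injective h2).symm

theorem zpow_units_injective {x : ℂ} (h0 : x ≠ 0) (h1 : x ^ 2 ≠ 1) {ε ε' : ℤˣ}
    (h : x ^ (ε : ℤ) = x ^ (ε' : ℤ)) : ε = ε' := by
  rcases Int.units_eq_one_or ε with rfl | rfl <;> rcases Int.units_eq_one_or ε' with rfl | rfl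
  · rfl
  · refine absurd ?_ h1
    simp only [Units.val_neg, Units.val_one, zpow_neg, zpow_one] at h
    rw [pow_two]; nth_rw 1 [h]; exact inv_mul_cancel₀ h0
  · refine absurd ?_ h1
    simp only [Units.val_neg, Units.val_one, zpow_neg, zpow_one] at h
    rw [pow_two]; nth_rw 1 [← h]; exact inv_mul_cancel₀ h0
  · rfl

theorem nu_injective (hg : IsRegular partner D.gCoeff) :
    Function.Injective fun ε : (Fin h → ℤˣ) × (Fin s → ℤˣ) => D.nu ε.1 ε.2 := by
  rintro ⟨εh, εs⟩ ⟨εh', εs'⟩ heq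
  have h1 := D.isAdmissible_nu hg 1 1
  have hsq : ∀ j, D.nu 1 1 j ≠ 0 ∧ D.nu 1 1 j ^ 2 ≠ 1 := fun j => ⟨h1.ne_zero j, h1.sq_ne_one hg j⟩
  refine Prod.ext (funext fun i => ?_) (funext fun i => ?_)
  · have h2 := hsq (Index.hyp i)
    simp only [nu, Pi.one_apply, Units.val_one, zpow_one] at h2
    exact zpow_units_injective h2.1 h2.2 (congrFun heq (Index.hyp i))
  · have h2 := hsq (Index.fst i)
    simp only [nu, Pi.one_apply, Units.val_one, zpow_one] at h2
    exact zpow_units_injective h2.1 h2.2 (congrFun heq (Index.fst i))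

theorem setOf_isAdmissible (hg : IsRegular partner D.gCoeff) :
    {ν | IsAdmissible partner D.gCoeff ν} =
      Set.range fun ε : (Fin h → ℤˣ) × (Fin s → ℤˣ) => D.nu ε.1 ε.2 := by
  ext ν
  constructor
  · intro hν
    obtain ⟨εh, εs, h1⟩ := D.exists_nu_eq hg hν
    exact ⟨(εh, εs), h1⟩
  · rintro ⟨ε, rfl⟩
    exact D.isAdmissible_nu hg ε.1 ε.2

theorem finite_isAdmissible (hg : IsRegular partner D.gCoeff) :
    {ν | IsAdmissible partner D.gCoeff ν}.Finite := by
  rw [D.setOf_isAdmissible hg]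
  exact Set.finite_range _

theorem encard_isAdmissible (hg : IsRegular partner D.gCoeff) (hp : 0 < h + s) :
    {ν | IsAdmissible partner D.gCoeff ν}.encard = 2 * 2 ^ (h + s - 1) := by
  rw [D.setOf_isAdmissible hg, ← Set.image_univ, (D.nu_injective hg).encard_image, Set.encard_univ,
    ENat.card_eq_coe_fintype_card, Fintype.card_prod, Fintype.card_fun, Fintype.card_fun,
    Fintype.card_units_int, Fintype.card_fin, Fintype.card_fin, ← pow_add, ← pow_succ',
    Nat.sub_add_cancel hp]
  push_cast; rfl

theorem nonempty_index (hp : 0 < h + s) : Nonempty (Index 0 h s) := by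
  rcases Nat.eq_zero_or_pos h with h0 | h0
  · exact ⟨Index.fst ⟨0, by omega⟩⟩
  · exact ⟨Index.hyp ⟨0, h0⟩⟩

end

end ProductQuadric

theorem two_mul_le_two_mul_iff {a b : ℕ∞} : 2 * a ≤ 2 * b ↔ a ≤ b :=
  ENat.mul_le_mul_left_iff two_ne_zero (by simp)

end CRSing

end

/-! ### Assembly of the four assertions. -/

open CRSing in
theorem mainTheorem9 :
    -- (i)
    (∀ (e h s : ℕ) (D : ProductQuadric e h s), D.HasDistinctEigenvalues →
      ∀ H : Index e h s → MvPowerSeries (Index e h s ⊕ Index e h s) ℂ, IsThirdOrder H →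
        (∃ K, IsAttached (manifold (D.quadric + H)) K) → e = 0) ∧
    -- (ii)
    (∀ (h s : ℕ) (D : ProductQuadric 0 h s), 0 < h + s → D.HasDistinctEigenvalues →
      ∃ K, IsComplexSubmanifold (Fintype.card (Index 0 h s)) K ∧
        2 ^ (h + s - 1) ≤ (analyticAsymptoticPairsIn (manifold D.quadric) K).encard) ∧
    -- (iii)
    (∀ γ₁ γ₂ : ℝ, 1 / 2 < γ₁ → 1 / 2 < γ₂ →
      ¬ ∃ K, IsAttached (manifold (exampleE γ₁ γ₂)) K) ∧
    -- (iv)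
    (∀ (h s : ℕ) (D : ProductQuadric 0 h s), 0 < h + s → D.HasDistinctEigenvalues →
      ∀ H : Index 0 h s → MvPowerSeries (Index 0 h s ⊕ Index 0 h s) ℂ, IsThirdOrder H →
        HasMaximalDeck (D.quadric + H) →
        (∀ (εh : Fin h → ℤˣ) (εs : Fin s → ℤˣ), IsNonResonant (D.nu εh εs) →
          ∃! K : Ideal (RealSeries (Index 0 h s ⊕ Index 0 h s)) ×
              Ideal (RealSeries (Index 0 h s ⊕ Index 0 h s)),
            IsAsymptoticPair (manifold (D.quadric + H)) K.1 K.2 ∧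
            ∃ P₁ P₂ : Index 0 h s → MvPowerSeries (Index 0 h s) ℂ,
              IsAntiholomorphicInvolution P₁ ∧ IsAntiholomorphicInvolution P₂ ∧
              K.1 = fixedIn (manifold (D.quadric + H)) P₁ ∧
              K.2 = fixedIn (manifold (D.quadric + H)) P₂ ∧
              ((linearPart P₂)⁻¹ * linearPart P₁).charpoly =
                ∏ j, (Polynomial.X - Polynomial.C (D.nu εh εs j))) ∧
        ((∀ (εh : Fin h → ℤˣ) (εs : Fin s → ℤˣ), IsNonResonant (D.nu εh εs)) →
          (asymptoticPairs (manifold (D.quadric + H))).encard = 2 ^ (h + s - 1))) := by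
  refine ⟨?_, ?_, ?_, ?_⟩
  · intro e h s D hD H hH hK
    have hg := hD.isRegular
    obtain ⟨ν, hν⟩ := (D.isPerturbation hg hH).exists_admissible_of_isAttached hg hK
    by_contra he
    let i : Fin e := ⟨0, Nat.pos_of_ne_zero he⟩
    -- At an elliptic index, fixed by `partner`, admissibility bounds $\gamma_e^{-1}$ by two,
    -- whereas $\gamma_e<1/2$.
    have h1 := hν.norm_le (j := Index.ell i) rfl
    have h2 := D.γe_pos i
    have h3 := D.γe_lt i
    have h4 : ‖D.gCoeff (Index.ell i)‖ = (D.γe i)⁻¹ := by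
      rw [← abs_of_pos (inv_pos.2 h2), ← Real.norm_eq_abs, ← Complex.norm_real,
        Complex.ofReal_inv]
      rfl
    rw [h4] at h1
    have h5 : (D.γe i)⁻¹ * D.γe i = 1 := inv_mul_cancel₀ h2.ne'
    nlinarith
  · intro h s D hp hD
    have hg := hD.isRegular
    have := ProductQuadric.nonempty_index hp
    -- The bound is doubled so that it compares the number of admissible vectors with twice the
    -- number of unordered pairs of leaves.
    refine ⟨complexGraph (leafGraph ProductQuadric.partner D.gCoeff D.qCoeff),
      isComplexSubmanifold_leafGraph, two_mul_le_two_mul_iff.1 ?_⟩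
    rw [← D.encard_isAdmissible hg hp]
    exact encard_le_two_mul_encard_analyticAsymptoticPairsIn ProductQuadric.partner_involutive hg
      (D.quadric_eq hg) (D.finite_isAdmissible hg)
  · intro γ₁ γ₂ h₁ h₂
    exact not_isAttached_exampleE (by linarith) (by linarith)
  · intro h s D hp hD H hH hdeck
    have hg := hD.isRegular
    have := ProductQuadric.nonempty_index hp
    have hE := D.isPerturbation hg hH
    refine ⟨fun εh εs hn => hE.existsUnique_pair hg hdeck (D.isAdmissible_nu hg εh εs) hn,
      fun hn => ?_⟩
    have h1 := hE.two_mul_encard_asymptoticPairs hg hdeck (D.finite_isAdmissible hg) fun ν hν => by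
      obtain ⟨εh, εs, rfl⟩ := D.exists_nu_eq hg hν
      exact hn εh εs
    rw [D.encard_isAdmissible hg hp] at h1
    exact le_antisymm (two_mul_le_two_mul_iff.1 h1.le) (two_mul_le_two_mul_iff.1 h1.ge)
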